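/- Let $k$ be a perfect field of characteristic $p>0$. A Frobenius lifting of a $k$-scheme $X$ is a pair $(\widetilde X,\widetilde F_X)$ consisting of a flat $W_2(k)$-scheme $\widetilde X$ together with an isomorphism $X\cong \widetilde X\times_{\operatorname{Spec}W_2(k)}\operatorname{Spec}k$ of $k$-schemes, and a morphism $\widetilde F_X\colon\widetilde X\to\widetilde X$ which restricts to the absolute Frobenius $F_X\colon X\to X$; the scheme $X$ is called $F$-liftable if it has a Frobenius lifting. Let $X$ and $Y$ be non-empty smooth and proper schemes over $k$. (1) The product $X\times_k Y$ is $F$-liftable if and only if both $X$ and $Y$ are $F$-liftable. (2) Suppose moreover that $X$ and $Y$ are geometrically connected over $k$. Then every Frobenius lifting $(\widetilde Z,\widetilde F)$ of $X\times_k Y$ is a product of Frobenius liftings of the factors: there are Frobenius liftings $(\widetilde X,\widetilde F_X)$ of $X$ and $(\widetilde Y,\widetilde F_Y)$ of $Y$, and $W_2(k)$-morphisms $q_1\colon\widetilde Z\to\widetilde X$ and $q_2\colon\widetilde Z\to\widetilde Y$ lifting the projections $X\times_k Y\to X$ and $X\times_k Y\to Y$, such that $(q_1,q_2)\colon \widetilde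 Z\to\widetilde X\times_{\operatorname{Spec} W_2(k)}\widetilde Y$ is an isomorphism and $q_1\circ\widetilde F=\widetilde F_X\circ q_1$, $q_2\circ\widetilde F=\widetilde F_Y\circ q_2$. -/

import Mathlib

open CategoryTheory CategoryTheory.Limits AlgebraicGeometry

universe u

namespace FLift

/-- The `p`-th power map `x ↦ x ^ p` of a commutative ring in which the prime `p` is zero
(the zero ring is allowed). -/
def powRingHom (p : ℕ) [hp : Fact p.Prime] (R : Type u) [CommRing R] (h : (p : R) = 0) :
    R →+* R where
  toFun x := x ^ p
  map_one' := one_pow p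
  map_mul' x y := mul_pow x y p
  map_zero' := zero_pow hp.out.ne_zero
  map_add' x y := by
    obtain ⟨r, hr⟩ := exists_add_pow_prime_eq hp.out x y
    rw [hr, h]; ring

/-- The prime `p` is zero in every ring of sections of a scheme over a field of
characteristic `p`. -/
theorem natCast_sections_eq_zero (p : ℕ) {k : Type u} [Field k] [CharP k p]
    {X : Scheme.{u}} (f : X ⟶ Spec (.of k)) (U : X.Opens) : (p : Γ(X, U)) = 0 := by
  have h : (p : k) = 0 := CharP.cast_eq_zero k p
  let φ : k →+* Γ(X, U) :=
    (X.presheaf.map (homOfLE le_top : U ⟶ ⊤).op).hom.comp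
      ((f.appTop).hom.comp ((Scheme.ΓSpecIso (.of k)).inv.hom))
  rw [← map_natCast φ p, h, map_zero]

/-- The absolute Frobenius of a scheme over a field of characteristic `p`, as a morphism of
presheafed spaces: the identity on points, and `s ↦ s ^ p` on sections. -/
noncomputable def absFrobeniusAux (p : ℕ) [Fact p.Prime] {k : Type u} [Field k] [CharP k p]
    {X : Scheme.{u}} (f : X ⟶ Spec (.of k)) :
    PresheafedSpace.Hom X.toPresheafedSpace X.toPresheafedSpace where
  base := 𝟙 _
  c :=
    { app := fun U => CommRingCat.ofHom
        (powRingHom p (X.presheaf.obj U) (natCast_sections_eq_zero p f U.unop))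
      naturality := by
        intro U V i
        ext s
        exact (map_pow (X.presheaf.map i).hom s p).symm }

/-- The absolute Frobenius `F_X : X ⟶ X` of a scheme `X` over a field of characteristic `p`:
the identity on points, and `s ↦ s ^ p` on sections. -/
noncomputable def absFrobenius (p : ℕ) [hp : Fact p.Prime] {k : Type u} [Field k] [CharP k p]
    {X : Scheme.{u}} (f : X ⟶ Spec (.of k)) : X ⟶ X where
  toHom := absFrobeniusAux p f
  prop := by
    intro x
    refine ⟨fun a ha => ?_⟩
    obtain ⟨U, hxU, s, rfl⟩ := X.presheaf.exists_germ_eq (x := x) a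
    have key : ((absFrobeniusAux p f).stalkMap x).hom (X.presheaf.germ U x hxU s) =
        (X.presheaf.germ U x hxU s) ^ p := by
      rw [← map_pow]
      exact PresheafedSpace.stalkMap_germ_apply (absFrobeniusAux p f) U x hxU s
    exact (isUnit_pow_iff hp.out.ne_zero).mp (key ▸ ha)

theorem absFrobenius_apply (p : ℕ) [Fact p.Prime] {k : Type u} [Field k] [CharP k p]
    {X : Scheme.{u}} (f : X ⟶ Spec (.of k)) (x : X) : absFrobenius p f x = x := rfl

theorem absFrobenius_app (p : ℕ) [Fact p.Prime] {k : Type u} [Field k] [CharP k p]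
    {X : Scheme.{u}} (f : X ⟶ Spec (.of k)) (U : X.Opens) (s : Γ(X, U)) :
    (absFrobenius p f).app U s = s ^ p := rfl

/-- The reduction map `W₂(k) → k`, sending a Witt vector `(x₀, x₁)` to `x₀`. -/
noncomputable def reduction (p : ℕ) [Fact p.Prime] (k : Type u) [CommRing k] :
    TruncatedWittVector p 2 k →+* k where
  toFun x := x.coeff 0
  map_one' := by
    rw [← map_one (WittVector.truncate 2), WittVector.coeff_truncate]
    exact map_one (WittVector.constantCoeff (p := p) (R := k))
  map_mul' x y := by
    obtain ⟨x, rfl⟩ := WittVector.truncate_surjective p 2 k x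
    obtain ⟨y, rfl⟩ := WittVector.truncate_surjective p 2 k y
    rw [← map_mul]
    simp only [WittVector.coeff_truncate]
    exact map_mul (WittVector.constantCoeff (p := p) (R := k)) x y
  map_zero' := by
    rw [← map_zero (WittVector.truncate 2), WittVector.coeff_truncate]
    exact map_zero (WittVector.constantCoeff (p := p) (R := k))
  map_add' x y := by
    obtain ⟨x, rfl⟩ := WittVector.truncate_surjective p 2 k x
    obtain ⟨y, rfl⟩ := WittVector.truncate_surjective p 2 k y
    rw [← map_add]
    simp only [WittVector.coeff_truncate]
    exact map_add (WittVector.constantCoeff (p := p) (R := k)) x y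

/-- The scheme `Spec W₂(k)`. -/
noncomputable abbrev SpecW2 (p : ℕ) [Fact p.Prime] (k : Type u) [CommRing k] : Scheme.{u} :=
  Spec (.of (TruncatedWittVector p 2 k))

/-- The closed immersion `Spec k ⟶ Spec W₂(k)`. -/
noncomputable def specReduction (p : ℕ) [Fact p.Prime] (k : Type u) [CommRing k] :
    Spec (.of k) ⟶ SpecW2 p k :=
  Spec.map (CommRingCat.ofHom (reduction p k))

/-- A Frobenius lifting of a `k`-scheme `f : X ⟶ Spec k`: a flat scheme `X'` over `W₂(k)`
together with an identification `X ≅ X' ×_{W₂(k)} k` of `k`-schemes (given by the cartesian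
square of `incl : X ⟶ X'`), and a morphism `frob : X' ⟶ X'` which restricts to the absolute
Frobenius of `X`. -/
structure FrobeniusLifting (p : ℕ) [Fact p.Prime] {k : Type u} [Field k] [CharP k p]
    {X : Scheme.{u}} (f : X ⟶ Spec (.of k)) where
  /-- The lifting of `X`. -/
  scheme : Scheme.{u}
  /-- The structure morphism of the lifting. -/
  str : scheme ⟶ SpecW2 p k
  flat : Flat str
  /-- The inclusion of `X` as the special fibre. -/
  incl : X ⟶ scheme
  isPullback : IsPullback incl f str (specReduction p k)
  /-- The lifting of the absolute Frobenius. -/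
  frob : scheme ⟶ scheme
  incl_frob : incl ≫ frob = absFrobenius p f ≫ incl

/-- A `k`-scheme is `F`-liftable if it has a Frobenius lifting. -/
def IsFLiftable (p : ℕ) [Fact p.Prime] {k : Type u} [Field k] [CharP k p]
    {X : Scheme.{u}} (f : X ⟶ Spec (.of k)) : Prop :=
  Nonempty (FrobeniusLifting p f)

/-- The structure morphism of the product `X × Y` of two `k`-schemes. -/
noncomputable abbrev prodStr {k : Type u} [Field k] {X Y : Scheme.{u}}
    (f : X ⟶ Spec (.of k)) (g : Y ⟶ Spec (.of k)) : pullback f g ⟶ Spec (.of k) :=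
  pullback.fst f g ≫ f

/-- A Frobenius lifting `L = (Z', F)` of `X × Y` is the product of the Frobenius liftings
`LX = (X', F_{X'})` and `LY = (Y', F_{Y'})` if there are `W₂(k)`-morphisms `q₁ : Z' ⟶ X'` and
`q₂ : Z' ⟶ Y'` which exhibit `Z'` as the fibre product of `X'` and `Y'` over `W₂(k)`, which
lift the two projections of `X × Y`, and for which `F` is `F_{X'} × F_{Y'}`. -/
def FrobeniusLifting.IsProduct {p : ℕ} [Fact p.Prime] {k : Type u} [Field k] [CharP k p]
    {X Y : Scheme.{u}} {f : X ⟶ Spec (.of k)} {g : Y ⟶ Spec (.of k)}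
    (L : FrobeniusLifting p (prodStr f g)) (LX : FrobeniusLifting p f)
    (LY : FrobeniusLifting p g) : Prop :=
  ∃ (q₁ : L.scheme ⟶ LX.scheme) (q₂ : L.scheme ⟶ LY.scheme),
    q₁ ≫ LX.str = L.str ∧ q₂ ≫ LY.str = L.str ∧
    IsPullback q₁ q₂ LX.str LY.str ∧
    L.incl ≫ q₁ = pullback.fst f g ≫ LX.incl ∧
    L.incl ≫ q₂ = pullback.snd f g ≫ LY.incl ∧
    L.frob ≫ q₁ = q₁ ≫ LX.frob ∧
    L.frob ≫ q₂ = q₂ ≫ LY.frob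

end FLift

/-! A Frobenius lifting of a reduced scheme can be read off inside Witt vectors of length two. If
`S` is a flat lift of `A` with a lift `F` of Frobenius, then `F x = x ^ p + p δ(x)`, and `x ↦ (x,
δ(x))` modulo `p` is a ring map `S → W₂(A)`, injective when `A` is reduced. Its image surjects onto
`A` and meets the ideal `V(A)` exactly in `V(A ^ p)` (`IsFrobSubring`). Conversely such a subring is
a flat lift, with `F` induced by `W₂` of Frobenius. Liftings thus become compatible families of
subrings (`FrobFamily`), and questions about them become questions about second Witt components
modulo `p`-th powers.

For (1), a functional `ρ` on `B = Γ(Y, V)` with `ρ 1 = 1` gives an `A`-linear retraction `A ⊗ B →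
A`, which preserves `p`-th powers because `k` is perfect. It carries a Frobenius subring of `W₂(A ⊗
B)` to one of `W₂(A)` (`PthRetraction.isFrobSubring_descend`), naturally in `A`. The converse is the
fibre product of liftings.

For (2), take instead all `w` in `W₂(Γ(X, U))` whose pullback to `U × Y` comes from the given
lifting. The difficulty is that every `a` in `Γ(X, U)` should be a first component. Lifts of `a`
over the various `U × V` have second components forming a section of `O / O ^ p` over `U × Y`, which
must come from `U`. Expanding in a basis of `Γ(X, U)` adapted to the subspace of `p`-th powers
reduces this to `H⁰(Y, O) = k` and `H⁰(Y, O / O ^ p) = 0` (`exists_eq_tmul_one_add_pow`).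

The last vanishing is the heart (`exists_eq_pow_of_frobFamily`). By normality it is checked at
generic points. On the differentials of the function field `K`, the lifting defines a
Frobenius-semilinear map `ζ`, morally `dF / p`, which represents the inverse Cartier operator and is
injective modulo exact forms. For a section `t` of `O / O ^ p`, properness centres each valuation
ring of `K` over `k` on an affine open, so that `dt` lies in a finitely generated `ζ`-stable module
over it. A determinant computation then shows that a shortest linear relation among the iterates
`ζⁱ(dt)` has coefficients in all these valuation rings, hence algebraic over `k`. Extracting `p`-th
roots moves the relation back to the start, where it exhibits an exact form as `ζ` of a nonzero
form, a contradiction (`D_eq_zero_of_forall_valuationSubring`). So `dt = 0`, and `t` is a `p`-th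
power.

Once both projections lift, the induced map to the product of the two liftings is the identity on
special fibres, hence an isomorphism. -/

namespace FLift

set_option linter.unusedSectionVars false

/-! ### Witt vectors of length two and Frobenius subrings. -/

section

section WittTwo

variable (p : ℕ) [hp : Fact p.Prime]

/-- Witt vectors of length two. -/
abbrev W2 (A : Type*) : Type _ := TruncatedWittVector p 2 A

namespace W2

variable {p} {A B C : Type*} [CommRing A] [CommRing B] [CommRing C]

omit hp [CommRing A] in
theorem ext {x y : W2 p A} (h0 : x.coeff 0 = y.coeff 0) (h1 : x.coeff 1 = y.coeff 1) : x = y := by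
  apply TruncatedWittVector.ext
  intro i
  fin_cases i
  · exact h0
  · exact h1

/-- The zeroth component of a Witt vector of length two. -/
noncomputable def c0 : W2 p A →+* A := (reduction p A)

theorem c0_apply (x : W2 p A) : c0 x = x.coeff 0 := rfl

theorem ext' {x y : W2 p A} (h0 : c0 x = c0 y) (h1 : x.coeff 1 = y.coeff 1) : x = y := ext h0 h1

theorem mk_truncate (f : A →+* B) (z : WittVector p A) :
    (TruncatedWittVector.mk p fun i : Fin 2 => f ((WittVector.truncate 2 z).coeff i)) =
      WittVector.truncate 2 (WittVector.map f z) := by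
  ext i
  rw [TruncatedWittVector.coeff_mk, WittVector.coeff_truncate, WittVector.coeff_truncate,
    WittVector.map_coeff]

/-- Functoriality of Witt vectors of length two. -/
noncomputable def map (f : A →+* B) : W2 p A →+* W2 p B where
  toFun x := TruncatedWittVector.mk p fun i => f (x.coeff i)
  map_one' := by
    rw [← map_one (WittVector.truncate 2), mk_truncate, map_one, map_one]
  map_zero' := by
    rw [← map_zero (WittVector.truncate 2), mk_truncate, map_zero, map_zero]
  map_mul' x y := by
    obtain ⟨x, rfl⟩ := WittVector.truncate_surjective p 2 A x
    obtain ⟨y, rfl⟩ := WittVector.truncate_surjective p 2 A y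
    rw [← map_mul, mk_truncate, mk_truncate, mk_truncate, map_mul, map_mul]
  map_add' x y := by
    obtain ⟨x, rfl⟩ := WittVector.truncate_surjective p 2 A x
    obtain ⟨y, rfl⟩ := WittVector.truncate_surjective p 2 A y
    rw [← map_add, mk_truncate, mk_truncate, mk_truncate, map_add, map_add]

@[simp] theorem map_coeff (f : A →+* B) (x : W2 p A) (i : Fin 2) :
    (map f x).coeff i = f (x.coeff i) := TruncatedWittVector.coeff_mk _ _

@[simp] theorem c0_map (f : A →+* B) (x : W2 p A) : c0 (map f x) = f (c0 x) := map_coeff f x 0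

theorem map_map (g : B →+* C) (f : A →+* B) (x : W2 p A) :
    map g (map f x) = map (g.comp f) x := by
  apply ext <;> simp

theorem map_id (x : W2 p A) : map (RingHom.id A) x = x := by
  apply ext <;> simp

theorem map_surjective {f : A →+* B} (hf : Function.Surjective f) :
    Function.Surjective (map (p := p) f) := by
  intro y
  refine ⟨TruncatedWittVector.mk p fun i => (hf (y.coeff i)).choose, ?_⟩
  apply ext <;> simp [(hf _).choose_spec]

/-- The Witt vector `(a, b)`. -/
def mk (a b : A) : W2 p A := TruncatedWittVector.mk p ![a, b]

@[simp] theorem c0_mk (a b : A) : c0 (mk a b : W2 p A) = a :=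
  TruncatedWittVector.coeff_mk (p := p) ![a, b] 0

omit hp [CommRing A] in
@[simp] theorem coeff_one_mk (a b : A) : (mk a b : W2 p A).coeff 1 = b :=
  TruncatedWittVector.coeff_mk _ _

theorem mk_eta (x : W2 p A) : mk (c0 x) (x.coeff 1) = x := ext' (by simp) (by simp)

@[simp] theorem map_mk (f : A →+* B) (a b : A) : map (p := p) f (mk a b) = mk (f a) (f b) :=
  ext' (by simp) (by simp)

/-- The Verschiebung `x ↦ (0, x)`, as an additive map. -/
noncomputable def V : A →+ W2 p A where
  toFun x := mk 0 x
  map_zero' := ext' (by simp) (by simp)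
  map_add' x y := by
    -- Additivity is inherited from the Verschiebung of full Witt vectors, with Teichmüller elements
    -- as lifts of `x` and `y`.
    have h : ∀ z : WittVector p A, (mk 0 (z.coeff 0) : W2 p A) =
        WittVector.truncate 2 (WittVector.verschiebung z) := by
      intro z
      apply ext'
      · rw [c0_mk, c0_apply, WittVector.coeff_truncate]; simp
      · rw [coeff_one_mk, WittVector.coeff_truncate]
        exact (WittVector.verschiebung_coeff_succ z 0).symm
    have hx : x + y = (WittVector.teichmuller p x + WittVector.teichmuller p y).coeff 0 := by
      rw [WittVector.add_coeff_zero]; simp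
    have h1 := h (WittVector.teichmuller p x)
    have h2 := h (WittVector.teichmuller p y)
    rw [WittVector.teichmuller_coeff_zero] at h1 h2
    rw [h1, h2, hx, h, map_add, map_add]

@[simp] theorem c0_V (x : A) : c0 (V x : W2 p A) = 0 := c0_mk 0 x

@[simp] theorem coeff_one_V (x : A) : (V x : W2 p A).coeff 1 = x := coeff_one_mk 0 x

@[simp] theorem map_V (f : A →+* B) (x : A) : map (p := p) f (V x) = V (f x) :=
  ext' (by simp) (by simp)

theorem V_injective : Function.Injective (V : A → W2 p A) := by
  intro x y h
  rw [← coeff_one_V (p := p) x, h, coeff_one_V]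

theorem eq_V_of_c0_eq_zero {x : W2 p A} (h : c0 x = 0) : x = V (x.coeff 1) :=
  ext' (by simpa using h) (by simp)

/-- The Teichmüller lift. -/
noncomputable def teich : A →* W2 p A :=
  ((WittVector.truncate 2 : WittVector p A →+* W2 p A) : WittVector p A →* W2 p A).comp
    (WittVector.teichmuller p)

@[simp] theorem c0_teich (a : A) : c0 (teich a : W2 p A) = a := by
  change (WittVector.truncate 2 (WittVector.teichmuller p a)).coeff 0 = a
  rw [WittVector.coeff_truncate]
  exact WittVector.teichmuller_coeff_zero p a

@[simp] theorem coeff_one_teich (a : A) : (teich a : W2 p A).coeff 1 = 0 := by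
  change (WittVector.truncate 2 (WittVector.teichmuller p a)).coeff 1 = 0
  rw [WittVector.coeff_truncate]
  exact WittVector.teichmuller_coeff_pos p a 1 one_pos

@[simp] theorem map_teich (f : A →+* B) (a : A) : map (p := p) f (teich a) = teich (f a) :=
  ext' (by simp) (by simp)

/-- The two summands have disjoint supports, so their Witt sum is computed componentwise. -/
theorem eq_teich_add_V (x : W2 p A) : x = teich (c0 x) + V (x.coeff 1) := by
  obtain ⟨z, rfl⟩ := WittVector.truncate_surjective p 2 A x
  have h1 : WittVector.truncate 2 (WittVector.teichmuller p (z.coeff 0)) =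
      (teich (z.coeff 0) : W2 p A) := rfl
  have h2 : WittVector.truncate 2 (WittVector.verschiebung
      (WittVector.teichmuller p (z.coeff 1))) = (V (z.coeff 1) : W2 p A) := by
    apply ext'
    · rw [c0_apply, WittVector.coeff_truncate]; simp
    · rw [WittVector.coeff_truncate, coeff_one_V]
      exact (WittVector.verschiebung_coeff_succ _ 0).trans (WittVector.teichmuller_coeff_zero p _)
  rw [c0_apply, WittVector.coeff_truncate, WittVector.coeff_truncate]
  change _ = teich (z.coeff 0) + V (z.coeff 1)
  rw [← h1, ← h2, ← map_add]
  have hd : ∀ n, (WittVector.teichmuller p (z.coeff 0)).coeff n = 0 ∨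
      (WittVector.verschiebung (WittVector.teichmuller p (z.coeff 1))).coeff n = 0 := by
    intro n
    cases n with
    | zero => right; simp
    | succ n => left; exact WittVector.teichmuller_coeff_pos p _ _ n.succ_pos
  apply ext'
  · rw [c0_apply, c0_apply, WittVector.coeff_truncate, WittVector.coeff_truncate]
    simp [WittVector.coeff_add_of_disjoint _ _ _ hd]
  · rw [WittVector.coeff_truncate, WittVector.coeff_truncate]
    change _ = WittVector.coeff _ 1
    rw [WittVector.coeff_add_of_disjoint _ _ _ hd]
    rw [WittVector.teichmuller_coeff_pos p _ _ one_pos, zero_add]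
    exact ((WittVector.verschiebung_coeff_succ _ 0).trans
      (WittVector.teichmuller_coeff_zero p _)).symm

theorem add_V (x : W2 p A) (a : A) : x + V a = mk (c0 x) (x.coeff 1 + a) := by
  have h : ∀ b c : A, (teich b + V c : W2 p A) = mk b c := by
    intro b c
    have := eq_teich_add_V (mk b c : W2 p A)
    rw [c0_mk, coeff_one_mk] at this
    exact this.symm
  conv_lhs => rw [eq_teich_add_V x]
  rw [add_assoc, ← map_add, h]

@[simp] theorem coeff_one_add_V (x : W2 p A) (a : A) : (x + V a).coeff 1 = x.coeff 1 + a := by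
  rw [add_V, coeff_one_mk]

theorem c0_surjective : Function.Surjective (c0 : W2 p A → A) := fun a => ⟨teich a, c0_teich a⟩

section CharP

variable (hA : (p : A) = 0)
include hA

/-- The hypothesis `(p : A) = 0` also allows the zero ring, which does occur as sections over the
empty open set. -/
theorem charP_or_subsingleton : CharP A p ∨ Subsingleton A := by
  cases subsingleton_or_nontrivial A with
  | inl h => exact .inr h
  | inr h => exact .inl ((CharP.charP_iff_prime_eq_zero hp.out).mpr hA)

/-- This is the truncated projection formula `V(z) y = V(z F(y))`; in characteristic `p` the Witt
vector Frobenius raises components to the `p`-th power. -/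
theorem mul_V (x : W2 p A) (a : A) : x * V a = V (c0 x ^ p * a) := by
  rcases charP_or_subsingleton hA with h | h
  · have key : ∀ y z : WittVector p A, WittVector.truncate 2 (y * WittVector.verschiebung z) =
        (V ((y.coeff 0) ^ p * z.coeff 0) : W2 p A) := by
      intro y z
      rw [mul_comm, ← WittVector.verschiebung_mul_frobenius]
      apply ext'
      · rw [c0_apply, WittVector.coeff_truncate]; simp
      · rw [WittVector.coeff_truncate, coeff_one_V]
        refine (WittVector.verschiebung_coeff_succ _ 0).trans ?_
        rw [WittVector.mul_coeff_zero, WittVector.coeff_frobenius_charP, mul_comm]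
    obtain ⟨y, rfl⟩ := WittVector.truncate_surjective p 2 A x
    have hV : (V a : W2 p A) =
        WittVector.truncate 2 (WittVector.verschiebung (WittVector.teichmuller p a)) := by
      have := key 1 (WittVector.teichmuller p a)
      rw [one_mul] at this
      rw [this]; simp
    rw [hV, ← map_mul, key, WittVector.teichmuller_coeff_zero]
    rfl
  · exact Subsingleton.elim (h := ⟨fun a b => ext (Subsingleton.elim _ _) (Subsingleton.elim _ _)⟩)
      _ _

theorem V_mul_V (a b : A) : (V a : W2 p A) * V b = 0 := by
  rw [mul_V hA, c0_V, zero_pow hp.out.ne_zero, zero_mul, map_zero]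

theorem natCast_eq_V : (p : W2 p A) = V 1 := by
  rcases charP_or_subsingleton hA with h | h
  · rw [← map_natCast (WittVector.truncate 2 : WittVector p A →+* W2 p A)]
    apply ext'
    · rw [c0_apply, WittVector.coeff_truncate, c0_V]
      exact WittVector.coeff_p_zero p A
    · rw [WittVector.coeff_truncate, coeff_one_V]
      exact WittVector.coeff_p_one p A
  · exact Subsingleton.elim (h := ⟨fun a b => ext (Subsingleton.elim _ _) (Subsingleton.elim _ _)⟩)
      _ _

theorem natCast_mul (x : W2 p A) : (p : W2 p A) * x = V (c0 x ^ p) := by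
  rw [natCast_eq_V hA, mul_comm, mul_V hA, mul_one]

theorem natCast_mul_V (a : A) : (p : W2 p A) * V a = 0 := by
  rw [natCast_mul hA, c0_V, zero_pow hp.out.ne_zero, map_zero]

theorem natCast_mul_natCast : (p : W2 p A) * (p : W2 p A) = 0 := by
  rw [natCast_eq_V hA, V_mul_V hA]

theorem add_V_pow (x : W2 p A) (a : A) : (x + V a) ^ p = x ^ p := by
  obtain ⟨r, hr⟩ := exists_add_pow_prime_eq hp.out x (V a)
  have h2 : (V a : W2 p A) ^ p = 0 := by
    exact pow_eq_zero_of_le hp.out.two_le (by rw [pow_two, V_mul_V hA])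
  rw [hr, h2, add_zero]
  have : (p : W2 p A) * x * V a * r = x * r * ((p : W2 p A) * V a) := by ring
  rw [this, natCast_mul_V hA, mul_zero, add_zero]

/-- The ideal `V(A)` is killed by `p` and has square zero. Comparing with a Teichmüller element
gives `w ^ p = teich (c0 w ^ p)`, so Frobenius subrings contain the Teichmüller lifts of all `p`-th
powers. -/
theorem pow_eq_of_c0_eq {x y : W2 p A} (h : c0 x = c0 y) : x ^ p = y ^ p := by
  have : x = y + V ((x - y).coeff 1) := by
    rw [← eq_V_of_c0_eq_zero (x := x - y) (by rw [map_sub, h, sub_self])]; ring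
  rw [this, add_V_pow hA]

end CharP

end W2

/-- A subring of `W₂(A)` which is a lift of `A` along `(a, b) ↦ a`, with ideal
`{(0, c ^ p)}`. -/
structure IsFrobSubring {A : Type*} [CommRing A] (R : Subring (W2 p A)) : Prop where
  surj (a : A) : ∃ w ∈ R, W2.c0 w = a
  V_mem_iff (b : A) : W2.V b ∈ R ↔ ∃ c, b = c ^ p

-- Adding `V c` just adds `c` to the second component. Over a fixed first component the second
-- components therefore form one coset of the `p`-th powers.
variable {p} in
theorem IsFrobSubring.exists_coeff_one_sub {A : Type*} [CommRing A] {R : Subring (W2 p A)}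
    (hR : IsFrobSubring p R) {v w : W2 p A} (hv : v ∈ R) (hw : w ∈ R) (h : W2.c0 v = W2.c0 w) :
    ∃ c, v.coeff 1 = w.coeff 1 + c ^ p := by
  have h0 : W2.c0 (v - w) = 0 := by rw [map_sub, h, sub_self]
  have h1 := W2.eq_V_of_c0_eq_zero h0
  obtain ⟨c, hc⟩ := (hR.V_mem_iff _).mp (h1 ▸ R.sub_mem hv hw)
  refine ⟨c, ?_⟩
  rw [← hc, ← W2.coeff_one_add_V, ← h1]
  congr 1; ring

end WittTwo

end

/-! ### Flat lifts of rings and the map to Witt vectors given by a lift of Frobenius. -/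

section

section FlatLift

variable (p : ℕ) [hp : Fact p.Prime]

/-- A surjection `π : S → A` such that `ker π = p S = ann p`, that is, a lift of `A` to a ring `S`
which is flat over `ℤ / p ^ 2`. -/
structure IsFlatLift {S A : Type*} [CommRing S] [CommRing A] (π : S →+* A) : Prop where
  surj : Function.Surjective π
  eq_zero_iff (x : S) : π x = 0 ↔ ∃ y, x = p * y
  mul_eq_zero_iff (x : S) : p * x = 0 ↔ π x = 0

variable {p}

namespace IsFlatLift

variable {S A S' A' : Type*} [CommRing S] [CommRing A] [CommRing S'] [CommRing A']
  {π : S →+* A} {π' : S' →+* A'} (h : IsFlatLift p π) (h' : IsFlatLift p π')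

section
include h

theorem natCast_eq_zero : (p : A) = 0 := by
  rw [← map_natCast π]
  exact (h.eq_zero_iff _).mpr ⟨1, (mul_one _).symm⟩

theorem natCast_mul_natCast : (p : S) * p = 0 :=
  (h.mul_eq_zero_iff _).mpr (by rw [map_natCast, h.natCast_eq_zero])

theorem mul_eq_mul {x y : S} (hxy : π x = π y) : (p : S) * x = p * y := by
  rw [← sub_eq_zero, ← mul_sub, h.mul_eq_zero_iff, map_sub, hxy, sub_self]

theorem eq_of_mul_eq_mul {x y : S} (hxy : (p : S) * x = p * y) : π x = π y := by
  rw [← sub_eq_zero, ← map_sub, ← h.mul_eq_zero_iff, mul_sub, hxy, sub_self]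

theorem exists_eq_add {x y : S} (hxy : π x = π y) : ∃ z, x = y + p * z := by
  obtain ⟨z, hz⟩ := (h.eq_zero_iff (x - y)).mp (by rw [map_sub, hxy, sub_self])
  exact ⟨z, by rw [← hz]; ring⟩

/-- Since `p * p = 0` in `S`, every correction term of the binomial expansion vanishes. Hence the
`p`-th power of a lift depends only on the element lifted. -/
theorem add_mul_pow (x z : S) : (x + p * z) ^ p = x ^ p := by
  obtain ⟨r, hr⟩ := exists_add_pow_prime_eq hp.out x (p * z)
  have h2 : ((p : S) * z) ^ p = 0 := by
    refine pow_eq_zero_of_le hp.out.two_le ?_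
    have : ((p : S) * z) ^ 2 = p * p * z ^ 2 := by ring
    rw [this, h.natCast_mul_natCast, zero_mul]
  have h3 : (p : S) * x * (p * z) * r = p * p * (x * z * r) := by ring
  rw [hr, h2, h3, h.natCast_mul_natCast, zero_mul, add_zero, add_zero]

theorem pow_eq_pow {x y : S} (hxy : π x = π y) : x ^ p = y ^ p := by
  obtain ⟨z, rfl⟩ := h.exists_eq_add hxy
  exact h.add_mul_pow y z

end

/-- The value of the ghost map `(π a₀, π a₁) ↦ a₀ ^ p + p a₁`. -/
noncomputable def ghostFun (w : W2 p A) : S :=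
  (Function.surjInv h.surj (W2.c0 w)) ^ p + p * Function.surjInv h.surj (w.coeff 1)

theorem ghostFun_eq (w : W2 p A) {x y : S} (hx : π x = W2.c0 w) (hy : π y = w.coeff 1) :
    h.ghostFun w = x ^ p + p * y := by
  unfold ghostFun
  rw [h.pow_eq_pow (y := x) (by rw [Function.surjInv_eq h.surj, hx]),
    h.mul_eq_mul (y := y) (by rw [Function.surjInv_eq h.surj, hy])]

/-- The first ghost component on `W(S)` is a ring homomorphism, and it descends to `W₂(A)`; the ring
axioms for `ghost` come from here. -/
theorem ghostFun_truncate (z : WittVector p S) :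
    h.ghostFun (WittVector.truncate 2 (WittVector.map π z)) = WittVector.ghostComponent 1 z := by
  rw [h.ghostFun_eq (x := z.coeff 0) (y := z.coeff 1), WittVector.ghostComponent_apply,
    wittPolynomial_one]
  · simp [add_comm]
  · rw [W2.c0_apply, WittVector.coeff_truncate]; simp
  · rw [WittVector.coeff_truncate]; simp

include h in
theorem exists_eq_truncate_map (w : W2 p A) :
    ∃ z : WittVector p S, w = WittVector.truncate 2 (WittVector.map π z) := by
  obtain ⟨z, rfl⟩ := WittVector.truncate_surjective p 2 A w
  obtain ⟨y, rfl⟩ := WittVector.map_surjective π h.surj z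
  exact ⟨y, rfl⟩

/-- The ghost map `W₂(A) → S`, `(π a₀, π a₁) ↦ a₀ ^ p + p a₁`. -/
noncomputable def ghost : W2 p A →+* S where
  toFun := h.ghostFun
  map_one' := by
    rw [← map_one (WittVector.truncate 2), ← map_one (WittVector.map π), h.ghostFun_truncate,
      map_one]
  map_zero' := by
    rw [← map_zero (WittVector.truncate 2), ← map_zero (WittVector.map π), h.ghostFun_truncate,
      map_zero]
  map_mul' v w := by
    obtain ⟨v, rfl⟩ := h.exists_eq_truncate_map v
    obtain ⟨w, rfl⟩ := h.exists_eq_truncate_map w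
    rw [← map_mul, ← map_mul, h.ghostFun_truncate, h.ghostFun_truncate, h.ghostFun_truncate,
      map_mul]
  map_add' v w := by
    obtain ⟨v, rfl⟩ := h.exists_eq_truncate_map v
    obtain ⟨w, rfl⟩ := h.exists_eq_truncate_map w
    rw [← map_add, ← map_add, h.ghostFun_truncate, h.ghostFun_truncate, h.ghostFun_truncate,
      map_add]

theorem ghost_eq (w : W2 p A) {x y : S} (hx : π x = W2.c0 w) (hy : π y = w.coeff 1) :
    h.ghost w = x ^ p + p * y := h.ghostFun_eq w hx hy

/-- By flatness `p * y` determines `π y`, so the second component can be recovered. Identities for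
`toWitt` are all verified on first component and ghost value. -/
theorem ext_of_ghost {v w : W2 p A} (h0 : W2.c0 v = W2.c0 w) (h1 : h.ghost v = h.ghost w) :
    v = w := by
  obtain ⟨x, hx⟩ := h.surj (W2.c0 v)
  obtain ⟨y, hy⟩ := h.surj (v.coeff 1)
  obtain ⟨z, hz⟩ := h.surj (w.coeff 1)
  rw [h.ghost_eq v hx hy, h.ghost_eq w (hx.trans h0) hz, add_right_inj] at h1
  exact W2.ext' h0 (by rw [← hy, ← hz, h.eq_of_mul_eq_mul h1])

theorem ghost_map {φ : S →+* S'} {f : A →+* A'} (hφ : ∀ x, π' (φ x) = f (π x)) (w : W2 p A) :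
    h'.ghost (W2.map f w) = φ (h.ghost w) := by
  obtain ⟨x, hx⟩ := h.surj (W2.c0 w)
  obtain ⟨y, hy⟩ := h.surj (w.coeff 1)
  rw [h.ghost_eq w hx hy, h'.ghost_eq (W2.map f w) (x := φ x) (y := φ y)]
  · simp
  · rw [hφ, hx, W2.c0_map]
  · rw [hφ, hy, W2.map_coeff]

section Frob

variable {F : S →+* S} (hF : ∀ x, π (F x) = π x ^ p)
  {F' : S' →+* S'} (hF' : ∀ x, π' (F' x) = π' x ^ p)

include h hF in
theorem exists_delta (x : S) : ∃ y, F x = x ^ p + p * y :=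
  h.exists_eq_add (by rw [hF, map_pow])

-- With `F x = x ^ p + p * y`, the reduction of `y` is the required second component.
include h hF in
theorem exists_witt (x : S) : ∃ w : W2 p A, W2.c0 w = π x ∧ h.ghost w = F x := by
  obtain ⟨y, hy⟩ := h.exists_delta hF x
  refine ⟨W2.mk (π x) (π y), by simp, ?_⟩
  rw [hy]
  exact h.ghost_eq _ (by simp) (by simp)

/-- The ring homomorphism `S → W₂(A)` determined by a lift of Frobenius to `S`. -/
noncomputable def toWitt : S →+* W2 p A where
  toFun x := (h.exists_witt hF x).choose
  map_one' := by
    have := (h.exists_witt hF 1).choose_spec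
    apply h.ext_of_ghost
    · rw [this.1, map_one, map_one]
    · rw [this.2, map_one, map_one]
  map_zero' := by
    have := (h.exists_witt hF 0).choose_spec
    apply h.ext_of_ghost
    · rw [this.1, map_zero, map_zero]
    · rw [this.2, map_zero, map_zero]
  map_mul' x y := by
    have h1 := (h.exists_witt hF x).choose_spec
    have h2 := (h.exists_witt hF y).choose_spec
    have h3 := (h.exists_witt hF (x * y)).choose_spec
    apply h.ext_of_ghost
    · rw [h3.1, map_mul, map_mul, h1.1, h2.1]
    · rw [h3.2, map_mul, map_mul, h1.2, h2.2]
  map_add' x y := by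
    have h1 := (h.exists_witt hF x).choose_spec
    have h2 := (h.exists_witt hF y).choose_spec
    have h3 := (h.exists_witt hF (x + y)).choose_spec
    apply h.ext_of_ghost
    · rw [h3.1, map_add, map_add, h1.1, h2.1]
    · rw [h3.2, map_add, map_add, h1.2, h2.2]

@[simp] theorem c0_toWitt (x : S) : W2.c0 (h.toWitt hF x) = π x :=
  (h.exists_witt hF x).choose_spec.1

@[simp] theorem ghost_toWitt (x : S) : h.ghost (h.toWitt hF x) = F x :=
  (h.exists_witt hF x).choose_spec.2

/-- This is where the shape of `IsFrobSubring` comes from: the kernel `p S` of `π` lands on the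
elements `V (c ^ p)`. -/
theorem toWitt_natCast_mul (y : S) : h.toWitt hF (p * y) = W2.V (π y ^ p) := by
  rw [map_mul, map_natCast, W2.natCast_mul h.natCast_eq_zero, c0_toWitt]

theorem map_toWitt {φ : S →+* S'} {f : A →+* A'} (hφ : ∀ x, π' (φ x) = f (π x))
    (hφF : ∀ x, φ (F x) = F' (φ x)) (x : S) :
    W2.map f (h.toWitt hF x) = h'.toWitt hF' (φ x) := by
  apply h'.ext_of_ghost
  · simp [hφ]
  · rw [h.ghost_map h' hφ, ghost_toWitt, ghost_toWitt, hφF]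

theorem isFrobSubring_range : IsFrobSubring p (h.toWitt hF).range where
  surj a := by
    obtain ⟨x, rfl⟩ := h.surj a
    exact ⟨_, ⟨x, rfl⟩, h.c0_toWitt hF x⟩
  V_mem_iff b := by
    constructor
    · rintro ⟨x, hx⟩
      have h0 : π x = 0 := by rw [← h.c0_toWitt hF x, hx, W2.c0_V]
      obtain ⟨y, rfl⟩ := (h.eq_zero_iff x).mp h0
      rw [h.toWitt_natCast_mul] at hx
      exact ⟨π y, (W2.V_injective hx).symm⟩
    · rintro ⟨c, rfl⟩
      obtain ⟨y, rfl⟩ := h.surj c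
      exact ⟨p * y, h.toWitt_natCast_mul hF y⟩

theorem toWitt_injective [IsReduced A] : Function.Injective (h.toWitt hF) := by
  rw [injective_iff_map_eq_zero]
  intro x hx
  have h0 : π x = 0 := by rw [← h.c0_toWitt hF x, hx, map_zero]
  obtain ⟨y, rfl⟩ := (h.eq_zero_iff x).mp h0
  rw [h.toWitt_natCast_mul] at hx
  rw [h.mul_eq_zero_iff]
  exact eq_zero_of_pow_eq_zero (W2.V_injective (hx.trans (map_zero _).symm))

end Frob

section Perfect

variable {k : Type*} [CommRing k] (hk : (p : k) = 0) (hperf : ∀ c : k, ∃ e, c = e ^ p)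

-- For perfect `k` every Witt vector of length two is a `p`-th power plus a multiple of `p`, and in
-- `S` both of these depend only on reductions.
include h hk hperf in
theorem hom_ext_of_perfect {φ₁ φ₂ : W2 p k →+* S} (hφ : ∀ w, π (φ₁ w) = π (φ₂ w)) : φ₁ = φ₂ := by
  ext w
  rw [W2.eq_teich_add_V w]
  obtain ⟨e, he⟩ := hperf (W2.c0 w)
  obtain ⟨d, hd⟩ := hperf (w.coeff 1)
  have hV : (W2.V (w.coeff 1) : W2 p k) = (p : W2 p k) * W2.teich d := by
    rw [W2.natCast_mul hk, W2.c0_teich, hd]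
  rw [hV, he, map_pow, map_add, map_add, map_pow, map_pow, map_mul, map_mul, map_natCast,
    map_natCast, h.pow_eq_pow (hφ _), h.mul_eq_mul (hφ _)]

end Perfect

/-- A homomorphism between flat lifts of the same ring is bijective. -/
theorem bijective {π₁ : S →+* A} {π₂ : S' →+* A} (h₁ : IsFlatLift p π₁) (h₂ : IsFlatLift p π₂)
    {φ : S →+* S'} (hφ : ∀ x, π₂ (φ x) = π₁ x) : Function.Bijective φ := by
  constructor
  · rw [injective_iff_map_eq_zero]
    intro x hx
    obtain ⟨y, rfl⟩ := (h₁.eq_zero_iff x).mp (by rw [← hφ, hx, map_zero])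
    rw [map_mul, map_natCast, h₂.mul_eq_zero_iff, hφ] at hx
    rwa [h₁.mul_eq_zero_iff]
  · intro y
    obtain ⟨x, hx⟩ := h₁.surj (π₂ y)
    obtain ⟨z, hz⟩ := h₂.exists_eq_add (x := y) (y := φ x) (by rw [hφ, hx])
    obtain ⟨t, ht⟩ := h₁.surj (π₂ z)
    refine ⟨x + p * t, ?_⟩
    rw [hz, map_add, map_mul, map_natCast, h₂.mul_eq_mul (x := φ t) (y := z) (by rw [hφ, ht])]

end IsFlatLift

end FlatLift

end

/-! ### The semilinear operator on differentials defined by a Frobenius subring. -/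

section

section WittDerivation

variable {p : ℕ} [hp : Fact p.Prime]

/-- The map `w ↦ w₀ ^ (p - 1) d w₀ + d w₁`. -/
noncomputable def wittDer {R A M : Type*} [CommRing R] [CommRing A] [AddCommGroup M] [Algebra R A]
    [Module A M] [Module R M] (d : Derivation R A M) (w : W2 p A) : M :=
  W2.c0 w ^ (p - 1) • d (W2.c0 w) + d (w.coeff 1)

section

variable {S B M : Type*} [CommRing S] [CommRing B] [Algebra S B] [AddCommGroup M] [Module B M]
  [Module S M] (d : Derivation S B M)

/-- `wittDer` is the derivative of the ghost component `w₀ ^ p + p w₁` divided by `p`. In the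
absence of `p`-torsion its additivity and Leibniz rule follow at once. -/
theorem natCast_smul_wittDer (z : WittVector p B) :
    p • wittDer d (WittVector.truncate 2 z : W2 p B) = d (WittVector.ghostComponent 1 z) := by
  have h0 : W2.c0 (WittVector.truncate 2 z : W2 p B) = z.coeff 0 := by
    rw [W2.c0_apply, WittVector.coeff_truncate]; rfl
  have h1 : (WittVector.truncate 2 z : W2 p B).coeff 1 = z.coeff 1 := by
    rw [WittVector.coeff_truncate]; rfl
  rw [wittDer, h0, h1, WittVector.ghostComponent_apply, wittPolynomial_one]
  simp only [map_add, map_mul, map_pow, map_natCast, MvPolynomial.aeval_X, Derivation.leibniz,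
    Derivation.leibniz_pow, smul_add, Derivation.map_natCast, smul_zero, add_zero,
    Nat.cast_smul_eq_nsmul]
  rw [add_comm]

theorem wittDer_add_of_torsionFree (hM : ∀ m : M, p • m = 0 → m = 0) (v w : W2 p B) :
    wittDer d (v + w) = wittDer d v + wittDer d w := by
  obtain ⟨v, rfl⟩ := WittVector.truncate_surjective p 2 B v
  obtain ⟨w, rfl⟩ := WittVector.truncate_surjective p 2 B w
  rw [← sub_eq_zero]
  apply hM
  rw [smul_sub, smul_add, ← map_add]
  simp only [natCast_smul_wittDer]
  rw [map_add, map_add, sub_self]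

theorem wittDer_mul_of_torsionFree (hM : ∀ m : M, p • m = 0 → m = 0) (v w : WittVector p B) :
    wittDer d (WittVector.truncate 2 (v * w) : W2 p B) =
      WittVector.ghostComponent 1 v • wittDer d (WittVector.truncate 2 w : W2 p B) +
        WittVector.ghostComponent 1 w • wittDer d (WittVector.truncate 2 v : W2 p B) := by
  rw [← sub_eq_zero]
  apply hM
  rw [smul_sub, smul_add, smul_comm p, smul_comm p]
  simp only [natCast_smul_wittDer]
  rw [map_mul, Derivation.leibniz, sub_self]

end

section

variable {R A M : Type*} [CommRing R] [CommRing A] [AddCommGroup M] [Algebra R A]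
  [Module A M] [Module R M] (d : Derivation R A M)

/-- The restriction of a derivation of `A` to the polynomial ring `ℤ[A]`, as a linear map on
differentials. -/
theorem exists_linearMap_freeCommRing :
    ∃ l : Ω[MvPolynomial A ℤ⁄ℤ] →+ M,
      (∀ b, l (KaehlerDifferential.D ℤ (MvPolynomial A ℤ) b) =
        d (MvPolynomial.aeval (R := ℤ) (id : A → A) b)) ∧
      ∀ (b : MvPolynomial A ℤ) m, l (b • m) = MvPolynomial.aeval (R := ℤ) (id : A → A) b • l m := by
  let : Algebra (MvPolynomial A ℤ) A :=
    (MvPolynomial.aeval (R := ℤ) (id : A → A)).toRingHom.toAlgebra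
  let : Module (MvPolynomial A ℤ) M := Module.compHom M (algebraMap (MvPolynomial A ℤ) A)
  have : IsScalarTower (MvPolynomial A ℤ) A M := ⟨fun x y z => by
    rw [Algebra.smul_def, mul_smul]; rfl⟩
  let d' : Derivation ℤ A M := d.restrictScalars ℤ
  let d'' : Derivation ℤ (MvPolynomial A ℤ) M := d'.compAlgebraMap (MvPolynomial A ℤ)
  refine ⟨d''.liftKaehlerDifferential.toAddMonoidHom, fun b => ?_, fun b m => ?_⟩
  · exact d''.liftKaehlerDifferential_comp_D b
  · exact map_smul d''.liftKaehlerDifferential b m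

theorem aeval_id_surjective : Function.Surjective (MvPolynomial.aeval (R := ℤ) (id : A → A)) :=
  fun a => ⟨MvPolynomial.X a, by simp⟩

theorem torsionFree_kaehler_mvPolynomial (σ : Type*) (m : Ω[MvPolynomial σ ℤ⁄ℤ])
    (hm : p • m = 0) : m = 0 := by
  have hp0 : (p : MvPolynomial σ ℤ) ≠ 0 := Nat.cast_ne_zero.mpr hp.out.ne_zero
  apply (KaehlerDifferential.mvPolynomialBasis ℤ σ).repr.injective
  rw [map_zero]
  ext i : 1
  have := congrArg (fun x => (KaehlerDifferential.mvPolynomialBasis ℤ σ).repr x i) hm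
  simp only [map_nsmul, Finsupp.smul_apply, map_zero, Finsupp.zero_apply, nsmul_eq_mul,
    mul_eq_zero, hp0, false_or] at this
  exact this

theorem wittDer_map {l : Ω[MvPolynomial A ℤ⁄ℤ] →+ M}
    (hl : ∀ b, l (KaehlerDifferential.D ℤ (MvPolynomial A ℤ) b) =
        d (MvPolynomial.aeval (R := ℤ) (id : A → A) b))
    (hl' : ∀ (b : MvPolynomial A ℤ) m,
      l (b • m) = MvPolynomial.aeval (R := ℤ) (id : A → A) b • l m)
    (w : W2 p (MvPolynomial A ℤ)) :
    wittDer d (W2.map (MvPolynomial.aeval (R := ℤ) (id : A → A) : MvPolynomial A ℤ →+* A) w) =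
      l (wittDer (KaehlerDifferential.D ℤ (MvPolynomial A ℤ)) w) := by
  rw [wittDer, wittDer, map_add, hl, hl', hl, W2.c0_map, W2.map_coeff]
  simp

/-- Reduction to a universal case: the polynomial ring on the elements of `A` surjects onto `A`, and
its differentials are free, hence without `p`-torsion. -/
theorem wittDer_add (v w : W2 p A) : wittDer d (v + w) = wittDer d v + wittDer d w := by
  obtain ⟨l, hl, hl'⟩ := exists_linearMap_freeCommRing d
  obtain ⟨v, rfl⟩ := W2.map_surjective
    (f := (MvPolynomial.aeval (R := ℤ) (id : A → A) : MvPolynomial A ℤ →+* A))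
    aeval_id_surjective v
  obtain ⟨w, rfl⟩ := W2.map_surjective
    (f := (MvPolynomial.aeval (R := ℤ) (id : A → A) : MvPolynomial A ℤ →+* A))
    aeval_id_surjective w
  rw [← map_add, wittDer_map d hl hl', wittDer_map d hl hl', wittDer_map d hl hl',
    wittDer_add_of_torsionFree _ (torsionFree_kaehler_mvPolynomial A), map_add]

theorem wittDer_mul (hA : (p : A) = 0) (v w : W2 p A) :
    wittDer d (v * w) = W2.c0 v ^ p • wittDer d w + W2.c0 w ^ p • wittDer d v := by
  obtain ⟨l, hl, hl'⟩ := exists_linearMap_freeCommRing d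
  obtain ⟨v, rfl⟩ := W2.map_surjective
    (f := (MvPolynomial.aeval (R := ℤ) (id : A → A) : MvPolynomial A ℤ →+* A))
    aeval_id_surjective v
  obtain ⟨w, rfl⟩ := W2.map_surjective
    (f := (MvPolynomial.aeval (R := ℤ) (id : A → A) : MvPolynomial A ℤ →+* A))
    aeval_id_surjective w
  obtain ⟨v, rfl⟩ := WittVector.truncate_surjective p 2 _ v
  obtain ⟨w, rfl⟩ := WittVector.truncate_surjective p 2 _ w
  -- Modulo `p` the ghost component `z₀ ^ p + p z₁` becomes `z₀ ^ p`.
  have hg : ∀ z : WittVector p (MvPolynomial A ℤ),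
      MvPolynomial.aeval (R := ℤ) (id : A → A) (WittVector.ghostComponent 1 z) =
      W2.c0 (W2.map (MvPolynomial.aeval (R := ℤ) (id : A → A) : MvPolynomial A ℤ →+* A)
        (WittVector.truncate 2 z)) ^ p := by
    intro z
    rw [W2.c0_map, W2.c0_apply, WittVector.coeff_truncate, WittVector.ghostComponent_apply,
      wittPolynomial_one]
    simp [hA]
  rw [← map_mul, ← map_mul, wittDer_map d hl hl', wittDer_map d hl hl', wittDer_map d hl hl',
    wittDer_mul_of_torsionFree _ (torsionFree_kaehler_mvPolynomial A), map_add, hl', hl', hg, hg]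

theorem map_pow_prime_eq_zero (hA : (p : A) = 0) (a : A) : d (a ^ p) = 0 := by
  rw [Derivation.leibniz_pow, ← Nat.cast_smul_eq_nsmul A, hA, zero_smul]

/-- The second component is only ambiguous by a `p`-th power, which `d` kills; this makes `dF / p`
well defined on first components. -/
theorem wittDer_eq_of_c0_eq (hA : (p : A) = 0) {R : Subring (W2 p A)} (hR : IsFrobSubring p R)
    {v w : W2 p A} (hv : v ∈ R) (hw : w ∈ R) (h : W2.c0 v = W2.c0 w) :
    wittDer d v = wittDer d w := by
  obtain ⟨c, hc⟩ := hR.exists_coeff_one_sub hv hw h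
  rw [wittDer, wittDer, h, hc, map_add, map_pow_prime_eq_zero d hA, add_zero]

end

end WittDerivation

section FrobSemilinear

/-- A module over a ring of characteristic `p`, with scalars acting through Frobenius. -/
def FrobTwist (_p : ℕ) (_K M : Type*) : Type _ := M

namespace FrobTwist

variable (p : ℕ) (k K M : Type*) [CommRing k] [CommRing K] [Algebra k K] [ExpChar K p]
  [AddCommGroup M] [Module K M]

instance : AddCommGroup (FrobTwist p K M) := inferInstanceAs (AddCommGroup M)

noncomputable instance : Module K (FrobTwist p K M) := Module.compHom M (frobenius K p)

noncomputable instance (priority := low) : Module k (FrobTwist p K M) :=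
  Module.compHom M ((frobenius K p).comp (algebraMap k K))

/-- The identity map to the twisted module. -/
def of : M ≃+ FrobTwist p K M := AddEquiv.refl M

theorem smul_of (c : K) (m : M) : c • of p K M m = of p K M (c ^ p • m) := rfl

theorem algebraMap_smul_of (c : k) (m : M) :
    c • of p K M m = of p K M (algebraMap k K c ^ p • m) := rfl

instance : IsScalarTower k K (FrobTwist p K M) := ⟨fun c a n => by
  obtain ⟨n, rfl⟩ := (of p K M).surjective n
  rw [smul_of, smul_of, algebraMap_smul_of, Algebra.smul_def, mul_pow, mul_smul]⟩

end FrobTwist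

variable (p : ℕ) [hp : Fact p.Prime] (k : Type*) {K : Type*} [Field k] [Field K] [Algebra k K]
  [CharP k p] [CharP K p] [PerfectField k]

/-- The Frobenius-semilinear endomorphism of the differentials of a field `K` determined by a
lift of Frobenius. -/
theorem exists_frobSemilinear {R : Subring (W2 p K)} (hR : IsFrobSubring p R) :
    ∃ ζ : Ω[K⁄k] →ₛₗ[frobenius K p] Ω[K⁄k], ∀ w ∈ R,
      ζ (KaehlerDifferential.D k K (W2.c0 w)) = wittDer (KaehlerDifferential.D k K) w := by
  have hK : (p : K) = 0 := CharP.cast_eq_zero K p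
  let d := KaehlerDifferential.D k K
  -- `g a` is to be `ζ(da)`: dividing the derivative of `x ^ p + p δ(x)` by `p` gives `x ^ (p - 1)
  -- dx + dδ(x)`.
  let g : K → Ω[K⁄k] := fun a => wittDer d (hR.surj a).choose
  have hg : ∀ w ∈ R, g (W2.c0 w) = wittDer d w := fun w hw =>
    wittDer_eq_of_c0_eq d hK hR (hR.surj _).choose_spec.1 hw (hR.surj _).choose_spec.2
  have hadd : ∀ a b, g (a + b) = g a + g b := by
    intro a b
    obtain ⟨v, hv, rfl⟩ := hR.surj a
    obtain ⟨w, hw, rfl⟩ := hR.surj b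
    rw [← map_add, hg _ (R.add_mem hv hw), wittDer_add, hg v hv, hg w hw]
  have hmul : ∀ a b, g (a * b) = a ^ p • g b + b ^ p • g a := by
    intro a b
    obtain ⟨v, hv, rfl⟩ := hR.surj a
    obtain ⟨w, hw, rfl⟩ := hR.surj b
    rw [← map_mul, hg _ (R.mul_mem hv hw), wittDer_mul d hK, hg v hv, hg w hw]
  have hpow : ∀ a, g (a ^ p) = 0 := by
    intro a
    obtain ⟨v, hv, rfl⟩ := hR.surj a
    have hv' : v ^ p = W2.teich (W2.c0 v ^ p) := by
      rw [map_pow]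
      exact W2.pow_eq_of_c0_eq hK (by simp)
    rw [← map_pow, hg _ (R.pow_mem hv p), hv', wittDer, W2.c0_teich, W2.coeff_one_teich,
      map_zero, map_pow_prime_eq_zero d hK, smul_zero, add_zero]
  -- Constants are `p`-th powers by perfectness of `k`, and `g` vanishes on `p`-th powers.
  have hsmul : ∀ (c : k) a, g (c • a) = (algebraMap k K c) ^ p • g a := by
    intro c a
    obtain ⟨e, rfl⟩ := surjective_frobenius k p c
    rw [Algebra.smul_def, hmul, frobenius_def, map_pow, hpow, smul_zero, add_zero]
  -- Twisting the scalars by Frobenius turns the Leibniz rule of `g` into that of an ordinary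
  -- derivation, so the universal property of differentials applies.
  let D' : Derivation k K (FrobTwist p K Ω[K⁄k]) :=
    { toFun := fun a => FrobTwist.of p K _ (g a)
      map_add' := fun a b => by rw [hadd, map_add]
      map_smul' := fun c a => by rw [hsmul, RingHom.id_apply, FrobTwist.algebraMap_smul_of]
      map_one_eq_zero' := by
        have := hpow 1
        rw [one_pow] at this
        change FrobTwist.of p K _ (g 1) = 0
        rw [this, map_zero]
      leibniz' := fun a b => by
        change FrobTwist.of p K _ (g (a * b)) =
          a • FrobTwist.of p K _ (g b) + b • FrobTwist.of p K _ (g a)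
        rw [hmul, map_add, FrobTwist.smul_of, FrobTwist.smul_of] }
  let l := D'.liftKaehlerDifferential
  refine ⟨{ toFun := fun x => (FrobTwist.of p K _).symm (l x)
            map_add' := fun x y => by rw [map_add, map_add]
            map_smul' := fun c x => by
              rw [map_smul, frobenius_def, AddEquiv.symm_apply_eq, ← FrobTwist.smul_of,
                AddEquiv.apply_symm_apply] }, fun w hw => ?_⟩
  rw [← hg w hw]
  change (FrobTwist.of p K _).symm (l _) = _
  rw [D'.liftKaehlerDifferential_comp_D]
  rfl

end FrobSemilinear

end

/-! ### Injectivity modulo exact forms, and functions with zero differential. -/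

section

section DerivationPow

variable (p : ℕ) [hp : Fact p.Prime] {k K : Type*} [Field k] [Field K] [Algebra k K]
  [CharP k p]

/-- The `p`-th iterate of a derivation in characteristic `p` satisfies the Leibniz rule. -/
theorem Derivation_pow_prime_leibniz (d : Derivation k K K) (a b : K) :
    ((d : K →ₗ[k] K) ^ p) (a * b) = a * ((d : K →ₗ[k] K) ^ p) b + b * ((d : K →ₗ[k] K) ^ p) a := by
  let E := Module.End k K
  let D : E := (d : K →ₗ[k] K)
  have hc : CharP (Module.End k E) p :=
    charP_of_injective_algebraMap (algebraMap k (Module.End k E)).injective p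
  -- In characteristic `p`, `ad(D) ^ p = ad(D ^ p)`, because left and right multiplication by `D`
  -- commute. It is evaluated on the operator of multiplication by `a`, which `ad(D)` sends to
  -- multiplication by `d a`.
  have h1 : (LinearMap.mulLeft k D - LinearMap.mulRight k D) ^ p =
      LinearMap.mulLeft k (D ^ p) - LinearMap.mulRight k (D ^ p) := by
    have hcomm : Commute (LinearMap.mulLeft k D : Module.End k E) (LinearMap.mulRight k D) :=
      LinearMap.commute_mulLeft_right D D
    refine (sub_pow_char_of_commute (R := Module.End k E) p hcomm).trans ?_
    rw [LinearMap.pow_mulLeft, LinearMap.pow_mulRight]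
  have h2 : ∀ c : K, (LinearMap.mulLeft k D - LinearMap.mulRight k D) (LinearMap.mulLeft k c) =
      LinearMap.mulLeft k (d c) := by
    intro c
    ext x
    change d (c * x) - c * d x = d c * x
    rw [d.leibniz]
    simp only [smul_eq_mul]
    ring
  have h3 : ∀ n, ((LinearMap.mulLeft k D - LinearMap.mulRight k D) ^ n) (LinearMap.mulLeft k a) =
      LinearMap.mulLeft k ((D ^ n) a) := by
    intro n
    induction n with
    | zero => rfl
    | succ n ih =>
      rw [pow_succ', Module.End.mul_apply, ih, h2, pow_succ', Module.End.mul_apply]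
      rfl
  have h4 := h3 p
  rw [h1] at h4
  have h5 := congrArg (fun f : E => f b) h4
  change (D ^ p) (a * b) - a * (D ^ p) b = (D ^ p) a * b at h5
  change (D ^ p) (a * b) = _
  rw [sub_eq_iff_eq_add] at h5
  rw [h5]
  ring

end DerivationPow

section Cartier

variable {p : ℕ} [hp : Fact p.Prime] {k : Type*} {K : Type*} [Field k] [Field K] [Algebra k K]
  [CharP k p] [CharP K p]

/-- For `n = p - 1` the factorial is nonzero in `K`; this is what prevents `f * x ^ (p - 1)`, for `f
≠ 0`, from being of the form `d h` with `d ^ p h = 0`. -/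
theorem derivation_pow_apply (d : Derivation k K K) {x f : K} (hx : d x = 1) (hf : d f = 0) (n : ℕ) :
    ((d : K →ₗ[k] K) ^ n) (f * x ^ n) = (n.factorial : K) * f := by
  induction n with
  | zero => simp
  | succ n ih =>
    have h1 : (d : K →ₗ[k] K) (f * x ^ (n + 1)) = ((n + 1 : ℕ) : k) • (f * x ^ n) := by
      change d (f * x ^ (n + 1)) = _
      rw [d.leibniz, d.leibniz_pow, hf, hx, Algebra.smul_def ((n + 1 : ℕ) : k), map_natCast]
      simp
      ring
    rw [pow_succ, Module.End.mul_apply, h1, map_smul, ih, Algebra.smul_def, map_natCast,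
      Nat.factorial_succ]
    push_cast
    ring

/-- The kernel of the inverse Cartier operator modulo exact forms is trivial. -/
theorem eq_zero_of_frobSemilinear_eq_D {R : Subring (W2 p K)} (hR : IsFrobSubring p R)
    {ζ : Ω[K⁄k] →ₛₗ[frobenius K p] Ω[K⁄k]}
    (hζ : ∀ w ∈ R, ζ (KaehlerDifferential.D k K (W2.c0 w)) = wittDer (KaehlerDifferential.D k K) w)
    {η : Ω[K⁄k]} {h : K} (hη : ζ η = KaehlerDifferential.D k K h) : η = 0 := by
  classical
  let d := KaehlerDifferential.D k K
  have hK : (p : K) = 0 := CharP.cast_eq_zero K p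
  have hspan : ⊤ ≤ Submodule.span K (Set.range d) :=
    (KaehlerDifferential.span_range_derivation k K).ge
  let β := Module.Basis.ofSpan hspan
  have hx : ∀ i, ∃ x, d x = β i := fun i =>
    Module.Basis.ofSpan_subset hspan ⟨i, rfl⟩
  choose x hx using hx
  choose w hwR hw using fun i => hR.surj (x i)
  let f := β.repr η
  have h1 : η = ∑ i ∈ f.support, f i • d (x i) := by
    conv_lhs => rw [← β.linearCombination_repr η, Finsupp.linearCombination_apply, Finsupp.sum]
    exact Finset.sum_congr rfl fun i _ => by rw [hx]
  -- Write `η = ∑ fᵢ dxᵢ`. Each `fᵢ ^ p` is a constant for `d`, so the terms `fᵢ ^ p dwᵢ₁` of `ζ η`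
  -- are exact and may be moved to the side of `h`.
  have h2 : d (h - ∑ i ∈ f.support, f i ^ p * (w i).coeff 1) =
      ∑ i ∈ f.support, (f i ^ p * x i ^ (p - 1)) • d (x i) := by
    rw [map_sub, ← hη, h1, map_sum, map_sum, ← Finset.sum_sub_distrib]
    refine Finset.sum_congr rfl fun i _ => ?_
    rw [map_smulₛₗ, ← hw i, hζ _ (hwR i), wittDer, d.leibniz, map_pow_prime_eq_zero d hK,
      smul_zero, add_zero, frobenius_def, smul_add, smul_smul]
    simp [d]
  set h' := h - ∑ i ∈ f.support, f i ^ p * (w i).coeff 1 with hh'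
  suffices hf : f = 0 by
    rw [h1, hf]; simp
  ext j
  by_contra hj
  have hj' : j ∈ f.support := Finsupp.mem_support_iff.mpr hj
  let δ : Derivation k K K := (β.coord j).compDer d
  have hd : ∀ i, δ (x i) = if i = j then 1 else 0 := by
    intro i
    change β.coord j (d (x i)) = _
    rw [hx, β.coord_apply, β.repr_self, Finsupp.single_apply]
  have h3 : δ h' = f j ^ p * x j ^ (p - 1) := by
    change β.coord j (d h') = _
    rw [h2, map_sum, Finset.sum_eq_single j]
    · rw [map_smul, hx, β.coord_apply, β.repr_self, Finsupp.single_eq_same, smul_eq_mul, mul_one]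
    · intro i _ hij
      rw [map_smul, hx, β.coord_apply, β.repr_self, Finsupp.single_eq_of_ne' hij, smul_zero]
    · exact fun h => (h hj').elim
  -- The `p`-th power of the partial derivative `δ` is again a derivation. It kills every `xᵢ`, as
  -- `δ xᵢ` is `0` or `1` and `p ≥ 2`; since the `dxᵢ` form a basis it is zero.
  let Δ : Derivation k K K :=
    { toLinearMap := (δ : K →ₗ[k] K) ^ p
      map_one_eq_zero' := by
        have := Derivation_pow_prime_leibniz p δ 1 1
        simpa using this
      leibniz' := fun a b => Derivation_pow_prime_leibniz p δ a b }
  have h4 : Δ.liftKaehlerDifferential = 0 := by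
    apply β.ext
    intro i
    rw [← hx i, Derivation.liftKaehlerDifferential_comp_D]
    change ((δ : K →ₗ[k] K) ^ p) (x i) = 0
    obtain ⟨n, hn⟩ := Nat.exists_eq_add_of_le' hp.out.two_le
    rw [hn, pow_add, Module.End.mul_apply, pow_two, Module.End.mul_apply]
    have h5 : (δ : K →ₗ[k] K) ((δ : K →ₗ[k] K) (x i)) = 0 := by
      change δ (δ (x i)) = 0
      rw [hd]
      split_ifs
      · exact δ.map_one_eq_zero
      · exact map_zero _
    rw [h5, map_zero]
  have h6 : Δ h' = 0 := by
    rw [← Derivation.liftKaehlerDifferential_comp_D, h4, LinearMap.zero_apply]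
  change ((δ : K →ₗ[k] K) ^ p) h' = 0 at h6
  -- Therefore `0 = δ ^ (p - 1) (fⱼ ^ p xⱼ ^ (p - 1)) = (p - 1)! fⱼ ^ p`.
  have h7 : ((δ : K →ₗ[k] K) ^ p) h' = ((δ : K →ₗ[k] K) ^ (p - 1)) (δ h') := by
    conv_lhs => rw [← Nat.sub_add_cancel hp.out.one_le, pow_succ, Module.End.mul_apply]
    rfl
  rw [h7, h3, derivation_pow_apply δ (by rw [hd, if_pos rfl]) (map_pow_prime_eq_zero δ hK _)] at h6
  rcases mul_eq_zero.mp h6 with h8 | h8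
  · rw [CharP.cast_eq_zero_iff K p, hp.out.dvd_factorial] at h8
    have := hp.out.pos
    omega
  · exact hj (pow_eq_zero_iff hp.out.ne_zero |>.mp h8)

end Cartier

section PthRoot

variable (p : ℕ) [hp : Fact p.Prime] {k : Type*} {K : Type*} [Field k] [Field K] [Algebra k K]
  [CharP k p] [CharP K p] [PerfectField k]

/-- Over a perfect field, an element with zero differential is a `p`-th power. -/
theorem exists_eq_pow_of_D_eq_zero {t : K} (ht : KaehlerDifferential.D k K t = 0) :
    ∃ s, t = s ^ p := by
  by_contra hne
  -- The field of `p`-th powers contains `k` because `k` is perfect. Zorn's lemma then gives a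
  -- maximal extension `E` of it that avoids `t`.
  let K₀ : IntermediateField k K := 
    { (frobenius K p).fieldRange with
      algebraMap_mem' := fun c => by
        obtain ⟨e, rfl⟩ := surjective_frobenius k p c
        exact ⟨algebraMap k K e, by rw [frobenius_def, frobenius_def, map_pow]⟩ }
  have hK₀ : ∀ x, x ∈ K₀ ↔ ∃ s, x = s ^ p := fun x =>
    ⟨fun ⟨s, hs⟩ => ⟨s, hs.symm⟩, fun ⟨s, hs⟩ => ⟨s, hs.symm⟩⟩
  obtain ⟨E, hE₀, hE⟩ := zorn_le_nonempty₀ {E : IntermediateField k K | K₀ ≤ E ∧ t ∉ E} (by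
    intro c hc hchain y hy
    refine ⟨sSup c, ⟨(hc hy).1.trans (le_sSup hy), ?_⟩, fun z hz => le_sSup hz⟩
    intro hmem
    have : Nonempty c := ⟨⟨y, hy⟩⟩
    rw [sSup_eq_iSup', ← SetLike.mem_coe, IntermediateField.coe_iSup_of_directed
      hchain.directed] at hmem
    obtain ⟨z, hz⟩ := Set.mem_iUnion.mp hmem
    exact (hc z.2).2 hz) K₀ ⟨le_rfl, fun h => hne ((hK₀ t).mp h)⟩
  have hpow : ∀ s : K, s ^ p ∈ E := fun s => hE.prop.1 ((hK₀ _).mpr ⟨s, rfl⟩)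
  have hchar : CharP E p := charP_of_injective_algebraMap (algebraMap k E).injective p
  have hins : IsPurelyInseparable E K := by
    rw [isPurelyInseparable_iff_pow_mem E p]
    exact fun s => ⟨1, ⟨⟨s ^ p, hpow s⟩, by simp⟩⟩
  -- For `s ∉ E`, maximality puts `t` in `E(s)`. Both `E(t)` and `E(s)` have degree `p` over `E`, so
  -- they coincide, and `K = E(t)`.
  have hgen : ∀ s, s ∈ IntermediateField.adjoin E {t} := by
    have hdeg : ∀ s : K, s ∉ E → Module.finrank E (IntermediateField.adjoin E {s}) = p := by
      intro s hs
      have hirr : Irreducible (Polynomial.X ^ p - Polynomial.C (⟨s ^ p, hpow s⟩ : E)) := by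
        refine X_pow_sub_C_irreducible_of_prime hp.out fun b hb => hs ?_
        have h1 : (b : K) ^ p = s ^ p := congrArg Subtype.val hb
        have h2 : (b : K) = s := frobenius_inj K p h1
        exact h2 ▸ b.2
      have hint : IsIntegral E s := Algebra.IsIntegral.isIntegral s
      rw [IntermediateField.adjoin.finrank hint, ← minpoly.eq_of_irreducible_of_monic hirr
        (by simp) (Polynomial.monic_X_pow_sub_C _ hp.out.ne_zero), Polynomial.natDegree_X_pow_sub_C]
    intro s
    by_cases hs : s ∈ E
    · exact (IntermediateField.adjoin E {t}).algebraMap_mem ⟨s, hs⟩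
    have hts : t ∈ IntermediateField.adjoin E {s} := by
      by_contra hts
      have hmem : (IntermediateField.adjoin E {s}).restrictScalars k ∈
          {E : IntermediateField k K | K₀ ≤ E ∧ t ∉ E} := by
        refine ⟨fun x hx => ?_, hts⟩
        exact (IntermediateField.adjoin E {s}).algebraMap_mem ⟨x, hE.prop.1 hx⟩
      have hle : E ≤ (IntermediateField.adjoin E {s}).restrictScalars k := fun x hx =>
        (IntermediateField.adjoin E {s}).algebraMap_mem ⟨x, hx⟩
      exact hs (hE.le_of_ge hmem hle (IntermediateField.mem_adjoin_simple_self E s))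
    have hfin : FiniteDimensional E (IntermediateField.adjoin E {s}) :=
      IntermediateField.adjoin.finiteDimensional (Algebra.IsIntegral.isIntegral s)
    have heq := IntermediateField.eq_of_le_of_finrank_eq
      (IntermediateField.adjoin_simple_le_iff.mpr hts)
      ((hdeg t hE.prop.2).trans (hdeg s hs).symm)
    rw [heq]
    exact IntermediateField.mem_adjoin_simple_self E s
  have hD : KaehlerDifferential.D E K t = 0 := by
    have := congrArg (KaehlerDifferential.map k E K K) ht
    simpa using this
  have hD' : ∀ s, KaehlerDifferential.D E K s = 0 := by
    intro s
    induction hgen s using IntermediateField.adjoin_induction with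
    | mem x hx => rw [Set.mem_singleton_iff.mp hx, hD]
    | algebraMap x => exact Derivation.map_algebraMap _ _
    | add x y _ _ hx hy => rw [map_add, hx, hy, add_zero]
    | mul x y _ _ hx hy => rw [Derivation.leibniz, hx, hy, smul_zero, smul_zero, add_zero]
    | inv x _ hx => rw [Derivation.leibniz_inv, hx, smul_zero]
  -- As `t` generates `K` over `E` and has zero differential, `K / E` is unramified; being also
  -- purely inseparable it is trivial, which contradicts `t ∉ E`.
  have hunr : Algebra.FormallyUnramified E K := by
    rw [Algebra.formallyUnramified_iff, ← not_nontrivial_iff_subsingleton]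
    intro hnt
    have hspan := KaehlerDifferential.span_range_derivation E K
    have h0 : Submodule.span K (Set.range (KaehlerDifferential.D E K)) = ⊥ := by
      rw [Submodule.span_eq_bot]
      rintro _ ⟨s, rfl⟩
      exact hD' s
    exact bot_ne_top (h0.symm.trans hspan)
  have hfg : Algebra.EssFiniteType E K := by
    rw [← IntermediateField.fg_top_iff]
    exact ⟨{t}, top_le_iff.mp fun s _ => by simpa using hgen s⟩
  have htop := Algebra.FormallyUnramified.range_eq_top_of_isPurelyInseparable E K
  have : t ∈ (algebraMap E K).range := htop ▸ trivial
  obtain ⟨e, rfl⟩ := this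
  exact hE.prop.2 e.2

end PthRoot

end

/-! ### Semilinear maps preserving a lattice over a valuation ring. -/

section

section ValuationLattice

variable {K : Type*} [Field K] (O : ValuationSubring K) {V : Type*} [AddCommGroup V] [Module K V]

/-- Finitely generated submodules over a valuation ring of a vector space are free. -/
theorem free_of_fg {M : Submodule O V} (hM : M.FG) : Module.Free O M := by
  have : Module.Finite O M := Module.Finite.iff_fg.mpr hM
  have : Module.Flat O M := by
    rw [Module.Flat.flat_iff_torsion_eq_bot_of_isBezout, eq_bot_iff]
    rintro m ⟨⟨r, hr⟩, h⟩
    have h1 : (r : K) • (m : V) = 0 := congrArg Subtype.val h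
    rcases smul_eq_zero.mp h1 with h2 | h2
    · exact (nonZeroDivisors.ne_zero hr (Subtype.ext h2)).elim
    · exact Subtype.ext h2
  exact Module.free_of_flat_of_isLocalRing

/-- A finitely generated submodule over a valuation ring meets every subspace in a finitely
generated submodule. -/
theorem fg_comap_subtype {M : Submodule O V} (hM : M.FG) (W : Submodule K V) :
    (M.comap (W.subtype.restrictScalars O)).FG := by
  -- The image of `M` in `V ⧸ W` is finitely generated inside a vector space, hence free, so the
  -- kernel of `M` onto it is finitely generated.
  let q : V →ₗ[O] V ⧸ W := W.mkQ.restrictScalars O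
  have hM' : (M.map q).FG := hM.map q
  have : Module.Finite O M := Module.Finite.iff_fg.mpr hM
  have : Module.Finite O (M.map q) := Module.Finite.iff_fg.mpr hM'
  have : Module.Free O (M.map q) := free_of_fg O hM'
  have : Module.FinitePresentation O (M.map q) := Module.finitePresentation_of_projective O _
  have h1 := (Module.FinitePresentation.fg_ker (q.submoduleMap M)
    (q.submoduleMap_surjective M)).map M.subtype
  have hinj : Function.Injective (W.subtype.restrictScalars O) := W.subtype_injective
  refine Submodule.fg_of_fg_map_injective (W.subtype.restrictScalars O) hinj ?_
  suffices h : (M.comap (W.subtype.restrictScalars O)).map (W.subtype.restrictScalars O) =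
      (LinearMap.ker (q.submoduleMap M)).map M.subtype from h ▸ h1
  ext x
  simp only [Submodule.mem_map, Submodule.mem_comap, LinearMap.mem_ker]
  constructor
  · rintro ⟨y, hy, rfl⟩
    refine ⟨⟨y, hy⟩, Subtype.ext ?_, rfl⟩
    exact (Submodule.Quotient.mk_eq_zero W).mpr y.2
  · rintro ⟨y, hy, rfl⟩
    have h2 : W.mkQ (y : V) = 0 := congrArg Subtype.val hy
    exact ⟨⟨y, (Submodule.Quotient.mk_eq_zero W).mp h2⟩, y.2, rfl⟩

/-- Cramer's rule: every term except `j = i` repeats a vector. -/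
theorem alternatingMap_update_sum {R M N ι : Type*} [CommRing R] [AddCommGroup M] [Module R M]
    [AddCommGroup N] [Module R N] [Fintype ι] [DecidableEq ι] (g : M [⋀^ι]→ₗ[R] N) (w : ι → M)
    (f : ι → R) (i : ι) : g (Function.update w i (∑ j, f j • w j)) = f i • g w := by
  rw [AlternatingMap.map_update_sum, Finset.sum_eq_single i]
  · rw [AlternatingMap.map_update_smul, Function.update_eq_self]
  · intro j _ hj
    rw [AlternatingMap.map_update_smul, AlternatingMap.map_update_self _ _ hj.symm, smul_zero]
  · exact fun h => (h (Finset.mem_univ _)).elim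

theorem basis_det_semilinear {σ : K →+* K} {ι : Type*} [Fintype ι] [DecidableEq ι]
    (e : Module.Basis ι K V) (ζ : V →ₛₗ[σ] V) (w : ι → V) :
    e.det (fun i => ζ (w i)) = σ (e.det w) * e.det (fun i => ζ (e i)) := by
  have h : e.toMatrix (fun i => ζ (w i)) =
      e.toMatrix (fun i => ζ (e i)) * σ.mapMatrix (e.toMatrix w) := by
    ext i j
    rw [Matrix.mul_apply, Module.Basis.toMatrix_apply]
    conv_lhs => rw [← e.sum_repr (w j), map_sum, map_sum, Finset.sum_apply']
    refine Finset.sum_congr rfl fun l _ => ?_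
    rw [map_smulₛₗ, map_smul, Finsupp.smul_apply, smul_eq_mul, mul_comm]
    rfl
  rw [Module.Basis.det_apply, h, Matrix.det_mul, ← RingHom.map_det, mul_comm]
  rfl

/-- A cyclic Frobenius-semilinear endomorphism preserving a lattice over a valuation ring
has integral constant coefficient; if this coefficient is a unit, all coefficients are
integral. -/
theorem coeff_mem_of_stable_lattice {p : ℕ} [hp : Fact p.Prime] [CharP K p] {n : ℕ}
    (w : Module.Basis (Fin (n + 1)) K V) (ζ : V →ₛₗ[frobenius K p] V) (f : Fin (n + 1) → K)
    (h1 : ∀ i : Fin n, ζ (w i.castSucc) = w i.succ) (h2 : ζ (w (Fin.last n)) = ∑ j, f j • w j)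
    {N : Submodule O V} (hN : N.FG) (hstab : ∀ x ∈ N, ζ x ∈ N) (hw0 : w 0 ∈ N) :
    f 0 ∈ O ∧ (f 0 ≠ 0 → (f 0)⁻¹ ∈ O → ∀ i, f i ∈ O) := by
  have hw : ∀ i, w i ∈ N := by
    intro i
    induction i using Fin.induction with
    | zero => exact hw0
    | succ i ih => exact h1 i ▸ hstab _ ih
  have : Module.Free O N := free_of_fg O hN
  have : Module.Finite O N := Module.Finite.iff_fg.mpr hN
  let e₀ := Module.Free.chooseBasis O N
  have hli : LinearIndependent K (fun i => (e₀ i : V)) := by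
    rw [← LinearIndependent.iff_fractionRing O K]
    exact e₀.linearIndependent.map' N.subtype N.ker_subtype
  have hexp : ∀ (x : V) (hx : x ∈ N), x = ∑ i, ((e₀.repr ⟨x, hx⟩ i : O) : K) • (e₀ i : V) := by
    intro x hx
    change N.subtype ⟨x, hx⟩ = _
    conv_lhs => rw [← e₀.sum_repr ⟨x, hx⟩]
    rw [map_sum]
    rfl
  have hsp : ⊤ ≤ Submodule.span K (Set.range fun i => (e₀ i : V)) := by
    rw [← w.span_eq, Submodule.span_le]
    rintro _ ⟨i, rfl⟩
    rw [SetLike.mem_coe, hexp (w i) (hw i)]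
    exact Submodule.sum_mem _ fun j _ =>
      Submodule.smul_mem _ _ (Submodule.subset_span ⟨j, rfl⟩)
  let e₁ := Module.Basis.mk hli hsp
  have he₁ : ∀ i, e₁ i = e₀ i := fun i => by simp [e₁]
  let e := e₁.reindex (e₁.indexEquiv w)
  have heN : ∀ i, e i ∈ N := fun i => by
    rw [Module.Basis.reindex_apply, he₁]; exact (e₀ _).2
  have hrepr : ∀ x ∈ N, ∀ i, e.repr x i ∈ O := by
    intro x hx i
    rw [Module.Basis.repr_reindex_apply, hexp x hx]
    simp_rw [← he₁]
    rw [Module.Basis.repr_sum_self]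
    exact (e₀.repr ⟨x, hx⟩ _).2
  have hdet : ∀ v : Fin (n + 1) → V, (∀ i, v i ∈ N) → e.det v ∈ O := by
    intro v hv
    have h3 : e.toMatrix v = O.subtype.mapMatrix
        (Matrix.of fun i j => (⟨e.repr (v j) i, hrepr _ (hv j) i⟩ : O)) := rfl
    rw [Module.Basis.det_apply, h3, ← RingHom.map_det]
    exact SetLike.coe_mem (Matrix.det _)
  have hT : e.det w ≠ 0 := (e.isUnit_det w).ne_zero
  -- The family `ζ(wᵢ)` is a cyclic permutation of `w` with `w₀` replaced by `∑ fⱼ wⱼ`. With `T =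
  -- e.det w` and `G` the determinant of `ζ(e)`, semilinearity then gives `± f₀ T = T ^ p G`.
  have hkey : e.det (fun i => ζ (w i)) = (Equiv.Perm.sign (finRotate (n + 1)) : ℤ) • (f 0 * e.det w) := by
    have h3 : (fun i => ζ (w i)) = (Function.update w 0 (∑ j, f j • w j)) ∘ finRotate (n + 1) := by
      funext i
      rw [Function.comp_apply]
      induction i using Fin.lastCases with
      | last => rw [finRotate_last, Function.update_self, h2]
      | cast i =>
        rw [finRotate_apply, Fin.coeSucc_eq_succ, Function.update_of_ne (Fin.succ_ne_zero i), h1]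
    rw [h3, AlternatingMap.map_perm, alternatingMap_update_sum, smul_eq_mul, Units.smul_def]
  rw [basis_det_semilinear, frobenius_def] at hkey
  set G := e.det fun i => ζ (e i) with hG
  have hGO : G ∈ O := hdet _ fun i => hstab _ (heN i)
  have hTO : e.det w ∈ O := hdet _ hw
  obtain ⟨m, hm⟩ := Nat.exists_eq_add_of_le' hp.out.two_le
  have hsign : ∃ s : ℤ, s * s = 1 ∧ (s : K) * (f 0 * e.det w) = e.det w ^ p * G := by
    refine ⟨(Equiv.Perm.sign (finRotate (n + 1)) : ℤ), ?_, ?_⟩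
    · exact congrArg Units.val (Int.units_mul_self (Equiv.Perm.sign (finRotate (n + 1))))
    · rw [hkey, zsmul_eq_mul]
  obtain ⟨s, hs, hkey⟩ := hsign
  have hs' : (s : K) * s = 1 := by exact_mod_cast congrArg (Int.cast (R := K)) hs
  have hf0 : f 0 = s * e.det w ^ (m + 1) * G := by
    apply mul_right_cancel₀ hT
    calc f 0 * e.det w = (s * s) * (f 0 * e.det w) := by rw [hs', one_mul]
      _ = s * (e.det w ^ p * G) := by rw [mul_assoc, hkey]
      _ = _ := by rw [hm]; ring
  have hsO : (s : K) ∈ O := intCast_mem O s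
  refine ⟨hf0 ▸ mul_mem (mul_mem hsO (pow_mem hTO _)) hGO, fun hne hinv i => ?_⟩
  -- As `p = m + 2`, `f₀ = ± T ^ (m + 1) G` is divisible by `T` in `O`, so `T` is a unit whenever
  -- `f₀` is. The other coefficients then follow from Cramer's rule.
  have hTi : (e.det w)⁻¹ ∈ O := by
    have : (e.det w)⁻¹ = (f 0)⁻¹ * (s * e.det w ^ m * G) := by
      rw [eq_inv_mul_iff_mul_eq₀ hne, ← div_eq_mul_inv, div_eq_iff hT, hf0]; ring
    rw [this]
    exact mul_mem hinv (mul_mem (mul_mem hsO (pow_mem hTO _)) hGO)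
  have h4 : f i = (e.det w)⁻¹ * e.det (Function.update w i (ζ (w (Fin.last n)))) := by
    rw [h2, alternatingMap_update_sum, smul_eq_mul, mul_left_comm, inv_mul_cancel₀ hT, mul_one]
  rw [h4]
  refine mul_mem hTi (hdet _ fun j => ?_)
  rcases eq_or_ne j i with rfl | hj
  · rw [Function.update_self]; exact hstab _ (hw _)
  · rw [Function.update_of_ne hj]; exact hw j

end ValuationLattice

end

/-! ### Integrality through valuation rings, and vanishing of exact forms by iterating the
semilinear map. -/

section

section Integral

variable {k K : Type*} [Field k] [Field K] [Algebra k K]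

/-- The integral closure of `k` in `K` is an intersection of valuation rings, all of which contain
`k`. -/
theorem isIntegral_of_forall_valuationSubring {x : K}
    (hx : ∀ O : ValuationSubring K, (∀ c, algebraMap k K c ∈ O) → x ∈ O) : IsIntegral k x := by
  let R : Subring K := (integralClosure k K).toSubring
  have : IsIntegrallyClosedIn R K :=
    inferInstanceAs (IsIntegrallyClosedIn (integralClosure k K) K)
  have h := Subring.eq_iInf_of_isIntegrallyClosedIn (R := R)
  have h2 : x ∈ R := by
    rw [h, Subring.mem_iInf]
    exact fun V => hx V.1 fun c => V.2 (isIntegral_algebraMap (R := k) (x := c))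
  exact h2

theorem mem_valuationSubring_of_isIntegral {x : K} (hx : IsIntegral k x) (O : ValuationSubring K)
    (hO : ∀ c, algebraMap k K c ∈ O) : x ∈ O := by
  obtain ⟨P, hP, h0⟩ := hx
  let φ : k →+* O := (algebraMap k K).codRestrict O hO
  have h1 : IsIntegral O x := ⟨P.map φ, hP.map φ, by rw [Polynomial.eval₂_map]; exact h0⟩
  obtain ⟨y, rfl⟩ := IsIntegrallyClosed.isIntegral_iff.mp h1
  exact y.2

/-- The algebraic closure of `k` in `K` is algebraic over a perfect field, hence perfect. -/
theorem exists_pow_eq_of_isIntegral (p : ℕ) [hp : Fact p.Prime] [CharP k p] [PerfectField k]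
    {x : K} (hx : IsIntegral k x) : ∃ g, IsIntegral k g ∧ g ^ p = x := by
  let k' := algebraicClosure k K
  have : CharP k' p := charP_of_injective_algebraMap (algebraMap k k').injective p
  have : PerfectField k' := Algebra.IsAlgebraic.perfectField (K := k)
  have : PerfectRing k' p := PerfectField.toPerfectRing p
  obtain ⟨g, hg⟩ := surjective_frobenius k' p ⟨x, mem_algebraicClosure_iff'.mpr hx⟩
  exact ⟨g, mem_algebraicClosure_iff'.mp g.2, congrArg Subtype.val hg⟩

end Integral

section SemilinearIterates

variable {p : ℕ} [hp : Fact p.Prime] {k K : Type*} [Field k] [Field K] [Algebra k K]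
  [CharP k p] [PerfectField k] [CharP K p] {V : Type*} [AddCommGroup V] [Module K V]

/-- Restriction of a cyclic relation to the subspace it spans. -/
theorem coeff_mem_of_stable {n : ℕ} (z : ℕ → V) (ζ : V →ₛₗ[frobenius K p] V)
    (hz : ∀ i, ζ (z i) = z (i + 1)) (s : ℕ)
    (hli : LinearIndependent K fun i : Fin (n + 1) => z (s + i)) (f : Fin (n + 1) → K)
    (hf : z (s + (n + 1)) = ∑ i, f i • z (s + i)) (O : ValuationSubring K)
    {M : Submodule O V} (hM : M.FG) (hstab : ∀ x ∈ M, ζ x ∈ M) (hs : z s ∈ M) :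
    f 0 ∈ O ∧ (f 0 ≠ 0 → (f 0)⁻¹ ∈ O → ∀ i, f i ∈ O) := by
  let w := Module.Basis.span hli
  have hw : ∀ i, (w i : V) = z (s + i) := fun i => by
    rw [Module.Basis.span_apply]
  have hζ : ∀ x : Submodule.span K (Set.range fun i : Fin (n + 1) => z (s + i)), ζ x ∈
      Submodule.span K (Set.range fun i : Fin (n + 1) => z (s + i)) := by
    rintro ⟨x, hx⟩
    change ζ x ∈ _
    induction hx using Submodule.span_induction with
    | mem x hx =>
      obtain ⟨i, rfl⟩ := hx
      dsimp only
      rw [hz]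
      induction i using Fin.lastCases with
      | last =>
        rw [Fin.val_last, add_assoc, hf]
        exact Submodule.sum_mem _ fun j _ =>
          Submodule.smul_mem _ _ (Submodule.subset_span ⟨j, rfl⟩)
      | cast i => exact Submodule.subset_span ⟨i.succ, by simp [add_assoc]⟩
    | zero => rw [map_zero]; exact zero_mem _
    | add x y _ _ hx hy => rw [map_add]; exact add_mem hx hy
    | smul c x _ hx => rw [map_smulₛₗ]; exact Submodule.smul_mem _ _ hx
  let ζ' := LinearMap.codRestrict _ (ζ.domRestrict _) hζ
  refine coeff_mem_of_stable_lattice O w ζ' f (fun i => Subtype.ext ?_) (Subtype.ext ?_)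
    (fg_comap_subtype O hM _) (fun x hx => hstab _ hx) ?_
  · change ζ (w i.castSucc) = w i.succ
    rw [hw, hw, hz]
    simp [add_assoc]
  · change ζ (w (Fin.last n)) = _
    rw [hw, hz, Fin.val_last, add_assoc, hf, Submodule.coe_sum]
    exact Finset.sum_congr rfl fun i _ => by rw [Submodule.coe_smul, hw]
  · change (w 0 : V) ∈ M
    rw [hw]
    exact hs

/-- An exact form which lies, at every valuation ring over `k`, in a finitely generated
module stable under the inverse Cartier operator, vanishes. -/
theorem D_eq_zero_of_forall_valuationSubring [Module k V] (D : Derivation k K V)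
    (ζ : V →ₛₗ[frobenius K p] V) (hinj : ∀ η h, ζ η = D h → η = 0) (t : K)
    (hval : ∀ O : ValuationSubring K, (∀ c, algebraMap k K c ∈ O) →
      ∃ M : Submodule O V, M.FG ∧ (∀ x ∈ M, ζ x ∈ M) ∧ D t ∈ M) : D t = 0 := by
  classical
  by_contra hne
  have hpK : (p : K) = 0 := CharP.cast_eq_zero K p
  have hinj0 : ∀ η, ζ η = 0 → η = 0 := fun η h => hinj η 0 (by rw [h, map_zero])
  let z : ℕ → V := fun i => ζ^[i] (D t)
  have hz : ∀ i, ζ (z i) = z (i + 1) := fun i => (Function.iterate_succ_apply' ζ i (D t)).symm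
  have hz0 : ∀ i, z i ≠ 0 := by
    intro i
    induction i with
    | zero => exact hne
    | succ i ih => exact fun h => ih (hinj0 _ (by rw [hz, h]))
  have hmem : ∀ (O : ValuationSubring K) (M : Submodule O V), (∀ x ∈ M, ζ x ∈ M) → D t ∈ M →
      ∀ i, z i ∈ M := by
    intro O M hM ht i
    induction i with
    | zero => exact ht
    | succ i ih => exact hz i ▸ hM _ ih
  -- The valuation ring `⊤`, equal to `K`, places all iterates in a finite-dimensional space.
  have hex : ∃ d, ∃ s, ¬ LinearIndependent K fun i : Fin d => z (s + i) := by
    obtain ⟨M, ⟨S, hS⟩, hM, ht⟩ := hval ⊤ fun _ => trivial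
    refine ⟨S.card + 1, 0, fun hli => ?_⟩
    have h1 := linearIndependent_le_span' _ hli (S : Set V) (by
      rintro _ ⟨i, rfl⟩
      have h2 := hmem _ M hM ht (0 + i)
      rw [← hS] at h2
      exact Submodule.span_le_restrictScalars (⊤ : ValuationSubring K) K (S : Set V) h2)
    simp at h1
  obtain ⟨s, hs⟩ := Nat.find_spec hex
  -- The length is minimal over all starting points, so shorter windows are independent wherever
  -- they start. This is used below at `s`, `s + 1` and `0`.
  have hmin : ∀ d < Nat.find hex, ∀ s, LinearIndependent K fun i : Fin d => z (s + i) := by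
    intro d hd s
    have := Nat.find_min hex hd
    push Not at this
    exact this s
  obtain ⟨n, hn⟩ : ∃ n, Nat.find hex = n + 2 := by
    refine ⟨Nat.find hex - 2, ?_⟩
    have h0 : Nat.find hex ≠ 0 := fun h => hs (by
      rw [h]; exact linearIndependent_empty_type)
    have h1 : Nat.find hex ≠ 1 := fun h => hs (by
      rw [h]; exact LinearIndependent.of_subsingleton (0 : Fin 1) (hz0 _))
    omega
  rw [hn] at hs
  have hli : ∀ s, LinearIndependent K fun i : Fin (n + 1) => z (s + i) := hmin (n + 1) (by omega)
  have hrel : ∃ f : Fin (n + 1) → K, z (s + (n + 1)) = ∑ i, f i • z (s + i) := by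
    rw [linearIndependent_finSucc'] at hs
    push Not at hs
    obtain ⟨f, hf⟩ := (Submodule.mem_span_range_iff_exists_fun K).mp (hs (hli s))
    exact ⟨f, hf.symm⟩
  obtain ⟨f, hf⟩ := hrel
  -- With `f 0 = 0` the window of length `n + 1` starting at `s + 1` would be dependent.
  have hf0 : f 0 ≠ 0 := by
    intro h0
    have h1 := (linearIndependent_finSucc'.mp (hli (s + 1))).2
    apply h1
    change z (s + 1 + n) ∈ _
    rw [show s + 1 + n = s + (n + 1) by omega, hf, Fin.sum_univ_succ, h0, zero_smul, zero_add]
    refine Submodule.sum_mem _ fun i _ => Submodule.smul_mem _ _ (Submodule.subset_span ⟨i, ?_⟩)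
    change z (s + 1 + i) = z (s + (i + 1))
    congr 1
    omega
  have hO : ∀ O : ValuationSubring K, (∀ c, algebraMap k K c ∈ O) →
      f 0 ∈ O ∧ (f 0 ≠ 0 → (f 0)⁻¹ ∈ O → ∀ i, f i ∈ O) := by
    intro O hk
    obtain ⟨M, hM, hst, ht⟩ := hval O hk
    exact coeff_mem_of_stable z ζ hz s (hli s) f hf O hM hst (hmem O M hst ht s)
  have hint0 : IsIntegral k (f 0) := isIntegral_of_forall_valuationSubring fun O hk => (hO O hk).1
  -- The inverse of `f 0` is integral over `k` as well, so `f 0` is a unit in every `O`, as the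
  -- second half of `hO` requires.
  have hint : ∀ i, IsIntegral k (f i) := fun i =>
    isIntegral_of_forall_valuationSubring fun O hk =>
      (hO O hk).2 hf0 (mem_valuationSubring_of_isIntegral hint0.inv O hk) i
  -- A relation at `s + 1` is `ζ` of the relation at `s` with `p`-th roots of the coefficients; `ζ`
  -- is injective, so the latter holds too.
  have hdesc : ∀ s, (∃ f : Fin (n + 1) → K, (∀ i, IsIntegral k (f i)) ∧
      z (s + (n + 1)) = ∑ i, f i • z (s + i)) → ∃ f : Fin (n + 1) → K,
        (∀ i, IsIntegral k (f i)) ∧ z (n + 1) = ∑ i, f i • z i := by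
    intro s
    induction s with
    | zero => simp only [zero_add]; exact id
    | succ s ih =>
      rintro ⟨f, hfi, hf⟩
      choose g hgi hg using fun i => exists_pow_eq_of_isIntegral p (hfi i)
      refine ih ⟨g, hgi, ?_⟩
      rw [← sub_eq_zero]
      apply hinj0
      rw [map_sub, hz, map_sum, show s + (n + 1) + 1 = s + 1 + (n + 1) by omega, hf, sub_eq_zero]
      refine Finset.sum_congr rfl fun i _ => ?_
      rw [map_smulₛₗ, hz, frobenius_def, hg, show s + 1 + (i : ℕ) = s + i + 1 by omega]
  obtain ⟨f, hfi, hf⟩ := hdesc s ⟨f, hint, hf⟩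
  choose g hgi hg using fun i => exists_pow_eq_of_isIntegral p (hfi i)
  -- `ζ` sends this to `f 0 • D t = D (f 0 * t)`, since `f 0 = g 0 ^ p` is killed by `D`.
  -- Injectivity modulo exact forms applies, and the result contradicts independence of `z 0, …, z
  -- n`.
  have h1 : z n - ∑ i : Fin n, g i.succ • z i = 0 := by
    apply hinj _ (f 0 * t)
    rw [map_sub, hz, hf, Fin.sum_univ_succ, map_sum, D.leibniz, ← hg 0,
      map_pow_prime_eq_zero D hpK, smul_zero, add_zero]
    rw [sub_eq_iff_eq_add]
    congr 1
    refine Finset.sum_congr rfl fun i _ => ?_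
    rw [map_smulₛₗ, hz, frobenius_def, hg, Fin.val_succ]
  have h2 := (linearIndependent_finSucc'.mp (hli 0)).2
  apply h2
  change z (0 + n) ∈ _
  rw [zero_add, sub_eq_zero.mp h1]
  refine Submodule.sum_mem _ fun i _ => Submodule.smul_mem _ _ (Submodule.subset_span ⟨i, ?_⟩)
  change z (0 + i) = z i
  rw [zero_add]

end SemilinearIterates

end

/-! ### On smooth algebras, `p`-th powers are detected at generic points. -/

section

section PthPowersLocal

open TensorProduct

/-- Being a `p`-th power in a ring of characteristic `p` is a local property. -/
theorem exists_eq_pow_of_localization (p : ℕ) [hp : Fact p.Prime] {A : Type u} [CommRing A]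
    (hA : (p : A) = 0) (b : A)
    (H : ∀ (m : Ideal A) [m.IsMaximal], ∃ s : Localization.AtPrime m, algebraMap A _ b = s ^ p) :
    ∃ s, b = s ^ p := by
  -- The `f` whose `p`-th power is a denominator for the problem; they form an ideal because `p`-th
  -- powers are additive.
  let I : Ideal A :=
    { carrier := {f | ∃ s, f ^ p * b = s ^ p}
      zero_mem' := ⟨0, by rw [zero_pow hp.out.ne_zero, zero_mul]⟩
      add_mem' := by
        rintro f g ⟨s, hs⟩ ⟨t, ht⟩
        refine ⟨s + t, ?_⟩
        have h1 := map_add (powRingHom p A hA) f g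
        have h2 := map_add (powRingHom p A hA) s t
        change (f + g) ^ p = f ^ p + g ^ p at h1
        change (s + t) ^ p = s ^ p + t ^ p at h2
        rw [h1, h2, add_mul, hs, ht]
      smul_mem' := by
        rintro c f ⟨s, hs⟩
        exact ⟨c * s, by rw [smul_eq_mul, mul_pow, mul_assoc, hs, mul_pow]⟩ }
  have hI : I = ⊤ := by
    by_contra hne
    obtain ⟨m, hm, hle⟩ := Ideal.exists_le_maximal I hne
    obtain ⟨s, hs⟩ := H m
    obtain ⟨a, f, rfl⟩ := IsLocalization.exists_mk'_eq m.primeCompl s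
    rw [← IsLocalization.mk'_pow, eq_comm, IsLocalization.mk'_eq_iff_eq_mul, ← map_mul] at hs
    obtain ⟨c, hc⟩ := (IsLocalization.eq_iff_exists m.primeCompl _).mp hs
    have hmem : (c : A) * f ∈ I := by
      obtain ⟨q, hq⟩ := Nat.exists_eq_add_of_le' hp.out.one_le
      refine ⟨c * a, ?_⟩
      calc ((c : A) * f) ^ p * b = (c : A) ^ q * (c * (b * (f : A) ^ p)) := by
            rw [mul_pow]; nth_rw 1 [hq]; ring
        _ = (c : A) ^ q * (c * a ^ p) := by rw [hc, SubmonoidClass.coe_pow]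
        _ = ((c : A) ^ (q + 1)) * a ^ p := by ring
        _ = _ := by rw [mul_pow, ← hq]
    rcases hm.isPrime.mem_or_mem (hle hmem) with h | h
    · exact c.2 h
    · exact f.2 h
  obtain ⟨s, hs⟩ := (Ideal.eq_top_iff_one I).mp hI
  exact ⟨s, by rwa [one_pow, one_mul] at hs⟩

/-- `b` is a `p`-th power in every local ring of `A` which is a field. -/
def IsPthPowerAtFields (p : ℕ) {A : Type u} [CommRing A] (b : A) : Prop :=
  ∀ (q : Ideal A) [q.IsPrime] (F : Type u) [CommRing F] [Algebra A F] [IsLocalization.AtPrime F q],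
    IsField F → ∃ s : F, algebraMap A F b = s ^ p

theorem IsPthPowerAtFields.map {p : ℕ} {A : Type u} [CommRing A] {b : A}
    (hb : IsPthPowerAtFields p b) {B : Type u} [CommRing B] [Algebra A B] (M : Submonoid A)
    [IsLocalization M B] : IsPthPowerAtFields p (algebraMap A B b) := by
  intro q _ F _ _ _ hF
  let : Algebra A F := ((algebraMap B F).comp (algebraMap A B)).toAlgebra
  have : IsScalarTower A B F := IsScalarTower.of_algebraMap_eq fun _ => rfl
  have : IsLocalization.AtPrime F (q.comap (algebraMap A B)) :=
    IsLocalization.isLocalization_isLocalization_atPrime_isLocalization M F q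
  exact hb (q.comap (algebraMap A B)) F hF

section Etale

variable (P : Type u) {A : Type u} [CommRing P] [IsDomain P] [CommRing A] [Algebra P A]

theorem isReduced_tensor_fractionRing [Algebra.Etale P A] :
    IsReduced (A ⊗[P] FractionRing P) := by
  have : IsReduced (FractionRing P ⊗[P] A) :=
    Algebra.FormallyUnramified.isReduced_of_field (FractionRing P) _
  exact isReduced_of_injective (Algebra.TensorProduct.comm P A (FractionRing P))
    (AlgEquiv.injective _)

theorem isArtinianRing_tensor_fractionRing [Algebra.Etale P A] :
    IsArtinianRing (A ⊗[P] FractionRing P) := by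
  have := Algebra.FormallyUnramified.finite_of_free (FractionRing P) (FractionRing P ⊗[P] A)
  have : IsArtinianRing (FractionRing P ⊗[P] A) := isArtinian_of_tower (FractionRing P) inferInstance
  exact (Algebra.TensorProduct.comm P A (FractionRing P)).symm.surjective.isArtinianRing
    (f := (Algebra.TensorProduct.comm P A (FractionRing P)).symm.toRingHom)

theorem injective_algebraMap_tensor_fractionRing [Algebra.Etale P A] :
    Function.Injective (algebraMap A (A ⊗[P] FractionRing P)) :=
  Algebra.TensorProduct.includeLeft_injective (R := P) (S := P)
    (IsFractionRing.injective P (FractionRing P))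

theorem isReduced_of_etale [Algebra.Etale P A] : IsReduced A :=
  have := isReduced_tensor_fractionRing P (A := A)
  isReduced_of_injective _ (injective_algebraMap_tensor_fractionRing P (A := A))

/-- The ring `A ⊗ Frac P` is reduced and Artinian, so its local rings are fields and a root exists
there. The root is integral over `A`. Integral closure commutes with étale base change and `P` is
integrally closed, so the root lies in `A`. -/
theorem exists_eq_pow_of_etale [Algebra.Etale P A] [IsIntegrallyClosed P] (p : ℕ)
    [hp : Fact p.Prime] (hA : (p : A) = 0) {b : A} (hb : IsPthPowerAtFields p b) :
    ∃ s, b = s ^ p := by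
  let L := A ⊗[P] FractionRing P
  have hred : IsReduced L := isReduced_tensor_fractionRing P
  have hart : IsArtinianRing L := isArtinianRing_tensor_fractionRing P
  have hL : (p : L) = 0 := by rw [← map_natCast (algebraMap A L), hA, map_zero]
  obtain ⟨s, hs⟩ := exists_eq_pow_of_localization p hL (algebraMap A L b) (fun m _ => by
    have : IsReduced (Localization.AtPrime m) :=
      isReduced_localizationPreserves m.primeCompl (Localization.AtPrime m) hred
    have : IsArtinianRing (Localization.AtPrime m) :=
      IsArtinianRing.localization_artinian m.primeCompl _
    exact hb.map (Algebra.algebraMapSubmonoid A (nonZeroDivisors P)) m (Localization.AtPrime m)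
      (IsArtinianRing.isField_of_isReduced_of_isLocalRing _))
  have hint : IsIntegral A s :=
    IsIntegral.of_pow hp.out.pos (hs ▸ isIntegral_algebraMap)
  obtain ⟨x, hx⟩ := (TensorProduct.toIntegralClosure_bijective_of_smooth (R := P) (S := A)
    (B := FractionRing P)).2 ⟨s, hint⟩
  have hrange : ∀ x : A ⊗[P] integralClosure P (FractionRing P),
      ((TensorProduct.toIntegralClosure P A (FractionRing P) x : _) : L) ∈
        (algebraMap A L).range := by
    intro x
    induction x with
    | zero => rw [map_zero]; exact zero_mem _
    | add x y hx hy => rw [map_add]; exact add_mem hx hy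
    | tmul a c =>
      obtain ⟨c', hc'⟩ := IsIntegrallyClosed.isIntegral_iff.mp c.2
      refine ⟨c' • a, ?_⟩
      change (c' • a) ⊗ₜ[P] (1 : FractionRing P) = a ⊗ₜ (c : FractionRing P)
      rw [← hc', TensorProduct.smul_tmul, Algebra.smul_def, mul_one]
  obtain ⟨a, ha⟩ := hrange x
  rw [hx] at ha
  refine ⟨a, injective_algebraMap_tensor_fractionRing P ?_⟩
  rw [map_pow, ha, hs]

end Etale

section Smooth

theorem isReduced_of_smooth (k : Type u) {A : Type u} [Field k] [CommRing A] [Algebra k A]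
    [Algebra.Smooth k A] : IsReduced A := by
  refine ⟨fun x hx => eq_zero_of_localization x fun m _ => ?_⟩
  obtain ⟨f, hf, n, _, _, _⟩ :=
    Algebra.IsSmoothAt.exists_isStandardEtale_mvPolynomial (R := k) (p := m)
  have := isReduced_of_etale (MvPolynomial (Fin n) k) (A := Localization.Away f)
  have hu : IsUnit (algebraMap A (Localization.AtPrime m) f) :=
    IsLocalization.map_units (Localization.AtPrime m) (⟨f, hf⟩ : m.primeCompl)
  rw [← IsLocalization.Away.lift_eq (S := Localization.Away f) f hu,
    (hx.map (algebraMap A (Localization.Away f))).eq_zero, map_zero]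

/-- Locally a smooth algebra is étale over a polynomial ring, an integrally closed domain. -/
theorem exists_eq_pow_of_smooth (k : Type u) {A : Type u} [Field k] [CommRing A] [Algebra k A]
    [Algebra.Smooth k A] (p : ℕ) [hp : Fact p.Prime] (hA : (p : A) = 0) {b : A} (hb : IsPthPowerAtFields p b) :
    ∃ s, b = s ^ p := by
  refine exists_eq_pow_of_localization p hA b fun m _ => ?_
  obtain ⟨f, hf, n, _, _, _⟩ :=
    Algebra.IsSmoothAt.exists_isStandardEtale_mvPolynomial (R := k) (p := m)
  obtain ⟨s, hs⟩ := exists_eq_pow_of_etale (MvPolynomial (Fin n) k) (A := Localization.Away f) p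
    (by rw [← map_natCast (algebraMap A _), hA, map_zero]) (hb.map (Submonoid.powers f))
  have hu : IsUnit (algebraMap A (Localization.AtPrime m) f) :=
    IsLocalization.map_units (Localization.AtPrime m) (⟨f, hf⟩ : m.primeCompl)
  refine ⟨IsLocalization.Away.lift f hu s, ?_⟩
  rw [← map_pow, ← hs, IsLocalization.Away.lift_eq]

end Smooth

end PthPowersLocal

end

/-! ### Descent of Frobenius subrings along a retraction. -/

section

section Retraction

variable (p : ℕ) [hp : Fact p.Prime]

theorem exists_pow_sub_pow_eq {A : Type*} [CommRing A] (hA : (p : A) = 0) (a b : A) :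
    ∃ c, a ^ p - b ^ p = c ^ p := by
  refine ⟨a - b, ?_⟩
  have h := map_sub (powRingHom p A hA) a b
  exact h.symm

theorem exists_pow_add_pow_eq {A : Type*} [CommRing A] (hA : (p : A) = 0) (a b : A) :
    ∃ c, a ^ p + b ^ p = c ^ p := by
  refine ⟨a + b, ?_⟩
  have h := map_add (powRingHom p A hA) a b
  exact h.symm

/-- An `A`-linear retraction of `i : A → C` which preserves `p`-th powers. -/
structure PthRetraction {A C : Type*} [CommRing A] [CommRing C] (i : A →+* C) where
  toFun : C →+ A
  map_mul' (a : A) (c : C) : toFun (i a * c) = a * toFun c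
  map_one' : toFun 1 = 1
  map_pow' (c : C) : ∃ a, toFun (c ^ p) = a ^ p

variable {p} {A C : Type*} [CommRing A] [CommRing C] {i : A →+* C}

/-- The subring of `W₂(A)` obtained from a Frobenius subring of `W₂(C)` by a retraction. -/
def PthRetraction.descend (hA : (p : A) = 0) (hC : (p : C) = 0) (r : PthRetraction p i)
    (R : Subring (W2 p C)) : Subring (W2 p A) where
  -- An error `V c` is tolerated when the retraction of `c` is a `p`-th power. It persists under
  -- products: the cross terms are `V` of `p`-th powers of `A` times `c` or `c'`, the retraction is
  -- `A`-linear, and `V c * V c' = 0`.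
  carrier := {w | ∃ c, W2.map i w + W2.V c ∈ R ∧ ∃ a, r.toFun c = a ^ p}
  zero_mem' := ⟨0, by simp, 0, by simp [hp.out.ne_zero]⟩
  one_mem' := ⟨0, by simp, 0, by simp [hp.out.ne_zero]⟩
  add_mem' := by
    rintro w w' ⟨c, hc, a, ha⟩ ⟨c', hc', a', ha'⟩
    refine ⟨c + c', ?_, ?_⟩
    · have := R.add_mem hc hc'
      rw [map_add, map_add]
      convert this using 1
      ring
    · rw [map_add, ha, ha']
      exact exists_pow_add_pow_eq p hA a a'
  neg_mem' := by
    rintro w ⟨c, hc, a, ha⟩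
    refine ⟨-c, ?_, ?_⟩
    · have := R.neg_mem hc
      rw [map_neg, map_neg]
      convert this using 1
      ring
    · obtain ⟨b, hb⟩ := exists_pow_sub_pow_eq p hA 0 a
      rw [zero_pow hp.out.ne_zero, zero_sub] at hb
      exact ⟨b, by rw [map_neg, ha, hb]⟩
  mul_mem' := by
    rintro w w' ⟨c, hc, a, ha⟩ ⟨c', hc', a', ha'⟩
    refine ⟨i (W2.c0 w ^ p) * c' + i (W2.c0 w' ^ p) * c, ?_, ?_⟩
    · have := R.mul_mem hc hc'
      convert this using 1
      have h1 : W2.map i w * W2.V c' = W2.V (i (W2.c0 w ^ p) * c') := by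
        rw [W2.mul_V hC, W2.c0_map, map_pow]
      have h2 : W2.map i w' * W2.V c = W2.V (i (W2.c0 w' ^ p) * c) := by
        rw [W2.mul_V hC, W2.c0_map, map_pow]
      rw [map_mul, map_add, ← h1, ← h2]
      have h3 := W2.V_mul_V (p := p) hC c c'
      linear_combination -h3
    · rw [map_add, r.map_mul', r.map_mul', ha, ha', ← mul_pow, ← mul_pow]
      exact exists_pow_add_pow_eq p hA _ _

theorem PthRetraction.mem_descend (hA : (p : A) = 0) (hC : (p : C) = 0) (r : PthRetraction p i)
    (R : Subring (W2 p C)) (w : W2 p A) :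
    w ∈ r.descend hA hC R ↔ ∃ c, W2.map i w + W2.V c ∈ R ∧ ∃ a, r.toFun c = a ^ p := Iff.rfl

theorem PthRetraction.apply (r : PthRetraction p i) (a : A) : r.toFun (i a) = a := by
  rw [← mul_one (i a), r.map_mul', r.map_one', mul_one]

/-- If `v` in `R` lies over `i a`, the second component `r v₁` leaves the error `v₁ - i (r v₁)`,
which `r` kills. If `i b + c = d ^ p` with `r c = a ^ p`, applying `r` shows that `b` is a
difference of `p`-th powers. -/
theorem PthRetraction.isFrobSubring_descend (hA : (p : A) = 0) (hC : (p : C) = 0)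
    (r : PthRetraction p i) {R : Subring (W2 p C)} (hR : IsFrobSubring p R) :
    IsFrobSubring p (r.descend hA hC R) where
  surj a := by
    obtain ⟨v, hv, hva⟩ := hR.surj (i a)
    refine ⟨W2.mk a (r.toFun (v.coeff 1)),
      ⟨v.coeff 1 - i (r.toFun (v.coeff 1)), ?_, 0, ?_⟩, W2.c0_mk _ _⟩
    · convert hv using 1
      rw [W2.add_V]
      apply W2.ext'
      · simp [hva]
      · simp
    · rw [map_sub, r.apply, sub_self, zero_pow hp.out.ne_zero]
  V_mem_iff b := by
    rw [r.mem_descend]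
    constructor
    · rintro ⟨c, hc, a, ha⟩
      rw [W2.map_V, ← map_add, hR.V_mem_iff] at hc
      obtain ⟨d, hd⟩ := hc
      obtain ⟨e, he⟩ := r.map_pow' d
      rw [← hd, map_add, r.apply, ha] at he
      obtain ⟨f, hf⟩ := exists_pow_sub_pow_eq p hA e a
      exact ⟨f, by rw [← hf, ← he]; ring⟩
    · rintro ⟨c, rfl⟩
      refine ⟨0, ?_, 0, by simp [hp.out.ne_zero]⟩
      rw [map_zero, add_zero, W2.map_V, hR.V_mem_iff]
      exact ⟨i c, by rw [map_pow]⟩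

theorem PthRetraction.map_mem_descend (hA : (p : A) = 0) (hC : (p : C) = 0)
    (r : PthRetraction p i) {R : Subring (W2 p C)} {A' C' : Type*} [CommRing A'] [CommRing C']
    {i' : A' →+* C'} (hA' : (p : A') = 0) (hC' : (p : C') = 0)
    (r' : PthRetraction p i') {R' : Subring (W2 p C')} (φ : A →+* A') (ψ : C →+* C')
    (hi : ∀ a, ψ (i a) = i' (φ a)) (hr : ∀ c, r'.toFun (ψ c) = φ (r.toFun c))
    (hR : ∀ w ∈ R, W2.map ψ w ∈ R') {w : W2 p A} (hw : w ∈ r.descend hA hC R) :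
    W2.map φ w ∈ r'.descend hA' hC' R' := by
  obtain ⟨c, hc, a, ha⟩ := hw
  refine ⟨ψ c, ?_, φ a, by rw [hr, ha, map_pow]⟩
  have h1 := hR _ hc
  rw [map_add, W2.map_V, W2.map_map] at h1
  rw [W2.map_map]
  convert h1 using 4
  exact RingHom.ext fun a => (hi a).symm

open TensorProduct in
/-- A linear functional on `B` defines a retraction of `A → A ⊗ B`. -/
noncomputable def tensorRetraction {k : Type*} [Field k] [PerfectField k] [CharP k p] {A B : Type*}
    [CommRing A] [CommRing B] [Algebra k A] [Algebra k B] (ρ : B →ₗ[k] k) (hρ : ρ 1 = 1)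
    (hA : (p : A) = 0) :
    PthRetraction p (Algebra.TensorProduct.includeLeftRingHom : A →+* A ⊗[k] B) where
  toFun := ((TensorProduct.rid k A).toLinearMap ∘ₗ ρ.lTensor A).toAddMonoidHom
  map_mul' a c := by
    induction c with
    | zero => simp
    | add x y hx hy => rw [mul_add, map_add, map_add, mul_add, hx, hy]
    | tmul x y =>
      simp
  map_one' := by
    simp [Algebra.TensorProduct.one_def, hρ]
  map_pow' c := by
    have hC : (p : A ⊗[k] B) = 0 := by
      rw [← map_natCast (Algebra.TensorProduct.includeLeftRingHom : A →+* A ⊗[k] B), hA, map_zero]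
    induction c with
    | zero => exact ⟨0, by simp [hp.out.ne_zero]⟩
    | add x y hx hy =>
      obtain ⟨a, ha⟩ := hx
      obtain ⟨b, hb⟩ := hy
      have h := map_add (powRingHom p _ hC) x y
      change (x + y) ^ p = x ^ p + y ^ p at h
      rw [h, map_add, ha, hb]
      exact exists_pow_add_pow_eq p hA a b
    | tmul x y =>
      -- The scalar `ρ (y ^ p)` has a `p`-th root in the perfect field `k`.
      obtain ⟨e, he⟩ := surjective_frobenius k p (ρ (y ^ p))
      refine ⟨e • x, ?_⟩
      rw [Algebra.TensorProduct.tmul_pow]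
      change (TensorProduct.rid k A) (ρ.lTensor A ((x ^ p) ⊗ₜ (y ^ p))) = _
      rw [LinearMap.lTensor_tmul, TensorProduct.rid_tmul, ← he, frobenius_def, smul_pow]

end Retraction

end

/-! ### A Künneth argument for sections modulo `p`-th powers. -/

section

section Kuenneth

open TensorProduct

variable (p : ℕ) [hp : Fact p.Prime] {k : Type*} [Field k] [PerfectField k] [CharP k p]

theorem exists_sum_eq_pow {A ι : Type*} [CommRing A] (hA : (p : A) = 0) (s : Finset ι) (x : ι → A)
    (hx : ∀ i ∈ s, ∃ c, x i = c ^ p) : ∃ c, ∑ i ∈ s, x i = c ^ p := by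
  classical
  induction s using Finset.induction_on with
  | empty => exact ⟨0, by simp [hp.out.ne_zero]⟩
  | insert i s hi ih =>
    obtain ⟨a, ha⟩ := hx i (Finset.mem_insert_self i s)
    obtain ⟨b, hb⟩ := ih fun j hj => hx j (Finset.mem_insert_of_mem hj)
    rw [Finset.sum_insert hi, ha, hb]
    exact exists_pow_add_pow_eq p hA a b

/-- A basis of an algebra over a perfect field which extends a basis of the subspace of `p`-th
powers. -/
theorem exists_basis_pow (A : Type u) [CommRing A] [Algebra k A] :
    ∃ (ι₁ ι₂ : Type u) (e : Module.Basis (ι₁ ⊕ ι₂) k A), (∀ i, ∃ a, e (.inl i) = a ^ p) ∧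
      ∀ a i, e.repr (a ^ p) (.inr i) = 0 := by
  have hA : (p : A) = 0 := by
    rw [← map_natCast (algebraMap k A), CharP.cast_eq_zero, map_zero]
  -- The `p`-th powers form a `k`-subspace because `k` is perfect; bases of it and of a complement
  -- are joined.
  let W : Submodule k A :=
    { carrier := {x | ∃ a, x = a ^ p}
      zero_mem' := ⟨0, by rw [zero_pow hp.out.ne_zero]⟩
      add_mem' := by
        rintro _ _ ⟨a, rfl⟩ ⟨b, rfl⟩
        exact exists_pow_add_pow_eq p hA a b
      smul_mem' := by
        rintro c _ ⟨a, rfl⟩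
        obtain ⟨e, rfl⟩ := surjective_frobenius k p c
        exact ⟨e • a, by rw [smul_pow, frobenius_def]⟩ }
  obtain ⟨W', hW'⟩ := W.exists_isCompl
  let b₁ := Module.Basis.ofVectorSpace k W
  let b₂ := Module.Basis.ofVectorSpace k W'
  refine ⟨_, _, (b₁.prod b₂).map (Submodule.prodEquivOfIsCompl W W' hW'), fun i => ?_, fun a i => ?_⟩
  · obtain ⟨a, ha⟩ := (b₁ i).2
    refine ⟨a, ?_⟩
    rw [← ha]
    simp
  · have h : (Submodule.prodEquivOfIsCompl W W' hW').symm (a ^ p) = (⟨a ^ p, a, rfl⟩, 0) :=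
      Submodule.prodEquivOfIsCompl_symm_apply_left W W' hW' ⟨a ^ p, a, rfl⟩
    simp [h]

/-- A family of elements of `A ⊗ B_V` which are compatible up to `p`-th powers is, up to
`p`-th powers, given by an element of `A`. -/
theorem exists_eq_tmul_one_add_pow (A : Type u) [CommRing A] [Algebra k A] {J : Type*}
    (rel : J → J → Prop) (B : J → Type*) [∀ j, CommRing (B j)] [∀ j, Algebra k (B j)]
    (res : ∀ i j, rel i j → (B i →ₐ[k] B j))
    (H0 : ∀ b : ∀ j, B j, (∀ i j (h : rel i j), res i j h (b i) = b j) →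
      ∃ n : k, ∀ j, b j = algebraMap k (B j) n)
    (H1 : ∀ b : ∀ j, B j, (∀ i j (h : rel i j), ∃ c, res i j h (b i) = b j + c ^ p) →
      ∀ j, ∃ c, b j = c ^ p)
    (d : ∀ j, A ⊗[k] B j)
    (hd : ∀ i j (h : rel i j), ∃ c,
      Algebra.TensorProduct.map (AlgHom.id k A) (res i j h) (d i) = d j + c ^ p) :
    ∃ n : A, ∀ j, ∃ c : A ⊗[k] B j, d j = n ⊗ₜ 1 + c ^ p := by
  classical
  -- If all `B j` vanish any `n` works. Otherwise a nonzero `B j₀` is used below to see that only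
  -- finitely many of the constants are nonzero.
  by_cases hJ : ∀ j, Subsingleton (B j)
  · refine ⟨0, fun j => ⟨0, ?_⟩⟩
    have : Subsingleton (A ⊗[k] B j) := by
      refine subsingleton_of_zero_eq_one ?_
      rw [Algebra.TensorProduct.one_def, Subsingleton.elim (1 : B j) 0, tmul_zero]
    exact Subsingleton.elim _ _
  push Not at hJ
  obtain ⟨j₀, hj₀⟩ := hJ
  have hA : (p : A) = 0 := by
    rw [← map_natCast (algebraMap k A), CharP.cast_eq_zero, map_zero]
  have hB : ∀ j, (p : B j) = 0 := fun j => by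
    rw [← map_natCast (algebraMap k (B j)), CharP.cast_eq_zero, map_zero]
  have hC : ∀ j, (p : A ⊗[k] B j) = 0 := fun j => by
    rw [← map_natCast (algebraMap k _), CharP.cast_eq_zero, map_zero]
  obtain ⟨ι₁, ι₂, e, he₁, he₂⟩ := exists_basis_pow p (k := k) A
  let Φ : ∀ j, A ⊗[k] B j ≃ₗ[k] (ι₁ ⊕ ι₂ →₀ B j) := fun j =>
    TensorProduct.equivFinsuppOfBasisLeft e
  have hΦ : ∀ j a b l, Φ j (a ⊗ₜ b) l = e.repr a l • b := fun j a b l => by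
    simp [Φ]
  have hΦres : ∀ i j (h : rel i j) x l,
      Φ j (Algebra.TensorProduct.map (AlgHom.id k A) (res i j h) x) l = res i j h (Φ i x l) := by
    intro i j h x l
    induction x with
    | zero => simp
    | add x y hx hy => rw [map_add, map_add, Finsupp.add_apply, hx, hy, map_add,
        Finsupp.add_apply, map_add]
    | tmul a b =>
      rw [Algebra.TensorProduct.map_tmul, hΦ, hΦ, map_smul]
      rfl
  have hΦinl : ∀ j (c : A ⊗[k] B j) i, ∃ b, Φ j (c ^ p) (.inl i) = b ^ p := by
    intro j c i
    induction c with
    | zero => exact ⟨0, by simp [hp.out.ne_zero]⟩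
    | add x y hx hy =>
      obtain ⟨a, ha⟩ := hx
      obtain ⟨b, hb⟩ := hy
      have h := map_add (powRingHom p _ (hC j)) x y
      change (x + y) ^ p = x ^ p + y ^ p at h
      rw [h, map_add, Finsupp.add_apply, ha, hb]
      exact exists_pow_add_pow_eq p (hB j) a b
    | tmul x y =>
      rw [Algebra.TensorProduct.tmul_pow, hΦ]
      obtain ⟨c, hc⟩ := surjective_frobenius k p (e.repr (x ^ p) (.inl i))
      exact ⟨c • y, by rw [← hc, frobenius_def, smul_pow]⟩
  have hΦinr : ∀ j (c : A ⊗[k] B j) i, Φ j (c ^ p) (.inr i) = 0 := by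
    intro j c i
    induction c with
    | zero => simp [hp.out.ne_zero]
    | add x y hx hy =>
      have h := map_add (powRingHom p _ (hC j)) x y
      change (x + y) ^ p = x ^ p + y ^ p at h
      rw [h, map_add, Finsupp.add_apply, hx, hy, add_zero]
    | tmul x y => rw [Algebra.TensorProduct.tmul_pow, hΦ, he₂, zero_smul]
  have hΦpow : ∀ j (x : A ⊗[k] B j), (∀ i, ∃ b, Φ j x (.inl i) = b ^ p) →
      (∀ i, Φ j x (.inr i) = 0) → ∃ c, x = c ^ p := by
    intro j x h1 h2
    have hx : x = ∑ l ∈ (Φ j x).support, e l ⊗ₜ Φ j x l := by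
      conv_lhs => rw [← (Φ j).symm_apply_apply x]
      rw [TensorProduct.equivFinsuppOfBasisLeft_symm_apply, Finsupp.sum]
    rw [hx]
    refine exists_sum_eq_pow p (hC j) _ _ fun l _ => ?_
    rcases l with i | i
    · obtain ⟨a, ha⟩ := he₁ i
      obtain ⟨b, hb⟩ := h1 i
      exact ⟨a ⊗ₜ b, by rw [Algebra.TensorProduct.tmul_pow, ha, hb]⟩
    · exact ⟨0, by rw [h2, tmul_zero, zero_pow hp.out.ne_zero]⟩
  -- A `p`-th power has no coordinates outside the span of `p`-th powers, so these coordinates of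
  -- `d` are strictly compatible and `H0` makes them constant. The remaining ones are compatible up
  -- to `p`-th powers and are handled by `H1`.
  have hn : ∀ i, ∃ n : k, ∀ j, Φ j (d j) (.inr i) = algebraMap k (B j) n := by
    intro i
    refine H0 (fun j => Φ j (d j) (.inr i)) fun i' j h => ?_
    obtain ⟨c, hc⟩ := hd i' j h
    rw [← hΦres, hc, map_add, Finsupp.add_apply, hΦinr, add_zero]
  choose n hn using hn
  have hpow : ∀ i j, ∃ c, Φ j (d j) (.inl i) = c ^ p := by
    intro i
    refine H1 (fun j => Φ j (d j) (.inl i)) fun i' j h => ?_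
    obtain ⟨c, hc⟩ := hd i' j h
    obtain ⟨b, hb⟩ := hΦinl j c i
    exact ⟨b, by rw [← hΦres, hc, map_add, Finsupp.add_apply, hb]⟩
  let N : ι₁ ⊕ ι₂ →₀ k := Finsupp.onFinset (Φ j₀ (d j₀)).support
    (fun l => l.elim (fun _ => 0) n) (by
      rintro (i | i) hi
      · exact (hi rfl).elim
      · rw [Finsupp.mem_support_iff, hn]
        exact fun h => hi ((map_eq_zero_iff _ (algebraMap k (B j₀)).injective).mp h))
  refine ⟨e.repr.symm N, fun j => ?_⟩
  suffices h : ∃ c, d j - e.repr.symm N ⊗ₜ 1 = c ^ p by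
    obtain ⟨c, hc⟩ := h
    exact ⟨c, by rw [← hc]; abel⟩
  refine hΦpow j _ (fun i => ?_) (fun i => ?_)
  · rw [map_sub, Finsupp.sub_apply, hΦ, LinearEquiv.apply_symm_apply]
    obtain ⟨c, hc⟩ := hpow i j
    refine ⟨c, ?_⟩
    rw [hc]
    simp [N]
  · rw [map_sub, Finsupp.sub_apply, hΦ, LinearEquiv.apply_symm_apply, hn]
    simp [N, Algebra.algebraMap_eq_smul_one]

end Kuenneth

end

/-! ### Flatness over `W₂(k)`, special fibres and localization of flat lifts. -/

section

section FlatLift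

open TensorProduct

variable {p : ℕ} [hp : Fact p.Prime]

theorem W2.isUnit_of_c0 {A : Type*} [CommRing A] (hA : (p : A) = 0) {x : W2 p A}
    (hx : IsUnit (W2.c0 x)) : IsUnit x := by
  obtain ⟨b, hb⟩ := hx.exists_right_inv
  have h1 : x * W2.teich b - 1 = W2.V ((x * W2.teich b - 1).coeff 1) :=
    W2.eq_V_of_c0_eq_zero (by rw [map_sub, map_mul, W2.c0_teich, hb, map_one, sub_self])
  set v : W2 p A := W2.V ((x * W2.teich b - 1).coeff 1) with hv
  have h2 : v * v = 0 := W2.V_mul_V hA _ _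
  refine IsUnit.of_mul_eq_one (W2.teich b * (1 - v)) ?_
  rw [← mul_assoc, sub_eq_iff_eq_add.mp h1]
  linear_combination -h2

/-- For perfect `k`, `V(k)` is the ideal generated by `p`, and everything outside it is a unit. -/
theorem W2.ideal_cases {k : Type*} [Field k] [CharP k p] [PerfectField k] (I : Ideal (W2 p k)) :
    ∃ g ∈ I, (∀ r ∈ I, ∃ c, r = c * g) ∧ (g = 1 ∨ g = p ∨ g = 0) := by
  have hk : (p : k) = 0 := CharP.cast_eq_zero k p
  by_cases h1 : ∃ r ∈ I, W2.c0 r ≠ 0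
  · obtain ⟨r, hr, h0⟩ := h1
    have hu := W2.isUnit_of_c0 hk (isUnit_iff_ne_zero.mpr h0)
    exact ⟨1, (Ideal.eq_top_of_isUnit_mem I hr hu) ▸ trivial, fun r _ => ⟨r, (mul_one r).symm⟩,
      .inl rfl⟩
  push Not at h1
  have hV : ∀ b : k, ∃ c : W2 p k, W2.V b = c * (p : W2 p k) := fun b => by
    obtain ⟨e, rfl⟩ := surjective_frobenius k p b
    exact ⟨W2.teich e, by rw [mul_comm, W2.natCast_mul hk, W2.c0_teich, frobenius_def]⟩
  by_cases h2 : ∃ r ∈ I, r ≠ 0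
  · obtain ⟨r, hr, h0⟩ := h2
    have hr1 := W2.eq_V_of_c0_eq_zero (h1 r hr)
    have hne : r.coeff 1 ≠ 0 := fun h => h0 (by rw [hr1, h, map_zero])
    refine ⟨p, ?_, fun r hr => ?_, .inr (.inl rfl)⟩
    · obtain ⟨e, he⟩ := surjective_frobenius k p (r.coeff 1)⁻¹
      have : (p : W2 p k) = W2.teich e * r := by
        rw [hr1, W2.mul_V hk, W2.c0_teich, W2.natCast_eq_V hk, ← frobenius_def, he,
          inv_mul_cancel₀ hne]
      rw [this]
      exact I.mul_mem_left _ hr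
    · obtain ⟨c, hc⟩ := hV (r.coeff 1)
      exact ⟨c, (W2.eq_V_of_c0_eq_zero (h1 r hr)).trans hc⟩
  · push Not at h2
    exact ⟨0, I.zero_mem, fun r hr => ⟨0, by rw [h2 r hr, mul_zero]⟩, .inr (.inr rfl)⟩

theorem W2.ker_c0 {k : Type*} [Field k] [CharP k p] [PerfectField k] {x : W2 p k}
    (hx : W2.c0 x = 0) : ∃ y, x = p * y := by
  have hk : (p : k) = 0 := CharP.cast_eq_zero k p
  obtain ⟨e, he⟩ := surjective_frobenius k p (x.coeff 1)
  exact ⟨W2.teich e, by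
    rw [W2.natCast_mul hk, W2.c0_teich, ← frobenius_def, he]; exact W2.eq_V_of_c0_eq_zero hx⟩

/-- The projection of a Frobenius subring is a flat lift. -/
theorem IsFrobSubring.isFlatLift {A : Type*} [CommRing A] [IsReduced A] (hA : (p : A) = 0)
    {R : Subring (W2 p A)} (hR : IsFrobSubring p R) : IsFlatLift p (W2.c0.comp R.subtype) where
  surj a := by
    obtain ⟨w, hw, rfl⟩ := hR.surj a
    exact ⟨⟨w, hw⟩, rfl⟩
  eq_zero_iff x := by
    constructor
    · intro h
      have hx := W2.eq_V_of_c0_eq_zero (x := (x : W2 p A)) h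
      obtain ⟨c, hc⟩ := (hR.V_mem_iff _).mp (hx ▸ x.2)
      obtain ⟨w, hw, rfl⟩ := hR.surj c
      refine ⟨⟨w, hw⟩, Subtype.ext ?_⟩
      rw [hx, hc]
      exact (W2.natCast_mul hA w).symm
    · rintro ⟨y, rfl⟩
      rw [map_mul, map_natCast, hA, zero_mul]
  mul_eq_zero_iff x := by
    have h1 : ((p * x : R) : W2 p A) = W2.V (W2.c0 (x : W2 p A) ^ p) := W2.natCast_mul hA _
    rw [← Subtype.coe_inj, h1, ZeroMemClass.coe_zero]
    constructor
    · intro h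
      have h2 : W2.c0 (x : W2 p A) ^ p = 0 := W2.V_injective (h.trans (map_zero W2.V).symm)
      exact pow_eq_zero_iff hp.out.ne_zero |>.mp h2
    · intro h
      change W2.c0 (x : W2 p A) = 0 at h
      rw [h, zero_pow hp.out.ne_zero, map_zero]

theorem IsFrobSubring.map_powRingHom_mem {A : Type u} [CommRing A] (hA : (p : A) = 0)
    {R : Subring (W2 p A)} (hR : IsFrobSubring p R) {w : W2 p A} (hw : w ∈ R) :
    W2.map (powRingHom p A hA) w ∈ R := by
  rw [W2.eq_teich_add_V (W2.map (powRingHom p A hA) w)]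
  refine R.add_mem ?_ ((hR.V_mem_iff _).mpr ⟨w.coeff 1, by rw [W2.map_coeff]; rfl⟩)
  have : W2.teich (W2.c0 (W2.map (powRingHom p A hA) w)) = w ^ p := by
    rw [W2.c0_map]
    change W2.teich (W2.c0 w ^ p) = w ^ p
    rw [map_pow]
    exact W2.pow_eq_of_c0_eq hA (W2.c0_teich _)
  rw [this]
  exact R.pow_mem hw p

theorem IsFrobSubring.map_mem {k : Type*} [Field k] [CharP k p] [PerfectField k] {A : Type*}
    [CommRing A] (hA : (p : A) = 0) {R : Subring (W2 p A)} (hR : IsFrobSubring p R) (φ : k →+* A)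
    (w : W2 p k) : W2.map φ w ∈ R := by
  rw [W2.eq_teich_add_V w, map_add, W2.map_teich, W2.map_V]
  obtain ⟨e, he⟩ := surjective_frobenius k p (W2.c0 w)
  obtain ⟨d, hd⟩ := surjective_frobenius k p (w.coeff 1)
  refine R.add_mem ?_ ((hR.V_mem_iff _).mpr ⟨φ d, by rw [← map_pow, ← frobenius_def, hd]⟩)
  obtain ⟨v, hv, hve⟩ := hR.surj (φ e)
  have : W2.teich (φ (W2.c0 w)) = v ^ p := by
    rw [← he, frobenius_def, map_pow, map_pow]
    exact W2.pow_eq_of_c0_eq hA (by rw [W2.c0_teich, hve])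
  rw [this]
  exact R.pow_mem hv p

variable {k : Type u} [Field k] [CharP k p] [PerfectField k]

/-- A flat lift which is a `W₂(k)`-algebra is flat over `W₂(k)`. -/
theorem IsFlatLift.flat {S A : Type*} [CommRing S] [CommRing A] {π : S →+* A}
    (h : IsFlatLift p π) (φ : W2 p k →+* S) : φ.Flat := by
  let := φ.toAlgebra
  change Module.Flat (W2 p k) S
  rw [Module.Flat.iff_lift_lsmul_comp_subtype_injective]
  intro I _
  -- Of the three possible generators only `p` needs care: `p * s = 0` forces `s = p * y`, and `p ⊗
  -- (p * y) = (p * p) ⊗ y = 0`.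
  obtain ⟨g, hg, hI, hcases⟩ := W2.ideal_cases I
  have hgen : ∀ x : I ⊗[W2 p k] S, ∃ s, x = (⟨g, hg⟩ : I) ⊗ₜ s := by
    intro x
    induction x with
    | zero => exact ⟨0, (tmul_zero _ _).symm⟩
    | add x y hx hy =>
      obtain ⟨s, rfl⟩ := hx
      obtain ⟨t, rfl⟩ := hy
      exact ⟨s + t, (tmul_add _ _ _).symm⟩
    | tmul r s =>
      obtain ⟨c, hc⟩ := hI r r.2
      refine ⟨c • s, ?_⟩
      rw [← smul_tmul]
      congr 1
      exact Subtype.ext hc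
  rw [injective_iff_map_eq_zero]
  intro x hx
  obtain ⟨s, rfl⟩ := hgen x
  have hx' : g • s = 0 := hx
  rw [Algebra.smul_def] at hx'
  change φ g * s = 0 at hx'
  rcases hcases with h1 | h1 | h1
  · rw [h1, map_one, one_mul] at hx'
    rw [hx', tmul_zero]
  · rw [h1, map_natCast, h.mul_eq_zero_iff, h.eq_zero_iff] at hx'
    obtain ⟨y, rfl⟩ := hx'
    have h2 : (p : S) * y = (p : W2 p k) • y := by
      rw [Algebra.smul_def, map_natCast]
    rw [h2, ← smul_tmul]
    have h3 : (p : W2 p k) • (⟨g, hg⟩ : I) = 0 := Subtype.ext (by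
      change (p : W2 p k) * g = 0
      rw [h1, W2.natCast_mul_natCast (CharP.cast_eq_zero k p)])
    rw [h3, zero_tmul]
  · have h3 : (⟨g, hg⟩ : I) = 0 := Subtype.ext h1
    rw [h3, zero_tmul]

/-- A competing cocone receives a map from `k`, so `p` vanishes in it and its map from `S` factors
through `S / p`. -/
theorem isPushout_of_ker {S A : Type u} [CommRing S] [CommRing A] {π : S →+* A}
    (hπ : Function.Surjective π) (hker : ∀ x, π x = 0 → ∃ y, x = p * y)
    (φ : W2 p k →+* S) (ψ : k →+* A) (hφ : ∀ w, π (φ w) = ψ (W2.c0 w)) :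
    IsPushout (CommRingCat.ofHom φ) (CommRingCat.ofHom (reduction p k)) (CommRingCat.ofHom π)
      (CommRingCat.ofHom ψ) := by
  have hsq : CommRingCat.ofHom φ ≫ CommRingCat.ofHom π =
      CommRingCat.ofHom (reduction p k) ≫ CommRingCat.ofHom ψ := by
    ext w
    exact hφ w
  have hp0 : ∀ s : PushoutCocone (CommRingCat.ofHom φ) (CommRingCat.ofHom (reduction p k)),
      (p : s.pt) = 0 := fun s => by
    rw [← map_natCast s.inr.hom]
    change s.inr.hom (p : k) = 0
    rw [CharP.cast_eq_zero, map_zero]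
  have hle : ∀ s : PushoutCocone (CommRingCat.ofHom φ) (CommRingCat.ofHom (reduction p k)),
      RingHom.ker π ≤ RingHom.ker s.inl.hom := fun s x hx => by
    obtain ⟨y, rfl⟩ := hker x hx
    rw [RingHom.mem_ker, map_mul]
    change s.inl.hom (p : S) * _ = 0
    rw [map_natCast, hp0, zero_mul]
  let desc : ∀ s : PushoutCocone (CommRingCat.ofHom φ) (CommRingCat.ofHom (reduction p k)),
      A →+* s.pt := fun s => RingHom.liftOfSurjective π hπ ⟨s.inl.hom, hle s⟩
  have hdesc : ∀ s x, desc s (π x) = s.inl.hom x := fun s x =>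
    RingHom.liftOfRightInverse_comp_apply _ _ _ _ _
  refine IsPushout.of_isColimit' ⟨hsq⟩ (PushoutCocone.IsColimit.mk _
    (fun s => CommRingCat.ofHom (desc s)) (fun s => ?_) (fun s => ?_) (fun s m hm _ => ?_))
  · ext x
    exact hdesc s x
  · ext c
    change desc s (ψ c) = s.inr.hom c
    obtain ⟨w, rfl⟩ := W2.c0_surjective (p := p) c
    rw [← hφ, hdesc]
    exact congrArg (fun f => f.hom w) s.condition
  · ext a
    obtain ⟨x, rfl⟩ := hπ a
    change _ = desc s (π x)
    rw [hdesc, ← hm]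
    rfl

theorem exists_sum_of_smul_eq_zero {R M : Type*} [CommRing R] [AddCommGroup M] [Module R M]
    [Module.Flat R M] {r : R} {x : M} (h : r • x = 0) :
    ∃ (n : ℕ) (a : Fin n → R) (y : Fin n → M), x = ∑ j, a j • y j ∧ ∀ j, r * a j = 0 := by
  obtain ⟨n, a, y, h1, h2⟩ := Module.Flat.isTrivialRelation_of_sum_smul_eq_zero
    (f := fun _ : Fin 1 => r) (x := fun _ => x) (by simpa using h)
  exact ⟨n, a 0, y, h1 0, fun j => by simpa using h2 j⟩

/-- The special fibre of a flat `W₂(k)`-algebra is a flat lift. -/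
theorem isFlatLift_of_isPushout {S A : Type u} [CommRing S] [CommRing A] {π : S →+* A}
    {φ : W2 p k →+* S} {ψ : k →+* A} (hφ : φ.Flat)
    (h : IsPushout (CommRingCat.ofHom φ) (CommRingCat.ofHom (reduction p k))
      (CommRingCat.ofHom π) (CommRingCat.ofHom ψ)) : IsFlatLift p π := by
  have hk : (p : k) = 0 := CharP.cast_eq_zero k p
  have hA : (p : A) = 0 := by rw [← map_natCast ψ, hk, map_zero]
  let Q := S ⧸ Ideal.span {(p : S)}
  let q : S →+* Q := Ideal.Quotient.mk _
  have hq : ∀ x, q x = 0 → ∃ y, x = p * y := fun x hx => by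
    rw [Ideal.Quotient.eq_zero_iff_mem, Ideal.mem_span_singleton] at hx
    exact hx
  have hle : RingHom.ker (W2.c0 : W2 p k →+* k) ≤ RingHom.ker (q.comp φ) := fun w hw => by
    obtain ⟨y, rfl⟩ := W2.ker_c0 hw
    rw [RingHom.mem_ker, RingHom.comp_apply, map_mul, map_natCast, map_mul]
    have : q (p : S) = 0 := Ideal.Quotient.eq_zero_iff_mem.mpr (Ideal.mem_span_singleton_self _)
    rw [this, zero_mul]
  let ψ' : k →+* Q := RingHom.liftOfSurjective W2.c0 W2.c0_surjective ⟨q.comp φ, hle⟩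
  have h' := isPushout_of_ker (p := p) Ideal.Quotient.mk_surjective hq φ ψ'
    (fun w => (RingHom.liftOfRightInverse_comp_apply W2.c0 _ _ ⟨q.comp φ, hle⟩ w).symm)
  let e := IsPushout.isoIsPushout _ _ h' h
  have he : ∀ x, e.hom.hom (q x) = π x := fun x =>
    congrArg (fun f : CommRingCat.of S ⟶ CommRingCat.of A => f.hom x) (IsPushout.inl_isoIsPushout_hom _ _ h' h)
  have hbij : Function.Bijective e.hom.hom := ConcreteCategory.bijective_of_isIso e.hom
  have hker : ∀ x, π x = 0 ↔ ∃ y, x = p * y := by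
    intro x
    constructor
    · intro hx
      refine hq x (hbij.1 ?_)
      rw [he, hx, map_zero]
    · rintro ⟨y, rfl⟩
      rw [map_mul, map_natCast, hA, zero_mul]
  refine ⟨fun a => ?_, hker, fun x => ⟨fun hx => ?_, fun hx => ?_⟩⟩
  · obtain ⟨b, rfl⟩ := hbij.2 a
    obtain ⟨x, rfl⟩ := Ideal.Quotient.mk_surjective b
    exact ⟨x, (he x).symm⟩
  · let := φ.toAlgebra
    have : Module.Flat (W2 p k) S := hφ
    -- By the equational criterion for flatness, `p * x = 0` writes `x` with coefficients in `W₂(k)`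
    -- killed by `p`, that is, divisible by `p`.
    obtain ⟨n, a, y, h1, h2⟩ := exists_sum_of_smul_eq_zero (r := (p : W2 p k)) (x := x)
      (by rw [Algebra.smul_def, map_natCast, hx])
    rw [h1, map_sum]
    refine Finset.sum_eq_zero fun j _ => ?_
    have h3 := h2 j
    rw [W2.natCast_mul hk] at h3
    have h4 : W2.c0 (a j) = 0 :=
      (pow_eq_zero_iff hp.out.ne_zero).mp (W2.V_injective (h3.trans (map_zero W2.V).symm))
    obtain ⟨b, hb⟩ := W2.ker_c0 h4
    have h5 : a j • y j = p * (φ b * y j) := by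
      rw [hb, Algebra.smul_def, map_mul, map_natCast, mul_assoc]
      rfl
    exact h5 ▸ (hker _).mpr ⟨_, rfl⟩
  · obtain ⟨y, rfl⟩ := (hker x).mp hx
    have h5 : (p : S) * p = 0 := by
      rw [← map_natCast φ, ← map_mul, W2.natCast_mul_natCast hk, map_zero]
    rw [← mul_assoc, h5, zero_mul]

theorem IsFlatLift.isUnit_of_isUnit {S A : Type*} [CommRing S] [CommRing A] {π : S →+* A}
    (h : IsFlatLift p π) {x : S} (hx : IsUnit (π x)) : IsUnit x := by
  obtain ⟨b, hb⟩ := hx.exists_right_inv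
  obtain ⟨y, rfl⟩ := h.surj b
  obtain ⟨z, hz⟩ := h.exists_eq_add (x := x * y) (y := 1) (by rw [map_mul, hb, map_one])
  refine IsUnit.of_mul_eq_one (y * (1 - p * z)) ?_
  rw [← mul_assoc, hz]
  linear_combination -z ^ 2 * h.natCast_mul_natCast

/-- Flat lifts are compatible with localization. -/
theorem IsFlatLift.isLocalization_away {S A S' A' : Type*} [CommRing S] [CommRing A] [CommRing S']
    [CommRing A'] {π : S →+* A} {π' : S' →+* A'} (h : IsFlatLift p π) (h' : IsFlatLift p π')
    [Algebra S S'] [Algebra A A'] (hcomm : ∀ x, π' (algebraMap S S' x) = algebraMap A A' (π x))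
    (f : S) [IsLocalization.Away (π f) A'] : IsLocalization.Away f S' := by
  have hu : IsUnit (algebraMap S S' f) := h'.isUnit_of_isUnit (by
    rw [hcomm]; exact IsLocalization.Away.algebraMap_isUnit (π f))
  -- A fraction is found modulo `p` first; a second application, to the `y` in the error `p * y`,
  -- finishes since `p * p = 0`.
  have hsurj : ∀ x : S', ∃ (n : ℕ) (a : S) (y : S'),
      x * algebraMap S S' f ^ n = algebraMap S S' a + p * y := by
    intro x
    obtain ⟨n, b, hb⟩ := IsLocalization.Away.surj (π f) (π' x)
    obtain ⟨a, rfl⟩ := h.surj b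
    obtain ⟨y, hy⟩ := h'.exists_eq_add (x := x * algebraMap S S' f ^ n) (y := algebraMap S S' a)
      (by rw [map_mul, map_pow, hcomm, hcomm, hb])
    exact ⟨n, a, y, hy⟩
  have hker : ∀ s : S, π' (algebraMap S S' s) = 0 → ∃ n : ℕ, π (f ^ n * s) = 0 := by
    intro s hs
    rw [hcomm] at hs
    obtain ⟨n, hn⟩ := IsLocalization.Away.exists_of_eq (S := A') (π f) (a := π s) (b := 0)
      (by rw [hs, map_zero])
    exact ⟨n, by rw [map_mul, map_pow, hn, mul_zero]⟩
  refine IsLocalization.Away.mk f hu (fun x => ?_) (fun x y hxy => ?_)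
  · obtain ⟨n, a, y, h1⟩ := hsurj x
    obtain ⟨m, b, z, h2⟩ := hsurj y
    refine ⟨n + m, a * f ^ m + p * b, ?_⟩
    have h3 := h'.natCast_mul_natCast
    simp only [map_add, map_mul, map_pow, map_natCast]
    linear_combination (algebraMap S S' f ^ m) * h1 + p * h2 + z * h3
  · obtain ⟨n, hn⟩ := hker (x - y) (by rw [map_sub, hxy, sub_self, map_zero])
    obtain ⟨t, ht⟩ := (h.eq_zero_iff _).mp hn
    have h1 : (p : S') * algebraMap S S' t = 0 := by
      rw [← map_natCast (algebraMap S S'), ← map_mul, ← ht, map_mul, map_sub, hxy, sub_self,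
        mul_zero]
    obtain ⟨m, hm⟩ := hker t ((h'.mul_eq_zero_iff _).mp h1)
    have h2 := (h.mul_eq_zero_iff _).mpr hm
    refine ⟨n + m, ?_⟩
    linear_combination f ^ m * ht + h2

end FlatLift

end

/-! ### Sections of a Frobenius lifting over open subsets. -/

section

variable {p : ℕ} [hp : Fact p.Prime] {k : Type u} [Field k] [CharP k p]

theorem reduction_surjective : Function.Surjective (reduction p k) := W2.c0_surjective

instance isClosedImmersion_specReduction : IsClosedImmersion (specReduction p k) :=
  IsClosedImmersion.spec_of_surjective _ reduction_surjective

instance surjective_specReduction [PerfectField k] : Surjective (specReduction p k) := by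
  have hk : (p : k) = 0 := CharP.cast_eq_zero k p
  refine ⟨fun x => ?_⟩
  have h := range_comap_of_surjective k (reduction p k) reduction_surjective
  have hx : x ∈ PrimeSpectrum.zeroLocus (RingHom.ker (reduction p k) : Set (W2 p k)) := by
    intro w hw
    obtain ⟨y, rfl⟩ := W2.ker_c0 (p := p) (x := w) hw
    have h2 : ((p : W2 p k) * y) * (p * y) = 0 := by
      rw [mul_mul_mul_comm, W2.natCast_mul_natCast hk, zero_mul]
    exact (x.isPrime.mem_or_mem (h2 ▸ x.asIdeal.zero_mem : (p : W2 p k) * y * (p * y) ∈ x.asIdeal)).elim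
      id id
  rw [← h] at hx
  exact hx

namespace FrobeniusLifting

variable [PerfectField k] {X : Scheme.{u}} {f : X ⟶ Spec (.of k)} (L : FrobeniusLifting p f)

instance isClosedImmersion_incl : IsClosedImmersion L.incl :=
  MorphismProperty.of_isPullback L.isPullback.flip inferInstance

instance surjective_incl : Surjective L.incl :=
  MorphismProperty.of_isPullback L.isPullback.flip inferInstance

instance flat_str : Flat L.str := L.flat

theorem preimage_injective {W W' : L.scheme.Opens} (h : L.incl ⁻¹ᵁ W ≤ L.incl ⁻¹ᵁ W') : W ≤ W' := by
  intro x hx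
  obtain ⟨y, rfl⟩ := L.incl.surjective x
  exact h hx

theorem exists_preimage_eq (U : X.Opens) : ∃ W : L.scheme.Opens, L.incl ⁻¹ᵁ W = U := by
  obtain ⟨W, hW, h⟩ := L.incl.isClosedEmbedding.isInducing.isOpen_iff.mp U.2
  exact ⟨⟨W, hW⟩, TopologicalSpace.Opens.ext h⟩

theorem frob_apply (x : L.scheme) : L.frob x = x := by
  obtain ⟨y, rfl⟩ := L.incl.surjective x
  rw [← Scheme.Hom.comp_apply, L.incl_frob, Scheme.Hom.comp_apply, absFrobenius_apply]

theorem frob_preimage (W : L.scheme.Opens) : L.frob ⁻¹ᵁ W = W := by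
  ext x
  change L.frob x ∈ W ↔ x ∈ W
  rw [L.frob_apply]

theorem isAffineOpen_preimage {W : L.scheme.Opens} (hW : IsAffineOpen W) :
    IsAffineOpen (L.incl ⁻¹ᵁ W) := hW.preimage L.incl

/-- The projection to the special fibre on sections. -/
noncomputable abbrev proj (W : L.scheme.Opens) : Γ(L.scheme, W) →+* Γ(X, L.incl ⁻¹ᵁ W) :=
  (L.incl.app W).hom

/-- The Frobenius lifting on sections. -/
noncomputable def frobSection (W : L.scheme.Opens) : Γ(L.scheme, W) →+* Γ(L.scheme, W) :=
  (L.frob.appLE W W (L.frob_preimage W).ge).hom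

theorem proj_frobSection (W : L.scheme.Opens) (s : Γ(L.scheme, W)) :
    L.proj W (L.frobSection W s) = L.proj W s ^ p := by
  have h1 : L.frob.appLE W W (L.frob_preimage W).ge ≫ L.incl.app W =
      (L.incl ≫ L.frob).appLE W (L.incl ⁻¹ᵁ W) (by
        rw [Scheme.Hom.comp_preimage, L.frob_preimage]) := by
    rw [Scheme.Hom.app_eq_appLE, Scheme.Hom.appLE_comp_appLE]
  have h2 : L.incl.app W ≫ (absFrobenius p f).app (L.incl ⁻¹ᵁ W) =
      (absFrobenius p f ≫ L.incl).appLE W (L.incl ⁻¹ᵁ W) (by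
        rw [Scheme.Hom.comp_preimage]; rfl) := by
    rw [Scheme.Hom.app_eq_appLE, Scheme.Hom.app_eq_appLE, Scheme.Hom.appLE_comp_appLE]
    rfl
  have h3 : L.frob.appLE W W (L.frob_preimage W).ge ≫ L.incl.app W =
      L.incl.app W ≫ (absFrobenius p f).app (L.incl ⁻¹ᵁ W) := by
    rw [h1, h2]
    congr 1
    exact L.incl_frob
  exact congrArg (fun g => g.hom s) h3

theorem frobSection_map {W W' : L.scheme.Opens} (h : W' ≤ W) (s : Γ(L.scheme, W)) :
    L.scheme.presheaf.map (homOfLE h).op (L.frobSection W s) =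
      L.frobSection W' (L.scheme.presheaf.map (homOfLE h).op s) := by
  have h1 : L.frob.appLE W W (L.frob_preimage W).ge ≫ L.scheme.presheaf.map (homOfLE h).op =
      L.scheme.presheaf.map (homOfLE h).op ≫ L.frob.appLE W' W' (L.frob_preimage W').ge := by
    rw [Scheme.Hom.appLE_map, Scheme.Hom.map_appLE]
  exact congrArg (fun g => g.hom s) h1

theorem proj_map {W W' : L.scheme.Opens} (h : W' ≤ W) (s : Γ(L.scheme, W)) :
    L.proj W' (L.scheme.presheaf.map (homOfLE h).op s) =
      X.presheaf.map (homOfLE (Scheme.Hom.preimage_mono L.incl h)).op (L.proj W s) :=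
  congrArg (fun g => g.hom s) (L.incl.naturality (homOfLE h).op)

/-- The structure map on sections. -/
noncomputable def strSection (W : L.scheme.Opens) : W2 p k →+* Γ(L.scheme, W) :=
  ((Scheme.ΓSpecIso (.of (W2 p k))).inv ≫ L.str.appLE ⊤ W le_top).hom

theorem flat_strSection {W : L.scheme.Opens} (hW : IsAffineOpen W) : (L.strSection W).Flat := by
  have h1 := L.str.flat_appLE (isAffineOpen_top _) hW le_top
  exact RingHom.Flat.comp (RingHom.Flat.of_bijective
    (ConcreteCategory.bijective_of_isIso (Scheme.ΓSpecIso (.of (W2 p k))).inv)) h1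

theorem isFlatLift {W : L.scheme.Opens} (hW : IsAffineOpen W) : IsFlatLift p (L.proj W) := by
  have h2 := (isIso_pushoutSection_iff L.isPullback (US := ⊤) (UT := ⊤) (UX := W) le_top le_top
    (UY := L.incl ⁻¹ᵁ W) (by simp)).mp
    (isIso_pushoutSection_of_isAffineOpen L.isPullback le_top le_top (by simp) (isAffineOpen_top _)
      (isAffineOpen_top _) hW)
  refine isFlatLift_of_isPushout (φ := L.strSection W)
    (ψ := ((Scheme.ΓSpecIso (.of k)).inv ≫ f.appLE ⊤ (L.incl ⁻¹ᵁ W) le_top).hom)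
    (L.flat_strSection hW) ?_
  refine h2.of_iso (Scheme.ΓSpecIso _) (Iso.refl _) (Scheme.ΓSpecIso _) (Iso.refl _) ?_ ?_ ?_ ?_
  · simp [strSection]
  · rw [← Iso.eq_comp_inv]
    simp [specReduction]
    rw [Scheme.Hom.appTop, Scheme.Hom.app_eq_appLE]
    rfl
  · simp [Scheme.Hom.app_eq_appLE]
  · simp

end FrobeniusLifting

end

/-! ### Gluing sections; affine opens of a lifting and the Frobenius subrings over them. -/

section

section Restriction

variable {X Y Z : Scheme.{u}}

/-- Restriction of sections, as a ring homomorphism. -/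
noncomputable def res {U V : X.Opens} (h : V ≤ U) : Γ(X, U) →+* Γ(X, V) :=
  (X.presheaf.map (homOfLE h).op).hom

theorem res_res {U V W : X.Opens} (h : V ≤ U) (h' : W ≤ V) (s : Γ(X, U)) :
    res h' (res h s) = res (h'.trans h) s := by
  change (X.presheaf.map (homOfLE h).op ≫ X.presheaf.map (homOfLE h').op).hom s = _
  rw [← X.presheaf.map_comp]
  rfl

theorem res_self {U : X.Opens} (h : U ≤ U) (s : Γ(X, U)) : res h s = s := by
  change (X.presheaf.map (𝟙 (Opposite.op U))).hom s = s
  rw [X.presheaf.map_id]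
  rfl

theorem basicOpen_res {U V : X.Opens} (h : V ≤ U) (s : Γ(X, U)) :
    X.basicOpen (res h s) = V ⊓ X.basicOpen s :=
  X.basicOpen_res s (homOfLE h).op

theorem res_comp_res {U V W : X.Opens} (h : V ≤ U) (h' : W ≤ V) :
    (res h').comp (res h) = res (h'.trans h) := RingHom.ext fun s => res_res h h' s

/-- Pullback of sections along a morphism of schemes. -/
noncomputable def pull (f : X ⟶ Y) {U : Y.Opens} {V : X.Opens} (e : V ≤ f ⁻¹ᵁ U) :
    Γ(Y, U) →+* Γ(X, V) := (f.appLE U V e).hom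

theorem res_pull (f : X ⟶ Y) {U : Y.Opens} {V V' : X.Opens} (e : V ≤ f ⁻¹ᵁ U) (h : V' ≤ V) :
    (res h).comp (pull f e) = pull f (h.trans e) :=
  congrArg CommRingCat.Hom.hom (f.appLE_map e (homOfLE h).op)

theorem pull_res (f : X ⟶ Y) {U U' : Y.Opens} {V : X.Opens} (e : V ≤ f ⁻¹ᵁ U') (h : U' ≤ U) :
    (pull f e).comp (res h) = pull f (e.trans (Scheme.Hom.preimage_mono f h)) :=
  congrArg CommRingCat.Hom.hom (f.map_appLE e (homOfLE h).op)

theorem pull_pull (f : X ⟶ Y) (g : Y ⟶ Z) {U : Z.Opens} {V : Y.Opens} {W : X.Opens}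
    (e₁ : W ≤ f ⁻¹ᵁ V) (e₂ : V ≤ g ⁻¹ᵁ U) :
    (pull f e₁).comp (pull g e₂) =
      pull (f ≫ g) (e₁.trans (Scheme.Hom.preimage_mono f e₂)) :=
  congrArg CommRingCat.Hom.hom (Scheme.Hom.appLE_comp_appLE f g U V W e₂ e₁)

theorem pull_congr {f g : X ⟶ Y} (h : f = g) {U : Y.Opens} {V : X.Opens} (e : V ≤ f ⁻¹ᵁ U) :
    pull f e = pull g (h ▸ e) := by
  subst h; rfl

/-- Two sections agreeing on a neighbourhood of each point are equal. -/
theorem section_ext {U : X.Opens} {s t : Γ(X, U)}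
    (h : ∀ x ∈ U, ∃ (V : X.Opens) (e : V ≤ U), x ∈ V ∧ res e s = res e t) : s = t := by
  choose V e hx hst using h
  refine X.sheaf.eq_of_locally_eq' (fun x : U => V x x.2) U (fun x => homOfLE (e x x.2))
    (fun x hxU => TopologicalSpace.Opens.mem_iSup.mpr ⟨⟨x, hxU⟩, hx x hxU⟩) s t
    (fun x => hst x x.2)

theorem witt_section_ext {p : ℕ} [Fact p.Prime] {U : X.Opens} {v w : W2 p Γ(X, U)}
    (h : ∀ x ∈ U, ∃ (V : X.Opens) (e : V ≤ U), x ∈ V ∧ W2.map (res e) v = W2.map (res e) w) :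
    v = w := by
  have key : ∀ i, v.coeff i = w.coeff i := fun i => section_ext fun x hx => by
    obtain ⟨V, e, hxV, hV⟩ := h x hx
    exact ⟨V, e, hxV, by rw [← W2.map_coeff, ← W2.map_coeff, hV]⟩
  exact W2.ext (key 0) (key 1)

/-- Gluing of sections given on the members of a basis of the opens in `U`. -/
theorem exists_section_glue {U : X.Opens} (P : X.Opens → Prop)
    (hP : ∀ V ≤ U, ∀ x ∈ V, ∃ V', P V' ∧ V' ≤ V ∧ x ∈ V')
    (s : ∀ V, P V → V ≤ U → Γ(X, V))
    (hs : ∀ V V' (hV : P V) (hV' : P V') (e : V ≤ U) (h : V' ≤ V),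
      res h (s V hV e) = s V' hV' (h.trans e)) :
    ∃ t : Γ(X, U), ∀ V (hV : P V) (e : V ≤ U), res e t = s V hV e := by
  let ι := {V : X.Opens // P V ∧ V ≤ U}
  obtain ⟨t, ht, -⟩ := X.sheaf.existsUnique_gluing' (fun i : ι => i.1) U
    (fun i => homOfLE i.2.2) (fun x hx => by
      obtain ⟨V', h1, h2, h3⟩ := hP U le_rfl x hx
      exact TopologicalSpace.Opens.mem_iSup.mpr ⟨⟨V', h1, h2⟩, h3⟩)
    (fun i => s i.1 i.2.1 i.2.2) (fun i j => by
      change res inf_le_left (s i.1 i.2.1 i.2.2) = res inf_le_right (s j.1 j.2.1 j.2.2)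
      refine section_ext fun x hx => ?_
      obtain ⟨V', h1, h2, h3⟩ := hP (i.1 ⊓ j.1) (inf_le_left.trans i.2.2) x hx
      refine ⟨V', h2, h3, ?_⟩
      rw [res_res, res_res, hs _ _ _ h1, hs _ _ _ h1])
  exact ⟨t, fun V hV e => ht ⟨V, hV, e⟩⟩

theorem exists_isAffineOpen_le {U : X.Opens} {x : X} (hx : x ∈ U) :
    ∃ V : X.Opens, IsAffineOpen V ∧ V ≤ U ∧ x ∈ V := by
  obtain ⟨V, hV, hxV, hVU⟩ := X.isBasis_affineOpens.exists_subset_of_mem_open hx U.2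
  obtain ⟨V, hV, rfl⟩ := hV
  exact ⟨V, hV, hVU, hxV⟩

end Restriction

namespace FrobeniusLifting

variable {p : ℕ} [hp : Fact p.Prime] {k : Type u} [Field k] [CharP k p] [PerfectField k]
  {X : Scheme.{u}} {f : X ⟶ Spec (.of k)} (L : FrobeniusLifting p f)

theorem proj_res {W W' : L.scheme.Opens} (h : W' ≤ W) (s : Γ(L.scheme, W)) :
    L.proj W' (res h s) = res (Scheme.Hom.preimage_mono L.incl h) (L.proj W s) :=
  L.proj_map h s

theorem res_frobSection {W W' : L.scheme.Opens} (h : W' ≤ W) (s : Γ(L.scheme, W)) :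
    res h (L.frobSection W s) = L.frobSection W' (res h s) :=
  L.frobSection_map h s

/-- The `p`-th power of a section on the special fibre lifts. -/
theorem exists_proj_eq_pow (W : L.scheme.Opens) (s : Γ(X, L.incl ⁻¹ᵁ W)) :
    ∃ F : Γ(L.scheme, W), L.proj W F = s ^ p := by
  have hex : ∀ V (_ : IsAffineOpen V) (e : V ≤ W), ∃ g : Γ(L.scheme, V),
      L.proj V g = res (Scheme.Hom.preimage_mono L.incl e) s :=
    fun V hV e => (L.isFlatLift hV).surj _
  choose g hg using hex
  -- Local lifts of `s` differ by multiples of `p`, but their `p`-th powers agree and so glue.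
  obtain ⟨F, hF⟩ := exists_section_glue (U := W) IsAffineOpen
    (fun V _ x hx => exists_isAffineOpen_le hx) (fun V hV e => g V hV e ^ p)
    (fun V V' hV hV' e h => by
      rw [map_pow]
      refine (L.isFlatLift hV').pow_eq_pow ?_
      rw [proj_res, hg, hg, res_res])
  refine ⟨F, section_ext fun x hx => ?_⟩
  obtain ⟨V, hV, e, hxV⟩ := exists_isAffineOpen_le (U := W) (x := L.incl x) hx
  refine ⟨L.incl ⁻¹ᵁ V, Scheme.Hom.preimage_mono L.incl e, hxV, ?_⟩
  rw [← proj_res L e, hF V hV e, map_pow, hg, map_pow]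

theorem sq_eq_zero_of_proj {W : L.scheme.Opens} {s : Γ(L.scheme, W)} (hs : L.proj W s = 0) :
    s ^ 2 = 0 := by
  refine section_ext fun x hx => ?_
  obtain ⟨V, hV, e, hxV⟩ := exists_isAffineOpen_le hx
  refine ⟨V, e, hxV, ?_⟩
  have hL := L.isFlatLift hV
  obtain ⟨y, hy⟩ := (hL.eq_zero_iff (res e s)).mp (by rw [proj_res, hs, map_zero])
  rw [map_pow, map_zero, hy, mul_pow, pow_two (p : Γ(L.scheme, V)), hL.natCast_mul_natCast,
    zero_mul]

theorem exists_affine_basicOpen {W : L.scheme.Opens} (hW : IsAffineOpen (L.incl ⁻¹ᵁ W))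
    {x : X} (hx : L.incl x ∈ W) :
    ∃ F : Γ(L.scheme, W), IsAffineOpen (L.scheme.basicOpen F) ∧ L.incl x ∈ L.scheme.basicOpen F := by
  obtain ⟨V, hV, e, hxV⟩ := exists_isAffineOpen_le hx
  obtain ⟨a, ha, hxa⟩ := hW.exists_basicOpen_le (V := L.incl ⁻¹ᵁ V) ⟨x, hxV⟩ hx
  obtain ⟨F, hF⟩ := L.exists_proj_eq_pow W a
  have h1 : L.incl ⁻¹ᵁ (L.scheme.basicOpen F) = X.basicOpen a := by
    rw [Scheme.preimage_basicOpen]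
    change X.basicOpen (L.proj W F) = _
    rw [hF, Scheme.basicOpen_pow _ _ hp.out.pos]
  have h2 : L.scheme.basicOpen F ≤ V := L.preimage_injective (h1 ▸ ha)
  refine ⟨F, ?_, ?_⟩
  · have h3 := hV.basicOpen (res e F)
    rwa [basicOpen_res, inf_eq_right.mpr h2] at h3
  · change x ∈ L.incl ⁻¹ᵁ (L.scheme.basicOpen F)
    rwa [h1]

/-- Sections lifting `a ^ p` cut out the same basic open as `a`, so affine basic opens cover `W`.
The ideal they generate contains some `n` reducing to `1`; then `(n - 1) ^ 2 = 0`, so `n` is a unit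
and the affineness criterion by basic opens applies. -/
theorem isAffineOpen_of_preimage {W : L.scheme.Opens} (hW : IsAffineOpen (L.incl ⁻¹ᵁ W)) :
    IsAffineOpen W := by
  have hchar : ∀ a b : Γ(X, L.incl ⁻¹ᵁ W), (a + b) ^ p = a ^ p + b ^ p := fun a b =>
    map_add (powRingHom p _ (natCast_sections_eq_zero p f _)) a b
  set J : Ideal Γ(L.scheme, W) :=
    Ideal.span {F | IsAffineOpen (L.scheme.basicOpen F)} with hJ
  let J' : Ideal Γ(X, L.incl ⁻¹ᵁ W) :=
    { carrier := {a | ∃ n ∈ J, L.proj W n = a ^ p}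
      zero_mem' := ⟨0, J.zero_mem, by rw [map_zero, zero_pow hp.out.ne_zero]⟩
      add_mem' := by
        rintro a b ⟨n, hn, ha⟩ ⟨m, hm, hb⟩
        exact ⟨n + m, J.add_mem hn hm, by rw [map_add, ha, hb, hchar]⟩
      smul_mem' := by
        rintro c a ⟨n, hn, ha⟩
        obtain ⟨F, hF⟩ := L.exists_proj_eq_pow W c
        exact ⟨F * n, J.mul_mem_left _ hn, by rw [map_mul, ha, hF, smul_eq_mul, mul_pow]⟩ }
  have hJ' : J' = ⊤ := by
    have hle : Ideal.span (L.proj W '' {F | IsAffineOpen (L.scheme.basicOpen F)}) ≤ J' := by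
      rw [Ideal.span_le]
      rintro _ ⟨F, hF, rfl⟩
      refine ⟨F ^ p, J.pow_mem_of_mem (Ideal.subset_span hF) p hp.out.pos, by rw [map_pow]⟩
    rw [eq_top_iff]
    refine le_trans ?_ hle
    rw [top_le_iff, ← hW.self_le_iSup_basicOpen_iff]
    intro x hx
    obtain ⟨F, hF, hxF⟩ := L.exists_affine_basicOpen hW (x := x) hx
    refine TopologicalSpace.Opens.mem_iSup.mpr ⟨⟨_, F, hF, rfl⟩, ?_⟩
    have := Scheme.preimage_basicOpen L.incl F
    change x ∈ X.basicOpen (L.incl.app W F)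
    rw [← this]
    exact hxF
  obtain ⟨n, hn, h1⟩ : (1 : Γ(X, L.incl ⁻¹ᵁ W)) ∈ J' := hJ' ▸ trivial
  refine isAffineOpen_of_isAffineOpen_basicOpen W {F | IsAffineOpen (L.scheme.basicOpen F)} ?_ ?_
  swap
  · intro F hF; exact hF
  have h2 : (n - 1) ^ 2 = 0 := L.sq_eq_zero_of_proj (by rw [map_sub, h1, one_pow, map_one, sub_self])
  rw [Ideal.eq_top_iff_one]
  have h3 : (1 : Γ(L.scheme, W)) = (2 - n) * n := by linear_combination h2
  rw [h3]
  exact J.mul_mem_left _ hn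

/-- Over an affine open of the special fibre there is an affine open of the lifting. -/
theorem exists_isAffineOpen_preimage_eq {U : X.Opens} (hU : IsAffineOpen U) :
    ∃ W : L.scheme.Opens, IsAffineOpen W ∧ L.incl ⁻¹ᵁ W = U := by
  obtain ⟨W, rfl⟩ := L.exists_preimage_eq U
  exact ⟨W, L.isAffineOpen_of_preimage hU, rfl⟩

/-- The subring of `W₂` of the special fibre given by the sections of the lifting. -/
noncomputable def frobSubring {W : L.scheme.Opens} (hW : IsAffineOpen W) :
    Subring (W2 p Γ(X, L.incl ⁻¹ᵁ W)) :=
  ((L.isFlatLift hW).toWitt (L.proj_frobSection W)).range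

theorem isFrobSubring_frobSubring {W : L.scheme.Opens} (hW : IsAffineOpen W) :
    IsFrobSubring p (L.frobSubring hW) :=
  (L.isFlatLift hW).isFrobSubring_range _

theorem map_toWitt_res {W W' : L.scheme.Opens} (hW : IsAffineOpen W) (hW' : IsAffineOpen W')
    (h : W' ≤ W) (s : Γ(L.scheme, W)) :
    W2.map (res (Scheme.Hom.preimage_mono L.incl h))
      ((L.isFlatLift hW).toWitt (L.proj_frobSection W) s) =
      (L.isFlatLift hW').toWitt (L.proj_frobSection W') (res h s) :=
  (L.isFlatLift hW).map_toWitt (L.isFlatLift hW') _ _ (L.proj_res h) (L.res_frobSection h) s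

theorem map_mem_frobSubring {W W' : L.scheme.Opens} (hW : IsAffineOpen W) (hW' : IsAffineOpen W')
    (h : W' ≤ W) {w : W2 p Γ(X, L.incl ⁻¹ᵁ W)} (hw : w ∈ L.frobSubring hW) :
    W2.map (res (Scheme.Hom.preimage_mono L.incl h)) w ∈ L.frobSubring hW' := by
  obtain ⟨s, rfl⟩ := hw
  exact ⟨res h s, (L.map_toWitt_res hW hW' h s).symm⟩

/-- Membership in the subring attached to a lifting is local. -/
theorem mem_frobSubring_of_locally [IsReduced X] {W : L.scheme.Opens} (hW : IsAffineOpen W)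
    {w : W2 p Γ(X, L.incl ⁻¹ᵁ W)}
    (h : ∀ x ∈ W, ∃ (W' : L.scheme.Opens) (hW' : IsAffineOpen W') (e : W' ≤ W), x ∈ W' ∧
      W2.map (res (Scheme.Hom.preimage_mono L.incl e)) w ∈ L.frobSubring hW') :
    w ∈ L.frobSubring hW := by
  -- Reducedness makes preimages under `toWitt` unique, which is why the local ones glue.
  have hinj : ∀ (V : L.scheme.Opens) (hV : IsAffineOpen V),
      Function.Injective ((L.isFlatLift hV).toWitt (L.proj_frobSection V)) := fun V hV =>
    (L.isFlatLift hV).toWitt_injective _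
  let P : L.scheme.Opens → Prop := fun V => ∃ (hV : IsAffineOpen V) (e : V ≤ W),
    W2.map (res (Scheme.Hom.preimage_mono L.incl e)) w ∈ L.frobSubring hV
  have hbasis : ∀ V ≤ W, ∀ x ∈ V, ∃ V', P V' ∧ V' ≤ V ∧ x ∈ V' := by
    intro V hVW x hx
    obtain ⟨W', hW', e, hxW', hmem⟩ := h x (hVW hx)
    obtain ⟨V', hV', e', hxV'⟩ := exists_isAffineOpen_le (U := V ⊓ W') (x := x) ⟨hx, hxW'⟩
    refine ⟨V', ⟨hV', (e'.trans inf_le_left).trans hVW, ?_⟩, e'.trans inf_le_left, hxV'⟩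
    have := L.map_mem_frobSubring hW' hV' (e'.trans inf_le_right) hmem
    rwa [W2.map_map, res_comp_res] at this
  have hex : ∀ V (_ : P V) (e : V ≤ W), ∃ (hV : IsAffineOpen V) (s : Γ(L.scheme, V)),
      (L.isFlatLift hV).toWitt (L.proj_frobSection V) s =
        W2.map (res (Scheme.Hom.preimage_mono L.incl e)) w := by
    rintro V ⟨hV, e', s, hs⟩ e
    exact ⟨hV, s, hs⟩
  choose hV s hs using hex
  obtain ⟨t, ht⟩ := exists_section_glue P hbasis s (fun V V' hPV hPV' e e' => by
    apply hinj V' (hV V' hPV' (e'.trans e))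
    rw [← L.map_toWitt_res (hV V hPV e) (hV V' hPV' (e'.trans e)), hs, hs, W2.map_map,
      res_comp_res])
  refine ⟨t, witt_section_ext fun x hx => ?_⟩
  obtain ⟨V, hPV, e, hxV⟩ := hbasis W le_rfl (L.incl x) hx
  refine ⟨L.incl ⁻¹ᵁ V, Scheme.Hom.preimage_mono L.incl e, hxV, ?_⟩
  rw [L.map_toWitt_res hW (hV V hPV e) e, ht V hPV e, hs]

end FrobeniusLifting

end

/-! ### Gluing morphisms, and the diagram of spectra of a Frobenius family. -/

section

section GlueHom

variable {S T : Scheme.{u}}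

theorem specMap_res_fromSpec {U V : S.Opens} (hU : IsAffineOpen U) (hV : IsAffineOpen V)
    (h : V ≤ U) : Spec.map (CommRingCat.ofHom (res h)) ≫ hU.fromSpec = hV.fromSpec :=
  hU.map_fromSpec hV (homOfLE h).op

theorem specMap_pull_fromSpec (f : S ⟶ T) {U : T.Opens} {V : S.Opens} (hU : IsAffineOpen U)
    (hV : IsAffineOpen V) (e : V ≤ f ⁻¹ᵁ U) :
    Spec.map (CommRingCat.ofHom (pull f e)) ≫ hU.fromSpec = hV.fromSpec ≫ f :=
  IsAffineOpen.SpecMap_appLE_fromSpec f hU hV e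

theorem hom_ext_of_affine {q q' : S ⟶ T}
    (h : ∀ x : S, ∃ (W : S.Opens) (hW : IsAffineOpen W), x ∈ W ∧
      hW.fromSpec ≫ q = hW.fromSpec ≫ q') : q = q' := by
  refine Scheme.hom_ext_of_forall _ _ fun x => ?_
  obtain ⟨W, hW, hx, e⟩ := h x
  refine ⟨W, hx, ?_⟩
  rw [← hW.isoSpec_hom_fromSpec, Category.assoc, e, Category.assoc]

/-- Agreement on a small affine neighbourhood of each point of an overlap suffices: the fibre
product of two charts is covered by the preimages of these neighbourhoods. -/
theorem exists_hom_glue {I : Type u} (W : I → S.Opens) (hW : ∀ i, IsAffineOpen (W i))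
    (hcov : ∀ x, ∃ i, x ∈ W i) (m : ∀ i, Spec Γ(S, W i) ⟶ T)
    (hm : ∀ i j, ∀ x ∈ W i, x ∈ W j → ∃ (V : S.Opens) (_ : IsAffineOpen V) (a : V ≤ W i)
      (b : V ≤ W j), x ∈ V ∧ Spec.map (CommRingCat.ofHom (res a)) ≫ m i =
        Spec.map (CommRingCat.ofHom (res b)) ≫ m j) :
    ∃ q : S ⟶ T, ∀ i, (hW i).fromSpec ≫ q = m i := by
  let 𝒰 : S.OpenCover :=
    { I₀ := I
      X := fun i => Spec Γ(S, W i)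
      f := fun i => (hW i).fromSpec
      mem₀ := by
        rw [Scheme.presieve₀_mem_precoverage_iff]
        refine ⟨fun x => ?_, inferInstance⟩
        obtain ⟨i, hi⟩ := hcov x
        exact ⟨i, by rw [(hW i).range_fromSpec]; exact hi⟩ }
  refine ⟨𝒰.glueMorphisms m fun i j => ?_, fun i => 𝒰.ι_glueMorphisms m _ i⟩
  let P := pullback (hW i).fromSpec (hW j).fromSpec
  let fst : P ⟶ Spec Γ(S, W i) := pullback.fst (hW i).fromSpec (hW j).fromSpec
  let snd : P ⟶ Spec Γ(S, W j) := pullback.snd (hW i).fromSpec (hW j).fromSpec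
  have hcond : fst ≫ (hW i).fromSpec = snd ≫ (hW j).fromSpec := pullback.condition
  let a : P ⟶ S := fst ≫ (hW i).fromSpec
  change fst ≫ m i = snd ≫ m j
  refine Scheme.hom_ext_of_forall _ _ fun z => ?_
  have h1 : a z ∈ W i := by
    rw [← SetLike.mem_coe, ← (hW i).range_fromSpec]
    exact ⟨fst z, rfl⟩
  have h2 : a z ∈ W j := by
    rw [← SetLike.mem_coe, ← (hW j).range_fromSpec]
    exact ⟨snd z, by simp only [a, hcond]; rfl⟩
  obtain ⟨V, hV, e₁, e₂, hzV, he⟩ := hm i j _ h1 h2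
  refine ⟨a ⁻¹ᵁ V, hzV, ?_⟩
  have hrange : Set.range ((a ⁻¹ᵁ V).ι ≫ a) ⊆ Set.range hV.fromSpec := by
    rw [hV.range_fromSpec]
    rintro _ ⟨y, rfl⟩
    exact y.2
  let l := IsOpenImmersion.lift hV.fromSpec ((a ⁻¹ᵁ V).ι ≫ a) hrange
  have hl : l ≫ hV.fromSpec = (a ⁻¹ᵁ V).ι ≫ a := IsOpenImmersion.lift_fac _ _ _
  have k1 : (a ⁻¹ᵁ V).ι ≫ fst = l ≫ Spec.map (CommRingCat.ofHom (res e₁)) := by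
    rw [← cancel_mono (hW i).fromSpec, Category.assoc, Category.assoc,
      specMap_res_fromSpec (hW i) hV, hl]
  have k2 : (a ⁻¹ᵁ V).ι ≫ snd = l ≫ Spec.map (CommRingCat.ofHom (res e₂)) := by
    rw [← cancel_mono (hW j).fromSpec, Category.assoc, Category.assoc,
      specMap_res_fromSpec (hW j) hV, hl, ← hcond]
  rw [reassoc_of% k1, reassoc_of% k2, he]

end GlueHom

section Family

variable {p : ℕ} [hp : Fact p.Prime]

variable (p) in
/-- A compatible family of Frobenius subrings of the rings `W₂(Γ(X, U))`, `U` affine. -/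
structure FrobFamily (X : Scheme.{u}) where
  /-- The subrings. -/
  R (U : X.Opens) : Subring (W2 p Γ(X, U))
  isFrobSubring {U : X.Opens} (hU : IsAffineOpen U) : IsFrobSubring p (R U)
  map_mem {U V : X.Opens} (hU : IsAffineOpen U) (hV : IsAffineOpen V) (h : V ≤ U) {w : W2 p Γ(X, U)}
    (hw : w ∈ R U) : W2.map (res h) w ∈ R V

namespace FrobFamily

variable {X : Scheme.{u}} (Φ : FrobFamily p X)

/-- Restriction of elements of the subrings. -/
noncomputable def resHom {U V : X.Opens} (hU : IsAffineOpen U) (hV : IsAffineOpen V) (h : V ≤ U) :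
    Φ.R U →+* Φ.R V :=
  ((W2.map (res h)).comp (Φ.R U).subtype).codRestrict (Φ.R V) fun w => Φ.map_mem hU hV h w.2

theorem coe_resHom {U V : X.Opens} (hU : IsAffineOpen U) (hV : IsAffineOpen V) (h : V ≤ U)
    (w : Φ.R U) : (Φ.resHom hU hV h w : W2 p Γ(X, V)) = W2.map (res h) w := rfl

/-- The projection to the ring of sections. -/
noncomputable def proj (U : X.Opens) : Φ.R U →+* Γ(X, U) := W2.c0.comp (Φ.R U).subtype

theorem proj_resHom {U V : X.Opens} (hU : IsAffineOpen U) (hV : IsAffineOpen V) (h : V ≤ U) :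
    (Φ.proj V).comp (Φ.resHom hU hV h) = (res h).comp (Φ.proj U) :=
  RingHom.ext fun w => W2.c0_map (res h) (w : W2 p Γ(X, U))

theorem isAffineOpen_toOpens (U : X.AffineZariskiSite) : IsAffineOpen U.toOpens := U.2

/-- The spectra of the subrings. -/
noncomputable def diagram : X.AffineZariskiSite ⥤ Scheme.{u} where
  obj U := Spec (.of (Φ.R U.toOpens))
  map {U V} i := Spec.map (CommRingCat.ofHom
    (Φ.resHom (isAffineOpen_toOpens V) (isAffineOpen_toOpens U) (Scheme.AffineZariskiSite.toOpens_mono i.le)))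
  map_id U := by
    rw [← Spec.map_id]
    congr 1
    refine CommRingCat.hom_ext (RingHom.ext fun w => Subtype.ext ?_)
    change W2.map (res (le_refl U.toOpens)) ((Φ.R U.toOpens).subtype w) = (Φ.R U.toOpens).subtype w
    have : res (le_refl U.toOpens) = RingHom.id Γ(X, U.toOpens) := RingHom.ext fun s => res_self _ s
    rw [this, W2.map_id]
  map_comp {U V W} i j := by
    rw [← Spec.map_comp]
    congr 1
    refine CommRingCat.hom_ext (RingHom.ext fun w => Subtype.ext ?_)
    change W2.map (res _) ((Φ.R W.toOpens).subtype w) =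
      W2.map (res _) (W2.map (res _) ((Φ.R W.toOpens).subtype w))
    rw [W2.map_map, res_comp_res]

variable {k : Type u} [Field k] [CharP k p] (f : X ⟶ Spec (.of k))

variable [IsReduced X]

include f in
theorem isFlatLift {U : X.Opens} (hU : IsAffineOpen U) : IsFlatLift p (Φ.proj U) :=
  (Φ.isFrobSubring hU).isFlatLift (natCast_sections_eq_zero p f U)

-- Morphisms of the site are inclusions of basic opens, so the transition map is localization at any
-- lift of the defining function.
include f in
theorem isOpenImmersion_diagram_map {U V : X.AffineZariskiSite} (i : U ⟶ V) :
    IsOpenImmersion (Φ.diagram.map i) := by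
  obtain ⟨g, hg⟩ := i.le
  have hle := Scheme.AffineZariskiSite.toOpens_mono i.le
  obtain ⟨s, rfl⟩ := (Φ.isFlatLift f (isAffineOpen_toOpens V)).surj g
  let := (Φ.resHom (isAffineOpen_toOpens V) (isAffineOpen_toOpens U) hle).toAlgebra
  let := (res hle).toAlgebra
  have h1 : IsLocalization.Away (Φ.proj V.toOpens s) Γ(X, U.toOpens) :=
    (isAffineOpen_toOpens V).isLocalization_of_eq_basicOpen _ (homOfLE hle) hg.symm
  have h2 : IsLocalization.Away s (Φ.R U.toOpens) :=
    (Φ.isFlatLift f (isAffineOpen_toOpens V)).isLocalization_away (Φ.isFlatLift f (isAffineOpen_toOpens U))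
      (fun x => congrArg (fun g => g x) (Φ.proj_resHom (isAffineOpen_toOpens V) (isAffineOpen_toOpens U) hle)) s
  exact IsOpenImmersion.of_isLocalization (R := Φ.R V.toOpens) (S := Φ.R U.toOpens) s

/-- The special fibre of the spectrum of a subring. -/
noncomputable abbrev specProj (U : X.Opens) : Spec Γ(X, U) ⟶ Spec (.of (Φ.R U)) :=
  Spec.map (CommRingCat.ofHom (Φ.proj U))

include f in
theorem specProj_surjective {U : X.Opens} (hU : IsAffineOpen U) :
    Function.Surjective (Φ.specProj U) := by
  have hL := Φ.isFlatLift f hU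
  intro x
  have h := range_comap_of_surjective _ (Φ.proj U) hL.surj
  have hx : x ∈ PrimeSpectrum.zeroLocus (RingHom.ker (Φ.proj U) : Set (Φ.R U)) := by
    intro w hw
    obtain ⟨y, rfl⟩ := (hL.eq_zero_iff w).mp hw
    have h2 : ((p : Φ.R U) * y) * (p * y) = 0 := by
      rw [mul_mul_mul_comm, hL.natCast_mul_natCast, zero_mul]
    exact (x.isPrime.mem_or_mem (h2 ▸ x.asIdeal.zero_mem : (p : Φ.R U) * y * (p * y) ∈ x.asIdeal)).elim
      id id
  rw [← h] at hx
  exact hx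

include f in
theorem specProj_injective {U : X.Opens} (hU : IsAffineOpen U) :
    Function.Injective (Φ.specProj U) :=
  PrimeSpectrum.comap_injective_of_surjective _ (Φ.isFlatLift f hU).surj

/-- The special fibre of the spectrum of a subring, as a morphism to the diagram. -/
noncomputable abbrev diagramProj (U : X.AffineZariskiSite) :
    Spec Γ(X, U.toOpens) ⟶ Φ.diagram.obj U := Φ.specProj U.toOpens

include f in
theorem diagramProj_surjective (U : X.AffineZariskiSite) :
    Function.Surjective (Φ.diagramProj U) :=
  Φ.specProj_surjective f (isAffineOpen_toOpens U)

theorem diagramProj_map {U V : X.AffineZariskiSite} (i : U ⟶ V) :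
    Φ.diagramProj U ≫ Φ.diagram.map i =
      Spec.map (CommRingCat.ofHom (res (Scheme.AffineZariskiSite.toOpens_mono i.le))) ≫
        Φ.diagramProj V := by
  change Spec.map _ ≫ Spec.map _ = Spec.map _ ≫ Spec.map _
  rw [← Spec.map_comp, ← Spec.map_comp, ← CommRingCat.ofHom_comp, ← CommRingCat.ofHom_comp,
    proj_resHom]

/-- Near a common point two affine opens share an open that is basic in both; this is the source of
local directedness of the diagram. -/
theorem exists_le_le {U V : X.AffineZariskiSite} {x : X} (hU : x ∈ U.toOpens) (hV : x ∈ V.toOpens) :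
    ∃ W : X.AffineZariskiSite, W ≤ U ∧ W ≤ V ∧ x ∈ W.toOpens := by
  obtain ⟨f, g, e, hxf⟩ := exists_basicOpen_le_affine_inter (isAffineOpen_toOpens U) (isAffineOpen_toOpens V) x ⟨hU, hV⟩
  exact ⟨U.basicOpen f, U.basicOpen_le f, ⟨g, e.symm⟩, hxf⟩

include f in
theorem exists_of_fromSpec_eq {U V : X.AffineZariskiSite} (y : Spec Γ(X, U.toOpens))
    (z : Spec Γ(X, V.toOpens)) (h : (isAffineOpen_toOpens U).fromSpec y = (isAffineOpen_toOpens V).fromSpec z) :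
    ∃ (W : X.AffineZariskiSite) (i : W ⟶ U) (j : W ⟶ V) (x : Φ.diagram.obj W),
      Φ.diagram.map i x = Φ.diagramProj U y ∧ Φ.diagram.map j x = Φ.diagramProj V z := by
  have hU : (isAffineOpen_toOpens U).fromSpec y ∈ U.toOpens := by
    rw [← SetLike.mem_coe, ← (isAffineOpen_toOpens U).range_fromSpec]; exact ⟨y, rfl⟩
  have hV : (isAffineOpen_toOpens U).fromSpec y ∈ V.toOpens := by
    rw [h, ← SetLike.mem_coe, ← (isAffineOpen_toOpens V).range_fromSpec]; exact ⟨z, rfl⟩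
  obtain ⟨W, i, j, hW⟩ := exists_le_le hU hV
  rw [← SetLike.mem_coe, ← (isAffineOpen_toOpens W).range_fromSpec] at hW
  obtain ⟨x, hx⟩ := hW
  refine ⟨W, homOfLE i, homOfLE j, Φ.diagramProj W x, ?_, ?_⟩
  · rw [← Scheme.Hom.comp_apply, diagramProj_map, Scheme.Hom.comp_apply]
    congr 1
    apply (isAffineOpen_toOpens U).fromSpec.isOpenEmbedding.injective
    rw [← Scheme.Hom.comp_apply, specMap_res_fromSpec (isAffineOpen_toOpens U) (isAffineOpen_toOpens W), hx]
  · rw [← Scheme.Hom.comp_apply, diagramProj_map, Scheme.Hom.comp_apply]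
    congr 1
    apply (isAffineOpen_toOpens V).fromSpec.isOpenEmbedding.injective
    rw [← Scheme.Hom.comp_apply, specMap_res_fromSpec (isAffineOpen_toOpens V) (isAffineOpen_toOpens W), hx, h]

-- The kernel of the projection to `Γ(X, U)` has square zero, so both rings have the same points,
-- and the claim becomes one about points of `X`.
include f in
theorem isLocallyDirected : (Φ.diagram ⋙ Scheme.forget).IsLocallyDirected where
  cond {U V W} i j x y hxy := by
    change Φ.diagram.map i x = Φ.diagram.map j y at hxy
    obtain ⟨x, rfl⟩ := Φ.diagramProj_surjective f U x
    obtain ⟨y, rfl⟩ := Φ.diagramProj_surjective f V y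
    rw [← Scheme.Hom.comp_apply, ← Scheme.Hom.comp_apply, diagramProj_map, diagramProj_map,
      Scheme.Hom.comp_apply, Scheme.Hom.comp_apply] at hxy
    have h := congrArg (isAffineOpen_toOpens W).fromSpec (Φ.specProj_injective f (isAffineOpen_toOpens W) hxy)
    rw [← Scheme.Hom.comp_apply, ← Scheme.Hom.comp_apply, specMap_res_fromSpec (isAffineOpen_toOpens W) (isAffineOpen_toOpens U),
      specMap_res_fromSpec (isAffineOpen_toOpens W) (isAffineOpen_toOpens V)] at h
    exact Φ.exists_of_fromSpec_eq f x y h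

end FrobFamily

end Family

end

/-! ### The Frobenius lifting attached to a Frobenius family. -/

section

section StructureMap

variable {S T : Scheme.{u}} {A : Type u} [CommRing A]

/-- The structure map on sections of a scheme over `Spec A`. -/
noncomputable def strSec (g : S ⟶ Spec (.of A)) (W : S.Opens) : A →+* Γ(S, W) :=
  ((Scheme.ΓSpecIso (.of A)).inv ≫ g.appLE ⊤ W le_top).hom

theorem specMap_strSec (g : S ⟶ Spec (.of A)) {W : S.Opens} (hW : IsAffineOpen W) :
    Spec.map (CommRingCat.ofHom (strSec g W)) = hW.fromSpec ≫ g := by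
  rw [← IsAffineOpen.SpecMap_appLE_fromSpec g (isAffineOpen_top _) hW le_top,
    IsAffineOpen.fromSpec_top, Scheme.isoSpec_Spec_inv, ← Spec.map_comp]
  rfl

theorem le_preimage_top (g : S ⟶ T) (W : S.Opens) : W ≤ g ⁻¹ᵁ ⊤ := fun _ _ => trivial

theorem strSec_eq (g : S ⟶ Spec (.of A)) (W : S.Opens) (e : W ≤ g ⁻¹ᵁ ⊤) :
    strSec g W = (pull g e).comp (Scheme.ΓSpecIso (.of A)).inv.hom := rfl

theorem pull_comp_strSec (h : T ⟶ S) (g : S ⟶ Spec (.of A)) {W : S.Opens} {V : T.Opens}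
    (e : V ≤ h ⁻¹ᵁ W) : (pull h e).comp (strSec g W) = strSec (h ≫ g) V := by
  rw [strSec_eq g W (le_preimage_top _ _), strSec_eq (h ≫ g) V (le_preimage_top _ _),
    ← RingHom.comp_assoc, pull_pull]

theorem res_comp_strSec (g : S ⟶ Spec (.of A)) {W V : S.Opens} (e : V ≤ W) :
    (res e).comp (strSec g W) = strSec g V := by
  rw [strSec_eq g W (le_preimage_top _ _), strSec_eq g V (le_preimage_top _ _),
    ← RingHom.comp_assoc, res_pull]

theorem strSec_comp_specMap {B : Type u} [CommRing B] (φ : B →+* A) (g : S ⟶ Spec (.of A))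
    {W : S.Opens} (hW : IsAffineOpen W) :
    strSec (g ≫ Spec.map (CommRingCat.ofHom φ)) W = (strSec g W).comp φ := by
  have h : CommRingCat.ofHom (strSec (g ≫ Spec.map (CommRingCat.ofHom φ)) W) =
      CommRingCat.ofHom ((strSec g W).comp φ) := by
    apply Spec.map_injective
    rw [CommRingCat.ofHom_comp, Spec.map_comp, specMap_strSec _ hW, specMap_strSec _ hW,
      Category.assoc]
  exact congrArg CommRingCat.Hom.hom h

end StructureMap

section Glued

variable {p : ℕ} [hp : Fact p.Prime] {X : Scheme.{u}} (Φ : FrobFamily p X)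
  {k : Type u} [Field k] [CharP k p] (f : X ⟶ Spec (.of k)) [IsReduced X]

namespace FrobFamily

theorem exists_site_mem (x : X) : ∃ V : X.AffineZariskiSite, x ∈ V.toOpens := by
  obtain ⟨V, hV, -, hxV⟩ := exists_isAffineOpen_le (U := ⊤) (x := x) trivial
  exact ⟨⟨V, hV⟩, hxV⟩

/-- The restriction maps between the spectra of the subrings. -/
noncomputable abbrev specRes {U V : X.AffineZariskiSite} (i : U ≤ V) :
    Spec (.of (Φ.R U.toOpens)) ⟶ Spec (.of (Φ.R V.toOpens)) :=
  Spec.map (CommRingCat.ofHom (Φ.resHom (isAffineOpen_toOpens V) (isAffineOpen_toOpens U)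
    (Scheme.AffineZariskiSite.toOpens_mono i)))

theorem specProj_specRes {U V : X.AffineZariskiSite} (i : U ≤ V) :
    Φ.specProj U.toOpens ≫ Φ.specRes i =
      Spec.map (CommRingCat.ofHom (res (Scheme.AffineZariskiSite.toOpens_mono i))) ≫
        Φ.specProj V.toOpens :=
  Φ.diagramProj_map (homOfLE i)

include f in
/-- The gluing of the spectra of a compatible family of Frobenius subrings. -/
theorem exists_glued : ∃ (T : Scheme.{u})
    (ι : ∀ U : X.AffineZariskiSite, Spec (.of (Φ.R U.toOpens)) ⟶ T),
    (∀ U, IsOpenImmersion (ι U)) ∧ (∀ {U V} (i : U ≤ V), Φ.specRes i ≫ ι V = ι U) ∧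
    (∀ t, ∃ U y, ι U y = t) ∧
    (∀ U V x y, ι U x = ι V y → ∃ W, ∃ (i : W ≤ U) (j : W ≤ V), ∃ z,
      Φ.specRes i z = x ∧ Φ.specRes j z = y) ∧
    ∀ (T' : Scheme.{u}) (m : ∀ U : X.AffineZariskiSite, Spec (.of (Φ.R U.toOpens)) ⟶ T'),
      (∀ {U V} (i : U ≤ V), Φ.specRes i ≫ m V = m U) → ∃ q : T ⟶ T', ∀ U, ι U ≫ q = m U := by
  have h1 : ∀ {U V : X.AffineZariskiSite} (i : U ⟶ V), IsOpenImmersion (Φ.diagram.map i) :=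
    fun i => Φ.isOpenImmersion_diagram_map f i
  have h2 := Φ.isLocallyDirected f
  refine ⟨colimit Φ.diagram, colimit.ι Φ.diagram,
    fun U => (inferInstance : IsOpenImmersion (colimit.ι Φ.diagram U)),
    fun i => colimit.w Φ.diagram (homOfLE i),
    Scheme.IsLocallyDirected.ι_jointly_surjective Φ.diagram,
    fun U V x y h => ?_, fun T' m hm => ?_⟩
  · obtain ⟨W, i, j, z, h⟩ := (Scheme.IsLocallyDirected.ι_eq_ι_iff Φ.diagram).mp h
    exact ⟨W, i.le, j.le, z, h⟩
  · refine ⟨colimit.desc Φ.diagram ⟨T', { app := m, naturality := fun U V i => ?_ }⟩,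
      fun U => colimit.ι_desc _ _⟩
    exact (hm i.le).trans (Category.comp_id _).symm

variable [PerfectField k]

/-- The `W₂(k)`-algebra structure on a Frobenius subring. -/
noncomputable def strHom {U : X.Opens} (hU : IsAffineOpen U) : W2 p k →+* Φ.R U :=
  (W2.map (strSec f U)).codRestrict (Φ.R U) fun w =>
    (Φ.isFrobSubring hU).map_mem (natCast_sections_eq_zero p f U) (strSec f U) w

theorem proj_strHom {U : X.Opens} (hU : IsAffineOpen U) (w : W2 p k) :
    Φ.proj U (Φ.strHom f hU w) = strSec f U (W2.c0 w) :=
  W2.c0_map (strSec f U) w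

theorem resHom_comp_strHom {U V : X.Opens} (hU : IsAffineOpen U) (hV : IsAffineOpen V)
    (h : V ≤ U) : (Φ.resHom hU hV h).comp (Φ.strHom f hU) = Φ.strHom f hV := by
  refine RingHom.ext fun w => Subtype.ext ?_
  change W2.map (res h) (W2.map (strSec f U) w) = W2.map (strSec f V) w
  rw [W2.map_map, res_comp_strSec]

/-- The Frobenius endomorphism of a Frobenius subring. -/
noncomputable def frobHom {U : X.Opens} (hU : IsAffineOpen U) : Φ.R U →+* Φ.R U :=
  ((W2.map (powRingHom p _ (natCast_sections_eq_zero p f U))).comp (Φ.R U).subtype).codRestrict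
    (Φ.R U) fun w => (Φ.isFrobSubring hU).map_powRingHom_mem (natCast_sections_eq_zero p f U) w.2

theorem resHom_comp_frobHom {U V : X.Opens} (hU : IsAffineOpen U) (hV : IsAffineOpen V)
    (h : V ≤ U) :
    (Φ.resHom hU hV h).comp (Φ.frobHom f hU) = (Φ.frobHom f hV).comp (Φ.resHom hU hV h) := by
  refine RingHom.ext fun w => Subtype.ext ?_
  change W2.map (res h) (W2.map (powRingHom p _ (natCast_sections_eq_zero p f U))
    (w : W2 p Γ(X, U))) = W2.map (powRingHom p _ (natCast_sections_eq_zero p f V))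
      (W2.map (res h) (w : W2 p Γ(X, U)))
  rw [W2.map_map, W2.map_map]
  congr 2
  exact RingHom.ext fun s => map_pow (res h) s p

omit [IsReduced X] [PerfectField k] in
theorem specMap_pow_fromSpec {U : X.Opens} (hU : IsAffineOpen U) :
    Spec.map (CommRingCat.ofHom (powRingHom p _ (natCast_sections_eq_zero p f U))) ≫ hU.fromSpec =
      hU.fromSpec ≫ absFrobenius p f := by
  have h := IsAffineOpen.SpecMap_appLE_fromSpec (absFrobenius p f) hU hU le_rfl
  rw [← h]
  congr 2
  have h2 : (absFrobenius p f).appLE U U le_rfl = (absFrobenius p f).app U :=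
    (Scheme.Hom.app_eq_appLE _).symm
  rw [h2]
  rfl

theorem isPullback_spec {U : X.Opens} (hU : IsAffineOpen U) :
    IsPullback (Φ.specProj U) (Spec.map (CommRingCat.ofHom (strSec f U)))
      (Spec.map (CommRingCat.ofHom (Φ.strHom f hU))) (specReduction p k) := by
  have hL := Φ.isFlatLift f hU
  exact isPullback_SpecMap_of_isPushout _ _ _ _ (isPushout_of_ker hL.surj
    (fun x hx => (hL.eq_zero_iff x).mp hx) (Φ.strHom f hU) (strSec f U) (Φ.proj_strHom f hU))

/-- A compatible family of Frobenius subrings comes from a Frobenius lifting. -/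
theorem exists_lifting : ∃ (LX : FrobeniusLifting p f)
    (ι : ∀ U : X.AffineZariskiSite, Spec (.of (Φ.R U.toOpens)) ⟶ LX.scheme),
    (∀ {U V} (i : U ≤ V), Φ.specRes i ≫ ι V = ι U) ∧
    (∀ U, (isAffineOpen_toOpens U).fromSpec ≫ LX.incl = Φ.specProj U.toOpens ≫ ι U) ∧
    (∀ U, ι U ≫ LX.str =
      Spec.map (CommRingCat.ofHom (Φ.strHom f (isAffineOpen_toOpens U)))) ∧
    (∀ U, ι U ≫ LX.frob =
      Spec.map (CommRingCat.ofHom (Φ.frobHom f (isAffineOpen_toOpens U))) ≫ ι U) := by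
  obtain ⟨T, ι, hopen, hcompat, hsurj, hinj, hdesc⟩ := Φ.exists_glued f
  obtain ⟨str, hstr⟩ := hdesc (SpecW2 p k)
    (fun U => Spec.map (CommRingCat.ofHom (Φ.strHom f (isAffineOpen_toOpens U)))) (fun {U V} i => by
      change Spec.map _ ≫ Spec.map _ = _
      rw [← Spec.map_comp, ← CommRingCat.ofHom_comp, resHom_comp_strHom])
  obtain ⟨frob, hfrob⟩ := hdesc T
    (fun U => Spec.map (CommRingCat.ofHom (Φ.frobHom f (isAffineOpen_toOpens U))) ≫ ι U)
    (fun {U V} i => by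
      rw [← hcompat i]
      change Spec.map _ ≫ Spec.map _ ≫ _ = Spec.map _ ≫ Spec.map _ ≫ _
      rw [← Spec.map_comp_assoc, ← Spec.map_comp_assoc, ← CommRingCat.ofHom_comp,
        ← CommRingCat.ofHom_comp, resHom_comp_frobHom])
  obtain ⟨incl, hincl⟩ := exists_hom_glue (S := X) (T := T) (I := X.AffineZariskiSite)
    (fun U => U.toOpens) isAffineOpen_toOpens
    exists_site_mem
    (fun U => Φ.specProj U.toOpens ≫ ι U)
    (fun U V x hU hV => by
      obtain ⟨W, i, j, hW⟩ := exists_le_le hU hV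
      refine ⟨W.toOpens, isAffineOpen_toOpens W, Scheme.AffineZariskiSite.toOpens_mono i,
        Scheme.AffineZariskiSite.toOpens_mono j, hW, ?_⟩
      have h1 := Φ.specProj_specRes i
      have h2 := Φ.specProj_specRes j
      rw [← reassoc_of% h1, ← reassoc_of% h2, hcompat, hcompat])
  have hpt : ∀ x : X, ∃ (U : X.AffineZariskiSite) (y : Spec Γ(X, U.toOpens)),
      (isAffineOpen_toOpens U).fromSpec y = x := by
    intro x
    obtain ⟨V, hxV⟩ := exists_site_mem x
    rw [← SetLike.mem_coe, ← (isAffineOpen_toOpens V).range_fromSpec] at hxV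
    exact ⟨V, hxV⟩
  have hincl_apply : ∀ (U : X.AffineZariskiSite) (y : Spec Γ(X, U.toOpens)),
      incl ((isAffineOpen_toOpens U).fromSpec y) = ι U (Φ.specProj U.toOpens y) := by
    intro U y
    rw [← Scheme.Hom.comp_apply, ← Scheme.Hom.comp_apply, hincl]
  have hincl_inj : Function.Injective incl := by
    intro x x' h
    obtain ⟨U, y, rfl⟩ := hpt x
    obtain ⟨V, z, rfl⟩ := hpt x'
    rw [hincl_apply, hincl_apply] at h
    obtain ⟨W, i, j, t, h1, h2⟩ := hinj _ _ _ _ h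
    obtain ⟨t, rfl⟩ := Φ.specProj_surjective f (isAffineOpen_toOpens W) t
    rw [← Scheme.Hom.comp_apply, specProj_specRes, Scheme.Hom.comp_apply] at h1 h2
    have h1' := Φ.specProj_injective f (isAffineOpen_toOpens U) h1
    have h2' := Φ.specProj_injective f (isAffineOpen_toOpens V) h2
    rw [← h1', ← h2', ← Scheme.Hom.comp_apply, ← Scheme.Hom.comp_apply,
      specMap_res_fromSpec (isAffineOpen_toOpens U) (isAffineOpen_toOpens W),
      specMap_res_fromSpec (isAffineOpen_toOpens V) (isAffineOpen_toOpens W)]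
  have hw : incl ≫ str = f ≫ specReduction p k := by
    refine hom_ext_of_affine fun x => ?_
    obtain ⟨V, hxV⟩ := exists_site_mem x
    have hV := isAffineOpen_toOpens V
    refine ⟨V.toOpens, hV, hxV, ?_⟩
    have h1 := hincl V
    have h2 : hV.fromSpec ≫ incl ≫ str = Φ.specProj V.toOpens ≫ Spec.map (CommRingCat.ofHom
        (Φ.strHom f hV)) := by
      rw [reassoc_of% h1, hstr V]
    refine h2.trans ((Φ.isPullback_spec f hV).w.trans ?_)
    rw [specMap_strSec f hV, Category.assoc]
  -- The comparison with the special fibre of the glued scheme, shown below to be a surjective open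
  -- immersion.
  let m : X ⟶ pullback str (specReduction p k) := pullback.lift incl f hw
  have hm1 : m ≫ pullback.fst _ _ = incl := pullback.lift_fst _ _ _
  have hm2 : m ≫ pullback.snd _ _ = f := pullback.lift_snd _ _ _
  have hm_inj : Function.Injective m := by
    intro x x' h
    apply hincl_inj
    rw [← hm1, Scheme.Hom.comp_apply, Scheme.Hom.comp_apply, h]
  have hm_open : IsOpenImmersion m := by
    refine IsOpenImmersion.of_forall_source_exists m hm_inj fun x => ?_
    obtain ⟨V, hxV⟩ := exists_site_mem x
    have hV := isAffineOpen_toOpens V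
    refine ⟨Spec Γ(X, V.toOpens), hV.fromSpec, inferInstance, by rw [hV.opensRange_fromSpec]; exact hxV, ?_⟩
    have hbig : IsPullback ((hV.fromSpec ≫ m) ≫ pullback.snd str (specReduction p k))
        (Φ.specProj V.toOpens) (specReduction p k) (ι V ≫ str) := by
      rw [Category.assoc, hm2, hstr V, ← specMap_strSec f hV]
      exact (Φ.isPullback_spec f hV).flip
    -- Cancelling the square that defines the special fibre from the affine one shows that `m` on
    -- this chart is a base change of the open immersion `ι V`.
    have hsq : IsPullback (hV.fromSpec ≫ m) (Φ.specProj V.toOpens) (pullback.fst str (specReduction p k))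
        (ι V) := by
      refine IsPullback.of_right hbig ?_ (IsPullback.of_hasPullback str (specReduction p k)).flip
      rw [Category.assoc, hm1]
      exact hincl V
    exact MorphismProperty.of_isPullback hsq.flip (hopen V)
  have hm_surj : Surjective m := by
    refine ⟨fun z => ?_⟩
    obtain ⟨U, y, hy⟩ := hsurj (pullback.fst str (specReduction p k) z)
    obtain ⟨y, rfl⟩ := Φ.specProj_surjective f (isAffineOpen_toOpens U) y
    refine ⟨(isAffineOpen_toOpens U).fromSpec y, ?_⟩
    apply (pullback.fst str (specReduction p k)).isClosedEmbedding.injective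
    rw [← Scheme.Hom.comp_apply, hm1, hincl_apply, hy]
  have hm_iso : IsIso m := (isIso_iff_isOpenImmersion_and_surjective m).mpr ⟨hm_open, hm_surj⟩
  have hflat : Flat str := by
    let 𝒰 : T.OpenCover :=
      { I₀ := X.AffineZariskiSite
        X := fun U => Spec (.of (Φ.R U.toOpens))
        f := ι
        mem₀ := by
          rw [Scheme.presieve₀_mem_precoverage_iff]
          exact ⟨hsurj, hopen⟩ }
    have := HasRingHomProperty.instIsZariskiLocalAtSource (P := @AlgebraicGeometry.Flat)
      (Q := @RingHom.Flat)
    rw [IsZariskiLocalAtSource.iff_of_openCover (P := @AlgebraicGeometry.Flat) 𝒰]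
    intro U
    change Flat (ι U ≫ str)
    rw [hstr, Flat.SpecMap_iff]
    exact (Φ.isFlatLift f (isAffineOpen_toOpens U)).flat _
  suffices hif : incl ≫ frob = absFrobenius p f ≫ incl by
    exact ⟨⟨T, str, hflat, incl, IsPullback.of_iso_pullback ⟨hw⟩ (asIso m) hm1 hm2, frob, hif⟩,
      ι, hcompat, hincl, hstr, hfrob⟩
  refine hom_ext_of_affine fun x => ?_
  obtain ⟨V, hxV⟩ := exists_site_mem x
  have hV := isAffineOpen_toOpens V
  refine ⟨V.toOpens, hV, hxV, ?_⟩
  have h1 : hV.fromSpec ≫ incl = Φ.specProj V.toOpens ≫ ι V := hincl V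
  have h2 := hfrob V
  have h3 := specMap_pow_fromSpec (p := p) f hV
  rw [reassoc_of% h1, h2, ← reassoc_of% h3, h1]
  change Spec.map _ ≫ Spec.map _ ≫ _ = Spec.map _ ≫ Spec.map _ ≫ _
  rw [← Spec.map_comp_assoc, ← Spec.map_comp_assoc, ← CommRingCat.ofHom_comp,
    ← CommRingCat.ofHom_comp]
  congr 3

end FrobFamily

end Glued

end

/-! ### Morphisms between liftings, and products of liftings. -/

section

section

variable {p : ℕ} [hp : Fact p.Prime] {k : Type u} [Field k] [CharP k p]

theorem exists_isAffineOpen_le_preimage {S T : Scheme.{u}} (h : S ⟶ T) {O : S.Opens} {x : S}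
    (hx : x ∈ O) : ∃ (U : T.Opens) (V : S.Opens), IsAffineOpen U ∧ IsAffineOpen V ∧ V ≤ O ∧
      V ≤ h ⁻¹ᵁ U ∧ x ∈ V := by
  obtain ⟨U, hU, -, hxU⟩ := exists_isAffineOpen_le (U := ⊤) (x := h x) trivial
  obtain ⟨V, hV, e, hxV⟩ := exists_isAffineOpen_le (U := O ⊓ h ⁻¹ᵁ U) (x := x) ⟨hx, hxU⟩
  exact ⟨U, V, hU, hV, e.trans inf_le_left, e.trans inf_le_right, hxV⟩

theorem absFrobenius_naturality {Z X : Scheme.{u}} (fZ : Z ⟶ Spec (.of k)) (f : X ⟶ Spec (.of k))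
    (h : Z ⟶ X) : absFrobenius p fZ ≫ h = h ≫ absFrobenius p f := by
  refine hom_ext_of_affine fun x => ?_
  obtain ⟨U, V, hU, hV, -, e, hx⟩ := exists_isAffineOpen_le_preimage h (O := ⊤) (x := x) trivial
  refine ⟨V, hV, hx, ?_⟩
  have h1 := FrobFamily.specMap_pow_fromSpec (p := p) fZ hV
  have h2 := FrobFamily.specMap_pow_fromSpec (p := p) f hU
  have h3 := specMap_pull_fromSpec h hU hV e
  rw [← reassoc_of% h1, ← h3, ← reassoc_of% h3, ← h2, ← Spec.map_comp_assoc, ← Spec.map_comp_assoc,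
    ← CommRingCat.ofHom_comp, ← CommRingCat.ofHom_comp]
  congr 3
  exact RingHom.ext fun s => (map_pow (pull h e) s p).symm

variable [PerfectField k]

namespace FrobeniusLifting

variable {X : Scheme.{u}} {f : X ⟶ Spec (.of k)} (L : FrobeniusLifting p f)

theorem proj_eq_pull (W : L.scheme.Opens) : L.proj W = pull L.incl le_rfl := by
  change (L.incl.app W).hom = (L.incl.appLE W (L.incl ⁻¹ᵁ W) le_rfl).hom
  rw [Scheme.Hom.app_eq_appLE]

theorem specMap_proj_fromSpec {W : L.scheme.Opens} (hW : IsAffineOpen W) :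
    Spec.map (CommRingCat.ofHom (L.proj W)) ≫ hW.fromSpec =
      (L.isAffineOpen_preimage hW).fromSpec ≫ L.incl := by
  rw [proj_eq_pull]
  exact specMap_pull_fromSpec L.incl hW _ le_rfl

theorem specMap_frobSection_fromSpec {W : L.scheme.Opens} (hW : IsAffineOpen W) :
    Spec.map (CommRingCat.ofHom (L.frobSection W)) ≫ hW.fromSpec = hW.fromSpec ≫ L.frob :=
  specMap_pull_fromSpec L.frob hW hW _

theorem proj_strSec {W : L.scheme.Opens} (hW : IsAffineOpen W) (w : W2 p k) :
    L.proj W (strSec L.str W w) = strSec f (L.incl ⁻¹ᵁ W) (W2.c0 w) := by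
  have h1 : (L.proj W).comp (strSec L.str W) = (strSec f (L.incl ⁻¹ᵁ W)).comp (reduction p k) := by
    rw [proj_eq_pull, pull_comp_strSec, ← strSec_comp_specMap _ _ (L.isAffineOpen_preimage hW)]
    congr 1
    exact L.isPullback.w
  exact congrArg (fun g => g w) h1

theorem ringHom_ext {W : L.scheme.Opens} (hW : IsAffineOpen W) {φ ψ : W2 p k →+* Γ(L.scheme, W)}
    (h : ∀ w, L.proj W (φ w) = L.proj W (ψ w)) : φ = ψ :=
  (L.isFlatLift hW).hom_ext_of_perfect (CharP.cast_eq_zero k p)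
    (fun c => (surjective_frobenius k p c).imp fun _ h => h.symm) h

/-- The Frobenius lifting is semilinear over the Frobenius of `W₂(k)`. -/
theorem frob_str : L.frob ≫ L.str =
    L.str ≫ Spec.map (CommRingCat.ofHom (W2.map (p := p) (frobenius k p))) := by
  refine hom_ext_of_affine fun x => ?_
  obtain ⟨W, hW, -, hx⟩ := exists_isAffineOpen_le (U := ⊤) (x := x) trivial
  refine ⟨W, hW, hx, ?_⟩
  have h1 := L.specMap_frobSection_fromSpec hW
  have h2 := specMap_strSec L.str hW
  rw [← reassoc_of% h1, ← h2, ← reassoc_of% h2, ← Spec.map_comp, ← Spec.map_comp,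
    ← CommRingCat.ofHom_comp, ← CommRingCat.ofHom_comp]
  congr 2
  refine L.ringHom_ext hW fun w => ?_
  rw [RingHom.comp_apply, proj_frobSection, L.proj_strSec hW, RingHom.comp_apply,
    L.proj_strSec hW, W2.c0_map, frobenius_def, map_pow]

/-- A morphism of liftings inducing the identity on the special fibre is an isomorphism. -/
theorem isIso_of_incl (L' : FrobeniusLifting p f) (q : L.scheme ⟶ L'.scheme)
    (hq : L.incl ≫ q = L'.incl) : IsIso q := by
  have hpt : ∀ z, q (L.incl z) = L'.incl z := fun z => by rw [← Scheme.Hom.comp_apply, hq]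
  rw [isIso_iff_isOpenImmersion_and_surjective]
  constructor
  · refine IsOpenImmersion.of_forall_source_exists q ?_ fun x => ?_
    · intro x y h
      obtain ⟨x, rfl⟩ := L.incl.surjective x
      obtain ⟨y, rfl⟩ := L.incl.surjective y
      rw [hpt, hpt] at h
      rw [L'.incl.isClosedEmbedding.injective h]
    · obtain ⟨W, hW, -, hx⟩ := exists_isAffineOpen_le (U := ⊤) (x := q x) trivial
      have hpre : L.incl ⁻¹ᵁ (q ⁻¹ᵁ W) = L'.incl ⁻¹ᵁ W := by
        rw [← Scheme.Hom.comp_preimage, hq]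
      have hV : IsAffineOpen (q ⁻¹ᵁ W) :=
        L.isAffineOpen_of_preimage (hpre ▸ L'.isAffineOpen_preimage hW)
      refine ⟨Spec Γ(L.scheme, q ⁻¹ᵁ W), hV.fromSpec, inferInstance,
        by rw [hV.opensRange_fromSpec]; exact hx, ?_⟩
      rw [← specMap_pull_fromSpec q hW hV le_rfl]
      -- On affine sections `q` is a homomorphism between flat lifts of the same ring, hence
      -- bijective.
      have hb : Function.Bijective (pull q (le_refl (q ⁻¹ᵁ W))) := by
        have hL : IsFlatLift p (pull L.incl (hpre.ge : L'.incl ⁻¹ᵁ W ≤ L.incl ⁻¹ᵁ (q ⁻¹ᵁ W))) := by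
          have h0 := L.isFlatLift hV
          rw [proj_eq_pull] at h0
          have : ∀ (V : X.Opens) (hV : L.incl ⁻¹ᵁ (q ⁻¹ᵁ W) = V),
              IsFlatLift p (pull L.incl (hV.ge : V ≤ L.incl ⁻¹ᵁ (q ⁻¹ᵁ W))) := by
            rintro V rfl
            exact h0
          exact this _ hpre
        refine (L'.isFlatLift hW).bijective hL fun s => ?_
        rw [← RingHom.comp_apply, pull_pull, proj_eq_pull, pull_congr hq]
      have : IsIso (CommRingCat.ofHom (pull q (le_refl (q ⁻¹ᵁ W)))) :=
        (ConcreteCategory.isIso_iff_bijective _).mpr hb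
      infer_instance
  · refine ⟨fun x => ?_⟩
    obtain ⟨z, rfl⟩ := L'.incl.surjective x
    exact ⟨L.incl z, hpt z⟩

variable {Y : Scheme.{u}} {g : Y ⟶ Spec (.of k)}

/-- The product of two Frobenius liftings. -/
noncomputable def prod (LX : FrobeniusLifting p f) (LY : FrobeniusLifting p g) :
    FrobeniusLifting p (prodStr f g) where
  scheme := pullback LX.str LY.str
  str := pullback.fst LX.str LY.str ≫ LX.str
  flat := inferInstance
  incl := pullback.map f g LX.str LY.str LX.incl LY.incl (specReduction p k)
    LX.isPullback.w.symm LY.isPullback.w.symm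
  isPullback := by
    have h1 := (IsPullback.of_hasPullback f g).flip.paste_horiz LY.isPullback
    rw [← LX.isPullback.w, ← pullback.lift_snd (f := LX.str) (g := LY.str)
      (pullback.fst f g ≫ LX.incl) (pullback.snd f g ≫ LY.incl)
      (by rw [Category.assoc, Category.assoc, LX.isPullback.w, LY.isPullback.w,
        pullback.condition_assoc])] at h1
    exact (IsPullback.of_right h1 (pullback.lift_fst _ _ _)
      (IsPullback.of_hasPullback LX.str LY.str).flip).paste_vert LX.isPullback
  -- Both Frobenius liftings cover the Frobenius of `W₂(k)` rather than the identity, so this is the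
  -- map needed on the base.
  frob := pullback.map LX.str LY.str LX.str LY.str LX.frob LY.frob
    (Spec.map (CommRingCat.ofHom (W2.map (p := p) (frobenius k p)))) LX.frob_str.symm
    LY.frob_str.symm
  incl_frob := by
    apply pullback.hom_ext
    · simp only [Category.assoc, pullback.lift_fst, pullback.lift_fst_assoc]
      rw [LX.incl_frob, ← Category.assoc, ← Category.assoc, absFrobenius_naturality _ f]
    · simp only [Category.assoc, pullback.lift_snd, pullback.lift_snd_assoc]
      rw [LY.incl_frob, ← Category.assoc, ← Category.assoc, absFrobenius_naturality _ g]

/-- The inverse of `toWitt` on the image of a ring. -/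
theorem exists_lift_toWitt [IsReduced X] {W : L.scheme.Opens} (hW : IsAffineOpen W) {R : Type u}
    [CommRing R] (ψ : R →+* W2 p Γ(X, L.incl ⁻¹ᵁ W)) (hψ : ∀ r, ψ r ∈ L.frobSubring hW) :
    ∃ φ : R →+* Γ(L.scheme, W), ∀ r,
      (L.isFlatLift hW).toWitt (L.proj_frobSection W) (φ r) = ψ r := by
  let θ := (L.isFlatLift hW).toWitt (L.proj_frobSection W)
  have hθ : Function.Injective θ := (L.isFlatLift hW).toWitt_injective _
  let e : Γ(L.scheme, W) ≃+* θ.range := RingEquiv.ofBijective θ.rangeRestrict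
    ⟨fun x y h => hθ (congrArg Subtype.val h), θ.rangeRestrict_surjective⟩
  refine ⟨(e.symm : θ.range →+* Γ(L.scheme, W)).comp (ψ.codRestrict θ.range hψ), fun r => ?_⟩
  exact congrArg Subtype.val (e.apply_symm_apply ⟨ψ r, hψ r⟩)

end FrobeniusLifting

/-- The lifting attached to a compatible family of Frobenius subrings, with its mapping
property. -/
theorem FrobFamily.exists_lifting_hom {X : Scheme.{u}} [IsReduced X] (f : X ⟶ Spec (.of k))
    (Φ : FrobFamily p X) :
    ∃ LX : FrobeniusLifting p f, ∀ (Z : Scheme.{u}) (_ : IsReduced Z) (fZ : Z ⟶ Spec (.of k))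
      (L : FrobeniusLifting p fZ) (h : Z ⟶ X), h ≫ f = fZ →
      (∀ (U : X.Opens) (W : L.scheme.Opens) (_ : IsAffineOpen U) (hW : IsAffineOpen W)
        (e : L.incl ⁻¹ᵁ W ≤ h ⁻¹ᵁ U), ∀ w ∈ Φ.R U, W2.map (pull h e) w ∈ L.frobSubring hW) →
      ∃ q : L.scheme ⟶ LX.scheme, q ≫ LX.str = L.str ∧ L.incl ≫ q = h ≫ LX.incl ∧
        L.frob ≫ q = q ≫ LX.frob := by
  obtain ⟨LX, ι, hcompat, hincl, hstr, hfrob⟩ := Φ.exists_lifting f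
  refine ⟨LX, fun Z _ fZ L h hf hΦ => ?_⟩
  -- Charts are pairs of affine opens, one of `X` and one of the lifting, such that `h` maps the
  -- special fibre of the second into the first.
  let I := {i : X.AffineZariskiSite × L.scheme.AffineZariskiSite //
    L.incl ⁻¹ᵁ i.2.toOpens ≤ h ⁻¹ᵁ i.1.toOpens}
  have hex : ∀ i : I, ∃ φ : Φ.R i.1.1.toOpens →+* Γ(L.scheme, i.1.2.toOpens), ∀ r,
      (L.isFlatLift (isAffineOpen_toOpens i.1.2)).toWitt (L.proj_frobSection _) (φ r) =
        W2.map (pull h i.2) r := fun i =>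
    L.exists_lift_toWitt (isAffineOpen_toOpens i.1.2)
      ((W2.map (pull h i.2)).comp (Φ.R i.1.1.toOpens).subtype)
      fun r => hΦ _ _ (isAffineOpen_toOpens i.1.1) _ i.2 r r.2
  choose φ hφ using hex
  have hφp : ∀ (i : I) r, L.proj i.1.2.toOpens (φ i r) = pull h i.2 (Φ.proj i.1.1.toOpens r) := by
    intro i r
    rw [← IsFlatLift.c0_toWitt (L.isFlatLift (isAffineOpen_toOpens i.1.2))
      (L.proj_frobSection i.1.2.toOpens) (φ i r), hφ, W2.c0_map]
    rfl
  have hinj : ∀ i : I, Function.Injective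
      ((L.isFlatLift (isAffineOpen_toOpens i.1.2)).toWitt (L.proj_frobSection _)) := fun i =>
    (L.isFlatLift (isAffineOpen_toOpens i.1.2)).toWitt_injective _
  have hmem : ∀ x : L.scheme, ∀ (O : L.scheme.Opens), x ∈ O → ∀ U : X.AffineZariskiSite,
      (∀ z, L.incl z = x → h z ∈ U.toOpens) → ∃ W : L.scheme.AffineZariskiSite,
        x ∈ W.toOpens ∧ W.toOpens ≤ O ∧ L.incl ⁻¹ᵁ W.toOpens ≤ h ⁻¹ᵁ U.toOpens := by
    intro x O hx U hU
    obtain ⟨O', hO'⟩ := L.exists_preimage_eq (h ⁻¹ᵁ U.toOpens)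
    obtain ⟨z, rfl⟩ := L.incl.surjective x
    have hz : L.incl z ∈ O' := by
      have : z ∈ L.incl ⁻¹ᵁ O' := hO' ▸ hU z rfl
      exact this
    obtain ⟨W, hW, e, hxW⟩ := exists_isAffineOpen_le (U := O ⊓ O') (x := L.incl z) ⟨hx, hz⟩
    exact ⟨⟨W, hW⟩, hxW, e.trans inf_le_left,
      hO' ▸ Scheme.Hom.preimage_mono L.incl (e.trans inf_le_right)⟩
  have hcov : ∀ x, ∃ i : I, x ∈ i.1.2.toOpens := by
    intro x
    obtain ⟨z, rfl⟩ := L.incl.surjective x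
    obtain ⟨U, hU⟩ := FrobFamily.exists_site_mem (h z)
    obtain ⟨W, hxW, -, e⟩ := hmem (L.incl z) ⊤ trivial U (fun z' hz' => by
      rwa [L.incl.isClosedEmbedding.injective hz'])
    exact ⟨⟨(U, W), e⟩, hxW⟩
  obtain ⟨q, hq⟩ := exists_hom_glue (S := L.scheme) (T := LX.scheme) (I := I)
    (fun i => i.1.2.toOpens) (fun i => isAffineOpen_toOpens i.1.2) hcov
    (fun i => Spec.map (CommRingCat.ofHom (φ i)) ≫ ι i.1.1) (by
      intro i j x hi hj
      obtain ⟨z, rfl⟩ := L.incl.surjective x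
      obtain ⟨U, a, b, hU⟩ := FrobFamily.exists_le_le (i.2 hi) (j.2 hj)
      obtain ⟨W, hxW, e, e'⟩ := hmem (L.incl z) (i.1.2.toOpens ⊓ j.1.2.toOpens) ⟨hi, hj⟩ U
        (fun z' hz' => by rwa [L.incl.isClosedEmbedding.injective hz'])
      have key : ∀ (i' : I) (a : U ≤ i'.1.1) (e₁ : W.toOpens ≤ i'.1.2.toOpens),
          Spec.map (CommRingCat.ofHom (res e₁)) ≫ Spec.map (CommRingCat.ofHom (φ i')) ≫ ι i'.1.1 =
            Spec.map (CommRingCat.ofHom (φ ⟨(U, W), e'⟩)) ≫ ι U := by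
        intro i' a e₁
        rw [← hcompat a, ← Spec.map_comp_assoc, ← Spec.map_comp_assoc, ← CommRingCat.ofHom_comp,
          ← CommRingCat.ofHom_comp]
        congr 3
        refine RingHom.ext fun w => hinj ⟨(U, W), e'⟩ ?_
        rw [RingHom.comp_apply, RingHom.comp_apply, hφ]
        refine (L.map_toWitt_res (isAffineOpen_toOpens i'.1.2) (isAffineOpen_toOpens W) e₁ _).symm.trans ?_
        rw [hφ, FrobFamily.coe_resHom, W2.map_map, W2.map_map, res_pull, pull_res]
      exact ⟨W.toOpens, isAffineOpen_toOpens W, e.trans inf_le_left, e.trans inf_le_right, hxW,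
        (key i a _).trans (key j b _).symm⟩)
  refine ⟨q, ?_, ?_, ?_⟩
  · refine hom_ext_of_affine fun x => ?_
    obtain ⟨i, hx⟩ := hcov x
    have hW := isAffineOpen_toOpens i.1.2
    refine ⟨i.1.2.toOpens, hW, hx, ?_⟩
    have h1 := hq i
    rw [reassoc_of% h1, hstr, ← specMap_strSec L.str hW, ← Spec.map_comp, ← CommRingCat.ofHom_comp]
    congr 2
    refine L.ringHom_ext hW fun w => ?_
    rw [RingHom.comp_apply, hφp, FrobFamily.proj_strHom, L.proj_strSec hW, ← RingHom.comp_apply,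
      pull_comp_strSec, hf]
  · refine hom_ext_of_affine fun z => ?_
    obtain ⟨i, hx⟩ := hcov (L.incl z)
    have hW := isAffineOpen_toOpens i.1.2
    refine ⟨L.incl ⁻¹ᵁ i.1.2.toOpens, L.isAffineOpen_preimage hW, hx, ?_⟩
    have h1 := hq i
    have h2 := L.specMap_proj_fromSpec hW
    have h3 := specMap_pull_fromSpec h (isAffineOpen_toOpens i.1.1) (L.isAffineOpen_preimage hW) i.2
    rw [← reassoc_of% h2, h1, ← reassoc_of% h3, hincl, ← Spec.map_comp_assoc, ← Spec.map_comp_assoc,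
      ← CommRingCat.ofHom_comp, ← CommRingCat.ofHom_comp]
    congr 3
    exact RingHom.ext fun w => hφp i w
  · refine hom_ext_of_affine fun x => ?_
    obtain ⟨i, hx⟩ := hcov x
    have hW := isAffineOpen_toOpens i.1.2
    refine ⟨i.1.2.toOpens, hW, hx, ?_⟩
    have h1 := hq i
    have h2 := L.specMap_frobSection_fromSpec hW
    rw [← reassoc_of% h2, h1, reassoc_of% h1, hfrob, ← Spec.map_comp_assoc, ← Spec.map_comp_assoc,
      ← CommRingCat.ofHom_comp, ← CommRingCat.ofHom_comp]
    congr 3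
    refine RingHom.ext fun w => hinj i ?_
    rw [RingHom.comp_apply, RingHom.comp_apply, hφ]
    -- Under `toWitt` the Frobenius of `L` becomes `W₂` of the `p`-th power map, which commutes with
    -- every map of sections.
    have h3 := (L.isFlatLift hW).map_toWitt (L.isFlatLift hW) (L.proj_frobSection _)
      (L.proj_frobSection _) (φ := L.frobSection _)
      (f := powRingHom p _ (natCast_sections_eq_zero p fZ _)) (L.proj_frobSection _)
      (fun _ => rfl) (φ i w)
    refine h3.symm.trans ?_
    rw [hφ]
    change W2.map _ (W2.map _ ((Φ.R i.1.1.toOpens).subtype w)) =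
      W2.map _ (W2.map (powRingHom p _ (natCast_sections_eq_zero p f _))
        ((Φ.R i.1.1.toOpens).subtype w))
    rw [W2.map_map, W2.map_map]
    congr 2
    exact RingHom.ext fun s => (map_pow (pull h i.2) s p).symm

end

end

/-! ### Opens of a product, and Frobenius families on its factors. -/

section

section

open TensorProduct

variable {p : ℕ} [hp : Fact p.Prime] {k : Type u} [Field k] [CharP k p]

namespace FrobeniusLifting

variable [PerfectField k] {Z : Scheme.{u}} {f : Z ⟶ Spec (.of k)} (L : FrobeniusLifting p f)

/-- The Witt vectors over an open of the special fibre which come from the lifting. -/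
noncomputable def wittSubring (U : Z.Opens) : Subring (W2 p Γ(Z, U)) where
  carrier := {w | ∀ (W : L.scheme.Opens) (hW : IsAffineOpen W) (e : L.incl ⁻¹ᵁ W ≤ U),
    W2.map (res e) w ∈ L.frobSubring hW}
  zero_mem' W hW e := by rw [map_zero]; exact zero_mem _
  one_mem' W hW e := by rw [map_one]; exact one_mem _
  add_mem' h h' W hW e := by rw [map_add]; exact add_mem (h W hW e) (h' W hW e)
  mul_mem' h h' W hW e := by rw [map_mul]; exact mul_mem (h W hW e) (h' W hW e)
  neg_mem' h W hW e := by rw [map_neg]; exact neg_mem (h W hW e)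

theorem map_mem_wittSubring {U V : Z.Opens} (h : V ≤ U) {w : W2 p Γ(Z, U)}
    (hw : w ∈ L.wittSubring U) : W2.map (res h) w ∈ L.wittSubring V := fun W hW e => by
  rw [W2.map_map, res_comp_res]
  exact hw W hW (e.trans h)

theorem wittSubring_preimage {W : L.scheme.Opens} (hW : IsAffineOpen W) :
    L.wittSubring (L.incl ⁻¹ᵁ W) = L.frobSubring hW := by
  ext w
  constructor
  · intro h
    have h1 := h W hW le_rfl
    have h2 : res (le_refl (L.incl ⁻¹ᵁ W)) = RingHom.id _ := RingHom.ext fun s => res_self _ s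
    rwa [h2, W2.map_id] at h1
  · intro h W' hW' e
    exact L.map_mem_frobSubring hW hW' (L.preimage_injective e) h

theorem isFrobSubring_wittSubring {U : Z.Opens} (hU : IsAffineOpen U) :
    IsFrobSubring p (L.wittSubring U) := by
  obtain ⟨W, hW, rfl⟩ := L.exists_isAffineOpen_preimage_eq hU
  rw [L.wittSubring_preimage hW]
  exact L.isFrobSubring_frobSubring hW

theorem mem_wittSubring_of_locally [IsReduced Z] {U : Z.Opens} {w : W2 p Γ(Z, U)}
    (h : ∀ z ∈ U, ∃ (V : Z.Opens) (e : V ≤ U), z ∈ V ∧ W2.map (res e) w ∈ L.wittSubring V) :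
    w ∈ L.wittSubring U := by
  intro W hW e
  refine L.mem_frobSubring_of_locally hW fun x hx => ?_
  obtain ⟨z, rfl⟩ := L.incl.surjective x
  obtain ⟨V, hVU, hzV, hV⟩ := h z (e hx)
  obtain ⟨O, rfl⟩ := L.exists_preimage_eq V
  obtain ⟨W', hW', e', hxW'⟩ := exists_isAffineOpen_le (U := W ⊓ O) (x := L.incl z) ⟨hx, hzV⟩
  refine ⟨W', hW', e'.trans inf_le_left, hxW', ?_⟩
  have h1 := hV W' hW' (Scheme.Hom.preimage_mono L.incl (e'.trans inf_le_right))
  rw [W2.map_map, res_comp_res] at h1 ⊢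
  exact h1

end FrobeniusLifting

section TensorProduct

variable {A B C : Type u} [CommRing A] [CommRing B] [CommRing C] [Algebra k A] [Algebra k B]

/-- The map from a tensor product given by two ring homomorphisms agreeing on the base. -/
noncomputable def tensorHom (i : A →+* C) (j : B →+* C)
    (hij : i.comp (algebraMap k A) = j.comp (algebraMap k B)) : A ⊗[k] B →+* C :=
  let := (i.comp (algebraMap k A)).toAlgebra
  (Algebra.TensorProduct.productMap (⟨i, fun _ => rfl⟩ : A →ₐ[k] C)
    (⟨j, fun r => (congrArg (fun φ => φ r) hij).symm⟩ : B →ₐ[k] C)).toRingHom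

@[simp] theorem tensorHom_tmul (i : A →+* C) (j : B →+* C)
    (hij : i.comp (algebraMap k A) = j.comp (algebraMap k B)) (x : A) (y : B) :
    tensorHom i j hij (x ⊗ₜ y) = i x * j y := by
  let := (i.comp (algebraMap k A)).toAlgebra
  exact Algebra.TensorProduct.productMap_apply_tmul _ _ _ _

theorem ringHom_tensor_ext {φ ψ : A ⊗[k] B →+* C} (h : ∀ x y, φ (x ⊗ₜ y) = ψ (x ⊗ₜ y)) : φ = ψ := by
  refine RingHom.ext fun c => ?_
  induction c with
  | zero => rw [map_zero, map_zero]
  | add x y hx hy => rw [map_add, map_add, hx, hy]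
  | tmul x y => exact h x y

theorem tensorHom_bijective {i : A →+* C} {j : B →+* C}
    (hij : i.comp (algebraMap k A) = j.comp (algebraMap k B))
    (h : IsPushout (CommRingCat.ofHom (algebraMap k A)) (CommRingCat.ofHom (algebraMap k B))
      (CommRingCat.ofHom i) (CommRingCat.ofHom j)) : Function.Bijective (tensorHom i j hij) := by
  let e := IsPushout.isoIsPushout _ _ (CommRingCat.isPushout_tensorProduct k A B) h
  have he : e.hom.hom = tensorHom i j hij := by
    refine ringHom_tensor_ext fun x y => ?_
    have h1 : e.hom.hom (x ⊗ₜ 1) = i x := congrArg (fun f : CommRingCat.of A ⟶ CommRingCat.of C => f.hom x)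
      (IsPushout.inl_isoIsPushout_hom _ _ (CommRingCat.isPushout_tensorProduct k A B) h)
    have h2 : e.hom.hom (1 ⊗ₜ y) = j y := congrArg (fun f : CommRingCat.of B ⟶ CommRingCat.of C => f.hom y)
      (IsPushout.inr_isoIsPushout_hom _ _ (CommRingCat.isPushout_tensorProduct k A B) h)
    have h3 : x ⊗ₜ[k] y = (x ⊗ₜ 1) * (1 ⊗ₜ y) := by
      rw [Algebra.TensorProduct.tmul_mul_tmul, one_mul, mul_one]
    rw [tensorHom_tmul, h3]
    refine (map_mul e.hom.hom _ _).trans ?_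
    rw [h1, h2]
  rw [← he]
  exact ConcreteCategory.bijective_of_isIso e.hom

theorem IsFrobSubring.comap {A C : Type*} [CommRing A] [CommRing C] {R : Subring (W2 p C)}
    (hR : IsFrobSubring p R) {θ : A →+* C} (hθ : Function.Bijective θ) :
    IsFrobSubring p (R.comap (W2.map θ)) where
  surj a := by
    obtain ⟨w, hw, h⟩ := hR.surj (θ a)
    obtain ⟨v, rfl⟩ := W2.map_surjective hθ.2 w
    rw [W2.c0_map] at h
    exact ⟨v, hw, hθ.1 h⟩
  V_mem_iff b := by
    rw [Subring.mem_comap, W2.map_V, hR.V_mem_iff]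
    constructor
    · rintro ⟨c, hc⟩
      obtain ⟨c, rfl⟩ := hθ.2 c
      exact ⟨c, hθ.1 (by rw [hc, map_pow])⟩
    · rintro ⟨c, rfl⟩
      exact ⟨θ c, map_pow _ _ _⟩

end TensorProduct

section Product

variable {X Y : Scheme.{u}} (f : X ⟶ Spec (.of k)) (g : Y ⟶ Spec (.of k))

/-- The product of two opens. -/
noncomputable abbrev prodOpen (U : X.Opens) (V : Y.Opens) : (pullback f g).Opens :=
  pullback.fst f g ⁻¹ᵁ U ⊓ pullback.snd f g ⁻¹ᵁ V

theorem prodOpen_mono {U U' : X.Opens} {V V' : Y.Opens} (hU : U' ≤ U) (hV : V' ≤ V) :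
    prodOpen f g U' V' ≤ prodOpen f g U V :=
  inf_le_inf (Scheme.Hom.preimage_mono _ hU) (Scheme.Hom.preimage_mono _ hV)

theorem isAffineOpen_prodOpen {U : X.Opens} {V : Y.Opens} (hU : IsAffineOpen U)
    (hV : IsAffineOpen V) : IsAffineOpen (prodOpen f g U V) := by
  have : IsAffine U.toScheme := hU
  have : IsAffine V.toScheme := hV
  let q : pullback (U.ι ≫ f) (V.ι ≫ g) ⟶ pullback f g :=
    pullback.map _ _ _ _ U.ι V.ι (𝟙 _) (by simp) (by simp)
  have h1 : IsAffineOpen q.opensRange := isAffineOpen_opensRange q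
  have h2 : q.opensRange = prodOpen f g U V := by
    apply TopologicalSpace.Opens.ext
    change Set.range q = _
    simp [q, Scheme.Pullback.range_map]
  rwa [h2] at h1

/-- The sections over a product of affine opens. -/
theorem isPushout_prodOpen {U : X.Opens} {V : Y.Opens} (hU : IsAffineOpen U)
    (hV : IsAffineOpen V) :
    IsPushout (CommRingCat.ofHom (strSec f U)) (CommRingCat.ofHom (strSec g V))
      (CommRingCat.ofHom (pull (pullback.fst f g) (inf_le_left : prodOpen f g U V ≤ _)))
      (CommRingCat.ofHom (pull (pullback.snd f g) (inf_le_right : prodOpen f g U V ≤ _))) := by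
  have h2 := (isIso_pushoutSection_iff (IsPullback.of_hasPullback f g) (US := ⊤) (UT := V) (UX := U)
    (le_preimage_top g V) (le_preimage_top f U) (UY := prodOpen f g U V) rfl).mp
    (isIso_pushoutSection_of_isAffineOpen (IsPullback.of_hasPullback f g) _ _ rfl
      (isAffineOpen_top _) hV hU)
  refine h2.of_iso (Scheme.ΓSpecIso _) (Iso.refl _) (Iso.refl _) (Iso.refl _) ?_ ?_ ?_ ?_
  · exact (Category.comp_id _).trans (Iso.hom_inv_id_assoc _ _).symm
  · exact (Category.comp_id _).trans (Iso.hom_inv_id_assoc _ _).symm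
  · rw [Iso.refl_hom, Category.comp_id, Iso.refl_hom, Category.id_comp]
    rfl
  · rw [Iso.refl_hom, Category.comp_id, Iso.refl_hom, Category.id_comp]
    rfl

variable [PerfectField k]

/-- A Frobenius lifting of the product induces a Frobenius family on the first factor. -/
theorem exists_frobFamily_left [Nonempty Y] (L : FrobeniusLifting p (prodStr f g)) :
    Nonempty (FrobFamily p X) := by
  obtain ⟨y⟩ := ‹Nonempty Y›
  obtain ⟨V, hV, -, hyV⟩ := exists_isAffineOpen_le (U := ⊤) (x := y) trivial
  have : Nonempty V := ⟨⟨y, hyV⟩⟩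
  have hnt : Nontrivial Γ(Y, V) := inferInstance
  let _ : Algebra k Γ(Y, V) := (strSec g V).toAlgebra
  -- A single `V` and a single functional serve for all `U`, so the retractions commute with
  -- restriction and the descended subrings are compatible.
  obtain ⟨ρ, hρ⟩ : ∃ ρ : Γ(Y, V) →ₗ[k] k, ρ 1 = 1 := by
    obtain ⟨ρ, hρ⟩ := (Algebra.linearMap k Γ(Y, V)).exists_leftInverse_of_injective
      (LinearMap.ker_eq_bot.mpr (FaithfulSMul.algebraMap_injective k Γ(Y, V)))
    refine ⟨ρ, ?_⟩
    have := congrArg (fun l => l 1) hρ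
    simpa using this
  let a : ∀ U : X.Opens, Algebra k Γ(X, U) := fun U => (strSec f U).toAlgebra
  have hA : ∀ U : X.Opens, (p : Γ(X, U)) = 0 := natCast_sections_eq_zero p f
  have hC : ∀ U : X.Opens, (p : Γ(X, U) ⊗[k] Γ(Y, V)) = 0 := fun U => by
    rw [← map_natCast (algebraMap k _), CharP.cast_eq_zero, map_zero]
  have hij : ∀ U : X.Opens,
      (pull (pullback.fst f g) (inf_le_left : prodOpen f g U V ≤ _)).comp (algebraMap k Γ(X, U)) =
      (pull (pullback.snd f g) (inf_le_right : prodOpen f g U V ≤ _)).comp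
        (algebraMap k Γ(Y, V)) := fun U => by
    change RingHom.comp _ (strSec f U) = RingHom.comp _ (strSec g V)
    rw [pull_comp_strSec, pull_comp_strSec, pullback.condition]
  let θ := fun U => tensorHom _ _ (hij U)
  exact ⟨{
    R := fun U => (tensorRetraction ρ hρ (hA U)).descend (hA U) (hC U)
      ((L.wittSubring (prodOpen f g U V)).comap (W2.map (θ U)))
    isFrobSubring := fun {U} hU => by
      refine PthRetraction.isFrobSubring_descend _ _ _ (IsFrobSubring.comap
        (L.isFrobSubring_wittSubring (isAffineOpen_prodOpen f g hU hV)) ?_)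
      exact tensorHom_bijective (hij U) (isPushout_prodOpen f g hU hV)
    map_mem := fun {U U'} hU hU' h w hw => by
      let φ : Γ(X, U) →ₐ[k] Γ(X, U') := ⟨res h, fun c =>
        congrArg (fun f => f c) (res_comp_strSec f h)⟩
      refine PthRetraction.map_mem_descend (hA U) (hC U) (tensorRetraction ρ hρ (hA U)) (hA U')
        (hC U') (tensorRetraction ρ hρ (hA U')) (res h)
        (Algebra.TensorProduct.map φ (AlgHom.id k _)).toRingHom (fun x => ?_) (fun c => ?_)
        (fun v hv => ?_) hw
      · change Algebra.TensorProduct.map φ (AlgHom.id k _) (x ⊗ₜ 1) = (res h x) ⊗ₜ 1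
        rw [Algebra.TensorProduct.map_tmul, map_one]
        rfl
      · induction c with
        | zero => simp only [map_zero]
        | add x y hx hy => simp only [map_add, hx, hy]
        | tmul x y =>
          change TensorProduct.rid k _ (ρ.lTensor _ ((φ x) ⊗ₜ y)) =
            φ (TensorProduct.rid k _ (ρ.lTensor _ (x ⊗ₜ y)))
          rw [LinearMap.lTensor_tmul, LinearMap.lTensor_tmul, TensorProduct.rid_tmul,
            TensorProduct.rid_tmul, map_smul]
      · rw [Subring.mem_comap] at hv ⊢
        have h1 := L.map_mem_wittSubring (prodOpen_mono f g h (le_refl V)) hv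
        rw [W2.map_map] at h1 ⊢
        convert h1 using 3
        refine ringHom_tensor_ext fun x y => ?_
        change tensorHom _ _ (hij U') ((res h x) ⊗ₜ y) = res _ (tensorHom _ _ (hij U) (x ⊗ₜ y))
        rw [tensorHom_tmul, tensorHom_tmul, map_mul, ← RingHom.comp_apply, ← RingHom.comp_apply,
          ← RingHom.comp_apply, res_pull, res_pull, pull_res] }⟩

end Product

end

end

/-! ### Global functions on smooth, proper, geometrically connected schemes. -/

section

section

open TensorProduct

variable {k : Type u} [Field k] {X Y : Scheme.{u}}

theorem smooth_strSec (f : X ⟶ Spec (.of k)) [Smooth f] {U : X.Opens} (hU : IsAffineOpen U) :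
    (strSec f U).Smooth := by
  have h : Smooth (Spec.map (CommRingCat.ofHom (strSec f U))) := by
    rw [specMap_strSec f hU]
    infer_instance
  exact (HasRingHomProperty.Spec_iff (P := @Smooth)).mp h

theorem isReduced_of_smooth_hom (f : X ⟶ Spec (.of k)) [Smooth f] : IsReduced X := by
  refine ⟨fun U => ⟨fun s hs => section_ext fun x hx => ?_⟩⟩
  obtain ⟨V, hV, e, hxV⟩ := exists_isAffineOpen_le hx
  refine ⟨V, e, hxV, ?_⟩
  algebraize [strSec f V]
  have h1 : Algebra.Smooth k Γ(X, V) := smooth_strSec f hV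
  have := isReduced_of_smooth k (A := Γ(X, V))
  rw [map_zero]
  exact (hs.map (res e)).eq_zero

theorem isIntegralElem_strSec (g : Y ⟶ Spec (.of k)) [UniversallyClosed g] (a : Γ(Y, ⊤)) :
    (strSec g ⊤).IsIntegralElem a := by
  obtain ⟨q, hq, h⟩ := isIntegral_appTop_of_universallyClosed g a
  refine ⟨q.map (Scheme.ΓSpecIso (.of k)).hom.hom, hq.map _, ?_⟩
  rw [Polynomial.eval₂_map, ← h]
  congr 1
  rw [strSec_eq g ⊤ (le_preimage_top _ _), RingHom.comp_assoc, ← CommRingCat.hom_comp,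
    Iso.hom_inv_id]
  refine (RingHom.comp_id _).trans ?_
  exact congrArg CommRingCat.Hom.hom (Scheme.Hom.app_eq_appLE g).symm

/-- A global function on a connected reduced scheme over an algebraically closed field satisfying
a monic equation over the field is constant. -/
theorem exists_eq_strSec_of_isIntegralElem [IsAlgClosed k] (g : Y ⟶ Spec (.of k)) [ConnectedSpace Y]
    [IsReduced Y] {a : Γ(Y, ⊤)} (ha : (strSec g ⊤).IsIntegralElem a) :
    ∃ c : k, a = strSec g ⊤ c := by
  obtain ⟨q, hq, h⟩ := ha
  have hroots := (IsAlgClosed.splits q).eq_prod_roots_of_monic hq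
  rw [hroots, Polynomial.eval₂_multiset_prod, Multiset.map_map] at h
  -- The product of the `a - c` over the roots is zero, so some factor is not a unit at `x`. Only
  -- one value `c` can occur at a given point, as differences of distinct constants are units.
  have hex : ∀ x : Y, ∃ c ∈ q.roots, x ∉ Y.basicOpen (a - strSec g ⊤ c) := by
    intro x
    by_contra! hx
    have h1 : IsUnit (Y.presheaf.germ ⊤ x trivial
        ((q.roots.map ((Polynomial.eval₂ (strSec g ⊤) a) ∘ fun a => Polynomial.X - Polynomial.C a)).prod)) := by
      rw [map_multiset_prod, Multiset.map_map]
      refine Multiset.prod_induction IsUnit _ (fun _ _ => IsUnit.mul) isUnit_one fun s hs => ?_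
      obtain ⟨c, hc, rfl⟩ := Multiset.mem_map.mp hs
      have := (Y.mem_basicOpen (a - strSec g ⊤ c) x trivial).mp (hx c hc)
      simpa using this
    rw [h, map_zero] at h1
    exact not_isUnit_zero h1
  have huniq : ∀ (x : Y) (c d : k), x ∉ Y.basicOpen (a - strSec g ⊤ c) →
      x ∉ Y.basicOpen (a - strSec g ⊤ d) → c = d := by
    intro x c d hc hd
    by_contra hcd
    rw [Y.mem_basicOpen (U := ⊤) _ x trivial] at hc hd
    have h1 : IsUnit (Y.presheaf.germ ⊤ x trivial (strSec g ⊤ (d - c))) :=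
      ((sub_ne_zero.mpr (Ne.symm hcd)).isUnit.map (strSec g ⊤)).map _
    have h2 : strSec g ⊤ (d - c) = (a - strSec g ⊤ c) - (a - strSec g ⊤ d) := by
      rw [map_sub]; ring
    rw [h2, map_sub, sub_eq_add_neg] at h1
    rcases IsLocalRing.isUnit_or_isUnit_of_isUnit_add h1 with h3 | h3
    · exact hc h3
    · exact hd ((IsUnit.neg_iff _).mp h3)
  obtain ⟨y⟩ : Nonempty Y := inferInstance
  obtain ⟨c, -, hyc⟩ := hex y
  -- The locus where `a - c` is invertible is the finite union, over the other roots, of the closed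
  -- loci where those roots are the value of `a`.
  have hclopen : IsClopen (Y.basicOpen (a - strSec g ⊤ c) : Set Y) := by
    refine ⟨?_, (Y.basicOpen _).2⟩
    have : (Y.basicOpen (a - strSec g ⊤ c) : Set Y) =
        ⋃ d ∈ {d | d ∈ q.roots ∧ d ≠ c}, ((Y.basicOpen (a - strSec g ⊤ d) : Set Y)ᶜ) := by
      ext x
      simp only [Set.mem_iUnion, Set.mem_ofPred_eq, Set.mem_compl_iff, SetLike.mem_coe]
      constructor
      · intro hx
        obtain ⟨d, hd, hxd⟩ := hex x
        exact ⟨d, ⟨hd, by rintro rfl; exact hxd hx⟩, hxd⟩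
      · rintro ⟨d, ⟨-, hdc⟩, hxd⟩
        by_contra hx
        exact hdc (huniq x d c hxd hx)
    rw [this]
    refine Set.Finite.isClosed_biUnion ((Multiset.finite_toSet q.roots).subset fun d hd => hd.1)
      fun d _ => (Y.basicOpen _).2.isClosed_compl
  rcases isClopen_iff.mp hclopen with h1 | h1
  · refine ⟨c, sub_eq_zero.mp ((basicOpen_eq_bot_iff _).mp ?_)⟩
    exact TopologicalSpace.Opens.ext h1
  · exact absurd (h1 ▸ Set.mem_univ y : y ∈ (Y.basicOpen (a - strSec g ⊤ c) : Set Y)) hyc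

/-- The global functions on a smooth, proper and geometrically connected scheme are constant. -/
theorem exists_eq_strSec (g : Y ⟶ Spec (.of k)) [Smooth g] [IsProper g]
    [GeometricallyConnected g] (b : ∀ V : Y.Opens, IsAffineOpen V → Γ(Y, V))
    (hb : ∀ V V' (hV : IsAffineOpen V) (hV' : IsAffineOpen V') (e : V' ≤ V),
      res e (b V hV) = b V' hV') :
    ∃ n : k, ∀ V hV, b V hV = strSec g V n := by
  obtain ⟨a, ha⟩ := exists_section_glue (U := (⊤ : Y.Opens)) IsAffineOpen
    (fun V _ x hx => exists_isAffineOpen_le hx) (fun V hV _ => b V hV)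
    (fun V V' hV hV' _ h => hb V V' hV hV' h)
  let K := AlgebraicClosure k
  let s : Spec (.of K) ⟶ Spec (.of k) := Spec.map (CommRingCat.ofHom (algebraMap k K))
  have : ConnectedSpace (pullback g s : Scheme.{u}) :=
    GeometricallyConnected.geometrically_connectedSpace s _ _ (IsPullback.of_hasPullback g s)
  have := isReduced_of_smooth_hom (pullback.snd g s)
  obtain ⟨c, hc⟩ := exists_eq_strSec_of_isIntegralElem (pullback.snd g s)
    (isIntegralElem_strSec (pullback.snd g s) (pull (pullback.fst g s) (le_preimage_top _ _) a))
  let B : CommRingCat := Γ(Spec (.of K), ⊤)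
  let _ : Algebra k B := (strSec s ⊤).toAlgebra
  have : Nontrivial B := (Scheme.ΓSpecIso (.of K)).hom.hom.domain_nontrivial
  obtain ⟨ρ, hρ⟩ : ∃ ρ : B →ₗ[k] k, ρ 1 = 1 := by
    obtain ⟨ρ, hρ⟩ := (Algebra.linearMap k B).exists_leftInverse_of_injective
      (LinearMap.ker_eq_bot.mpr (FaithfulSMul.algebraMap_injective k B))
    refine ⟨ρ, ?_⟩
    have := congrArg (fun l => l 1) hρ
    simpa using this
  let c' : B := (Scheme.ΓSpecIso (.of K)).inv.hom c
  refine ⟨ρ c', fun V hV => ?_⟩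
  let _ : Algebra k Γ(Y, V) := (strSec g V).toAlgebra
  have hij : (pull (pullback.fst g s) (inf_le_left : prodOpen g s V ⊤ ≤ _)).comp
        (algebraMap k Γ(Y, V)) =
      (pull (pullback.snd g s) (inf_le_right : prodOpen g s V ⊤ ≤ _)).comp (algebraMap k B) := by
    change RingHom.comp _ (strSec g V) = RingHom.comp _ (strSec s ⊤)
    rw [pull_comp_strSec, pull_comp_strSec, pullback.condition]
  have hbij := tensorHom_bijective hij (isPushout_prodOpen g s hV (isAffineOpen_top _))
  -- After base change to the algebraic closure the function is a constant `c'`; applying `ρ` to the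
  -- second factor brings the constant back to `k`.
  have key : b V hV ⊗ₜ[k] (1 : B) = 1 ⊗ₜ c' := by
    apply hbij.1
    rw [tensorHom_tmul, tensorHom_tmul, map_one, map_one, mul_one, one_mul, ← ha V hV le_top,
      ← RingHom.comp_apply, pull_res]
    have h1 := congrArg (res (le_top : prodOpen g s V ⊤ ≤ ⊤)) hc
    rw [← RingHom.comp_apply, res_pull, ← RingHom.comp_apply (res _), res_comp_strSec] at h1
    exact h1
  have h2 := congrArg (fun t => TensorProduct.rid k _ (ρ.lTensor Γ(Y, V) t)) key
  simp only [LinearMap.lTensor_tmul, TensorProduct.rid_tmul, hρ, one_smul] at h2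
  rw [h2, Algebra.smul_def, mul_one]
  rfl

end

end

/-! ### Global sections modulo `p`-th powers vanish on smooth proper schemes with a Frobenius
family. -/

section

section

variable {p : ℕ} [hp : Fact p.Prime] {k : Type u} [Field k] [CharP k p] [PerfectField k]

theorem W2.wittDer_map_mem {A K : Type u} [CommRing A] [Algebra k A] [Field K] [Algebra k K] [CharP K p]
    (φ : A →ₐ[k] K) (O : ValuationSubring K) (hO : ∀ a, φ a ∈ O) {M : Submodule O Ω[K⁄k]}
    (hM : ∀ a, KaehlerDifferential.D k K (φ a) ∈ M) (w : W2 p A) :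
    wittDer (KaehlerDifferential.D k K) (W2.map φ.toRingHom w) ∈ M := by
  unfold wittDer
  rw [W2.c0_map, W2.map_coeff]
  refine add_mem ?_ (hM (w.coeff 1))
  let o : O := ⟨φ (W2.c0 w), hO _⟩
  exact M.smul_mem (o ^ (p - 1)) (hM (W2.c0 w))

/-- An element of a field with a Frobenius subring is a `p`-th power if modulo `p`-th powers it
lies, at every valuation ring over `k`, in a compatible subalgebra of finite type. -/
theorem exists_eq_pow_of_forall_valuationSubring {K : Type u} [Field K] [Algebra k K] [CharP K p]
    {R : Subring (W2 p K)} (hR : IsFrobSubring p R) (t : K)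
    (h : ∀ O : ValuationSubring K, (∀ c, algebraMap k K c ∈ O) →
      ∃ (A : Type u) (_ : CommRing A) (_ : Algebra k A) (φ : A →ₐ[k] K), Algebra.FiniteType k A ∧
        (∀ a, φ a ∈ O) ∧ (∀ a, ∃ w : W2 p A, W2.c0 w = a ∧ W2.map φ.toRingHom w ∈ R) ∧
        ∃ a s, t = φ a + s ^ p) :
    ∃ s, t = s ^ p := by
  have hpK : (p : K) = 0 := CharP.cast_eq_zero K p
  obtain ⟨ζ, hζ⟩ := exists_frobSemilinear p k hR
  let d := KaehlerDifferential.D k K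
  refine exists_eq_pow_of_D_eq_zero p (k := k) (D_eq_zero_of_forall_valuationSubring d ζ
    (fun η h => eq_zero_of_frobSemilinear_eq_D hR hζ) t fun O hO => ?_)
  obtain ⟨A, _, _, φ, ⟨⟨S, hS⟩⟩, hφ, hw, a, s, rfl⟩ := h O hO
  -- Finite type makes `M` finitely generated. It is `ζ`-stable because `ζ(dw₀) = w₀ ^ (p - 1) dw₀ +
  -- dw₁` with both components of `w` in `A`.
  let M : Submodule O Ω[K⁄k] := Submodule.span O ((fun a => d (φ a)) '' S)
  have hM : ∀ a, d (φ a) ∈ M := fun a => by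
    have ha : a ∈ Algebra.adjoin k (S : Set A) := hS ▸ Algebra.mem_top
    induction ha using Algebra.adjoin_induction with
    | mem x hx => exact Submodule.subset_span ⟨x, hx, rfl⟩
    | algebraMap r =>
      rw [φ.commutes, d.map_algebraMap]
      exact zero_mem _
    | add x y _ _ hx hy =>
      rw [map_add, map_add]
      exact add_mem hx hy
    | mul x y _ _ hx hy =>
      rw [map_mul, Derivation.leibniz]
      exact add_mem (M.smul_mem ⟨φ x, hφ x⟩ hy) (M.smul_mem ⟨φ y, hφ y⟩ hx)
  refine ⟨M, Submodule.fg_span (S.finite_toSet.image _), fun x hx => ?_, ?_⟩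
  · induction hx using Submodule.span_induction with
    | mem x hx =>
      obtain ⟨b, -, rfl⟩ := hx
      obtain ⟨w, rfl, hwR⟩ := hw b
      have h1 := hζ _ hwR
      rw [W2.c0_map] at h1
      change ζ (d (φ.toRingHom (W2.c0 w))) ∈ M
      rw [h1]
      exact W2.wittDer_map_mem φ O hφ hM w
    | zero => rw [map_zero]; exact zero_mem _
    | add x y _ _ hx hy => rw [map_add]; exact add_mem hx hy
    | smul c x _ hx =>
      change ζ ((c : K) • x) ∈ M
      rw [map_smulₛₗ]
      exact M.smul_mem (c ^ p) hx
  · rw [map_add, map_pow_prime_eq_zero d hpK, add_zero]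
    exact hM a

end

section

variable {p : ℕ} [hp : Fact p.Prime] {Y : Scheme.{u}}

/-- Evaluation at a point, as a ring homomorphism. -/
noncomputable def evalAt {y : Y} {V : Y.Opens} (hy : y ∈ V) : Γ(Y, V) →+* Y.residueField y :=
  (Y.evaluation V y hy).hom

theorem evalAt_comp_res {y : Y} {V V' : Y.Opens} (hy : y ∈ V') (h : V' ≤ V) :
    (evalAt hy).comp (res h) = evalAt (h hy) := by
  refine RingHom.ext fun s => ?_
  exact congrArg (Y.residue y).hom (Y.presheaf.germ_res_apply (homOfLE h) y hy s)

theorem specMap_evalAt_fromSpec {y : Y} {V : Y.Opens} (hV : IsAffineOpen V) (hy : y ∈ V) :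
    Spec.map (CommRingCat.ofHom (evalAt hy)) ≫ hV.fromSpec = Y.fromSpecResidueField y := by
  change Spec.map (Y.presheaf.germ V y hy ≫ Y.residue y) ≫ hV.fromSpec = _
  rw [Spec.map_comp, Category.assoc]
  unfold Scheme.fromSpecResidueField
  rw [← hV.fromSpecStalk_eq_fromSpecStalk hy]
  rfl

theorem exists_evalAt_eq {y : Y} (s : Y.residueField y) :
    ∃ (V : Y.Opens) (_ : IsAffineOpen V) (hy : y ∈ V) (a : Γ(Y, V)), evalAt hy a = s := by
  obtain ⟨s, rfl⟩ := Y.residue_surjective y s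
  obtain ⟨U, hyU, a, rfl⟩ := Y.presheaf.exists_germ_eq s
  obtain ⟨V, hV, e, hyV⟩ := exists_isAffineOpen_le hyU
  refine ⟨V, hV, hyV, res e a, ?_⟩
  rw [← RingHom.comp_apply, evalAt_comp_res]
  rfl

theorem exists_res_eq_zero {y : Y} (hfield : IsField (Y.presheaf.stalk y)) {V : Y.Opens}
    (hy : y ∈ V) {a : Γ(Y, V)} (ha : evalAt hy a = 0) :
    ∃ (V' : Y.Opens) (_ : IsAffineOpen V') (e : V' ≤ V), y ∈ V' ∧ res e a = 0 := by
  have h1 : Y.presheaf.germ V y hy a = 0 := by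
    have h2 : Y.presheaf.germ V y hy a ∈ IsLocalRing.maximalIdeal _ :=
      (IsLocalRing.residue_eq_zero_iff _).mp ha
    rwa [IsLocalRing.isField_iff_maximalIdeal_eq.mp hfield] at h2
  obtain ⟨W, hyW, i, j, h⟩ := Y.presheaf.germ_eq y hy hy a 0 (by rw [h1, map_zero])
  obtain ⟨V', hV', e, hyV'⟩ := exists_isAffineOpen_le hyW
  refine ⟨V', hV', e.trans i.le, hyV', ?_⟩
  rw [← res_res i.le e]
  have h2 : res i.le a = 0 := h.trans (map_zero _)
  rw [h2, map_zero]

/-- The Witt vectors of a residue field coming from a Frobenius family. -/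
noncomputable def FrobFamily.residueSubring (Φ : FrobFamily p Y) (y : Y) :
    Subring (W2 p (Y.residueField y)) where
  carrier := {w | ∃ (V : Y.Opens) (_ : IsAffineOpen V) (hy : y ∈ V), ∃ v ∈ Φ.R V, W2.map (evalAt hy) v = w}
  zero_mem' := by
    obtain ⟨V, hV, -, hy⟩ := exists_isAffineOpen_le (U := ⊤) (x := y) trivial
    exact ⟨V, hV, hy, 0, zero_mem _, map_zero _⟩
  one_mem' := by
    obtain ⟨V, hV, -, hy⟩ := exists_isAffineOpen_le (U := ⊤) (x := y) trivial
    exact ⟨V, hV, hy, 1, one_mem _, map_one _⟩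
  add_mem' := by
    rintro _ _ ⟨V, hV, hy, v, hv, rfl⟩ ⟨V', hV', hy', v', hv', rfl⟩
    obtain ⟨T, hT, e, hyT⟩ := exists_isAffineOpen_le (U := V ⊓ V') ⟨hy, hy'⟩
    refine ⟨T, hT, hyT, _, add_mem (Φ.map_mem hV hT (e.trans inf_le_left) hv)
      (Φ.map_mem hV' hT (e.trans inf_le_right) hv'), ?_⟩
    rw [map_add, W2.map_map, W2.map_map, evalAt_comp_res, evalAt_comp_res]
  mul_mem' := by
    rintro _ _ ⟨V, hV, hy, v, hv, rfl⟩ ⟨V', hV', hy', v', hv', rfl⟩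
    obtain ⟨T, hT, e, hyT⟩ := exists_isAffineOpen_le (U := V ⊓ V') ⟨hy, hy'⟩
    refine ⟨T, hT, hyT, _, mul_mem (Φ.map_mem hV hT (e.trans inf_le_left) hv)
      (Φ.map_mem hV' hT (e.trans inf_le_right) hv'), ?_⟩
    rw [map_mul, W2.map_map, W2.map_map, evalAt_comp_res, evalAt_comp_res]
  neg_mem' := by
    rintro _ ⟨V, hV, hy, v, hv, rfl⟩
    exact ⟨V, hV, hy, -v, neg_mem hv, map_neg _ _⟩

/-- Where the local ring is a field, a section with zero value vanishes near the point, so the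
condition on `V` is inherited from a small affine open. -/
theorem FrobFamily.isFrobSubring_residueSubring (Φ : FrobFamily p Y) {y : Y}
    (hfield : IsField (Y.presheaf.stalk y)) : IsFrobSubring p (Φ.residueSubring y) where
  surj s := by
    obtain ⟨V, hV, hy, a, rfl⟩ := exists_evalAt_eq s
    obtain ⟨v, hv, rfl⟩ := (Φ.isFrobSubring hV).surj a
    exact ⟨_, ⟨V, hV, hy, v, hv, rfl⟩, W2.c0_map _ _⟩
  V_mem_iff b := by
    constructor
    · rintro ⟨V, hV, hy, v, hv, h⟩
      have h0 : evalAt hy (W2.c0 v) = 0 := by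
        rw [← W2.c0_map, h, W2.c0_V]
      obtain ⟨T, hT, e, hyT, hz⟩ := exists_res_eq_zero hfield hy h0
      rw [← W2.c0_map] at hz
      have h1 := Φ.map_mem hV hT e hv
      rw [W2.eq_V_of_c0_eq_zero hz] at h1
      obtain ⟨c, hc⟩ := ((Φ.isFrobSubring hT).V_mem_iff _).mp h1
      refine ⟨evalAt hyT c, ?_⟩
      rw [← map_pow, ← hc, ← W2.map_coeff, W2.map_map, evalAt_comp_res, h, W2.coeff_one_V]
    · rintro ⟨c, rfl⟩
      obtain ⟨V, hV, hy, a, rfl⟩ := exists_evalAt_eq c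
      refine ⟨V, hV, hy, W2.V (a ^ p), ((Φ.isFrobSubring hV).V_mem_iff _).mpr ⟨a, rfl⟩, ?_⟩
      rw [W2.map_V, map_pow]

end

section

variable {p : ℕ} [hp : Fact p.Prime] {k : Type u} [Field k] {Y : Scheme.{u}} (g : Y ⟶ Spec (.of k))

theorem evalAt_comp_strSec {y : Y} {V V' : Y.Opens} (hy : y ∈ V) (hy' : y ∈ V') :
    (evalAt hy).comp (strSec g V) = (evalAt hy').comp (strSec g V') := by
  have h : ∀ {T : Y.Opens} (hT : y ∈ T), (evalAt hT).comp (strSec g T) =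
      (evalAt (V := ⊤) trivial).comp (strSec g ⊤) := fun {T} hT => by
    rw [← res_comp_strSec g (le_top : T ≤ ⊤), ← RingHom.comp_assoc, evalAt_comp_res]
  rw [h, h]

/-- Every valuation ring of a residue field containing the base field is centred on an affine
open. -/
theorem exists_evalAt_mem [UniversallyClosed g] {y : Y} (O : ValuationSubring (Y.residueField y))
    (hO : ∀ {V : Y.Opens} (hy : y ∈ V) (c : k), evalAt hy (strSec g V c) ∈ O) :
    ∃ (V : Y.Opens) (_ : IsAffineOpen V) (hy : y ∈ V), ∀ a, evalAt hy a ∈ O := by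
  let κ := Y.residueField y
  obtain ⟨V₀, hV₀, -, hy₀⟩ := exists_isAffineOpen_le (U := ⊤) (x := y) trivial
  let ψ : k →+* O := ((evalAt hy₀).comp (strSec g V₀)).codRestrict O.toSubring fun c => hO hy₀ c
  have w : Y.fromSpecResidueField y ≫ g = Spec.map (CommRingCat.ofHom (algebraMap O κ)) ≫
      Spec.map (CommRingCat.ofHom ψ) := by
    rw [← specMap_evalAt_fromSpec hV₀ hy₀, Category.assoc, ← specMap_strSec g hV₀, ← Spec.map_comp,
      ← Spec.map_comp]
    rfl
  have hval : ValuativeCriterion.Existence g :=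
    (UniversallyClosed.eq_valuativeCriterion ▸ (inferInstance : UniversallyClosed g) :
      (ValuativeCriterion.Existence ⊓ @QuasiCompact) g).1
  -- The valuative criterion extends the point to `Spec O`; an affine open containing the image of
  -- the closed point contains the whole image.
  obtain ⟨l, hl₁, -⟩ := (hval { R := O, K := κ, commSq := ⟨w⟩, .. }).exists_lift
  dsimp only at hl₁
  obtain ⟨V, hV, -, hlV⟩ := exists_isAffineOpen_le (U := ⊤)
    (x := l (IsLocalRing.closedPoint O)) trivial
  have htop : l ⁻¹ᵁ V = ⊤ := Scheme.preimage_eq_top_of_closedPoint_mem l hlV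
  have hy : y ∈ V := by
    have h1 := Y.fromSpecResidueField_apply y (IsLocalRing.closedPoint κ)
    rw [← hl₁] at h1
    rw [← h1]
    have : Spec.map (CommRingCat.ofHom (algebraMap O κ)) (IsLocalRing.closedPoint κ) ∈ l ⁻¹ᵁ V := by
      rw [htop]; trivial
    exact this
  let φ : Γ(Y, V) →+* O := (Scheme.ΓSpecIso (.of O)).hom.hom.comp (pull l htop.ge)
  have hφ : Spec.map (CommRingCat.ofHom φ) ≫ hV.fromSpec = l := by
    change Spec.map (CommRingCat.ofHom (pull l htop.ge) ≫ (Scheme.ΓSpecIso (.of O)).hom) ≫ _ = _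
    rw [Spec.map_comp, Category.assoc, specMap_pull_fromSpec l hV (isAffineOpen_top _),
      IsAffineOpen.fromSpec_top, Scheme.isoSpec_Spec_inv, ← Spec.map_comp_assoc]
    simp
  have h2 : (algebraMap O κ).comp φ = evalAt hy := by
    have h3 : CommRingCat.ofHom ((algebraMap O κ).comp φ) = CommRingCat.ofHom (evalAt hy) := by
      apply Spec.map_injective
      rw [← cancel_mono hV.fromSpec, specMap_evalAt_fromSpec, CommRingCat.ofHom_comp, Spec.map_comp,
        Category.assoc, hφ, hl₁]
    exact congrArg CommRingCat.Hom.hom h3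
  exact ⟨V, hV, hy, fun a => by rw [← h2]; exact (φ a).2⟩

variable [CharP k p] [PerfectField k]

/-- On a smooth proper scheme with a Frobenius family, a local section up to `p`-th powers which
is globally well-defined is a `p`-th power. -/
theorem exists_eq_pow_of_frobFamily [Smooth g] [IsProper g] (Φ : FrobFamily p Y)
    (b : ∀ V : Y.Opens, IsAffineOpen V → Γ(Y, V))
    (hb : ∀ V V' (hV : IsAffineOpen V) (hV' : IsAffineOpen V') (e : V' ≤ V),
      ∃ c, res e (b V hV) = b V' hV' + c ^ p)
    (V : Y.Opens) (hV : IsAffineOpen V) : ∃ c, b V hV = c ^ p := by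
  algebraize [strSec g V]
  have hsm : Algebra.Smooth k Γ(Y, V) := smooth_strSec g hV
  -- It remains to treat points whose local ring is a field, hence equal to the residue field.
  refine exists_eq_pow_of_smooth k p (natCast_sections_eq_zero p g V) fun q _ F _ _ _ hF => ?_
  let y : Y := hV.fromSpec ⟨q, inferInstance⟩
  have hy : y ∈ V := by
    rw [← SetLike.mem_coe, ← hV.range_fromSpec]
    exact ⟨_, rfl⟩
  let _ : Algebra Γ(Y, V) (Y.presheaf.stalk y) := (Y.presheaf.germ V y hy).hom.toAlgebra
  have hloc : IsLocalization.AtPrime (Y.presheaf.stalk y) q := hV.isLocalization_stalk' _ hy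
  let e := IsLocalization.algEquiv q.primeCompl (Y.presheaf.stalk y) F
  have hfield : IsField (Y.presheaf.stalk y) := e.toMulEquiv.isField hF
  let _ : Algebra k (Y.residueField y) := ((evalAt hy).comp (strSec g V)).toAlgebra
  have hchar : CharP (Y.residueField y) p := charP_of_injective_algebraMap (algebraMap k _).injective p
  obtain ⟨s, hs⟩ := exists_eq_pow_of_forall_valuationSubring (k := k)
    (Φ.isFrobSubring_residueSubring hfield) (evalAt hy (b V hV)) fun O hO => by
      obtain ⟨T, hT, hyT, hTO⟩ := exists_evalAt_mem g O (fun {V'} hy' c => by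
        have := hO c
        rw [← RingHom.comp_apply, evalAt_comp_strSec g hy' hy]
        exact this)
      let _ : Algebra k Γ(Y, T) := (strSec g T).toAlgebra
      have hsmT : Algebra.Smooth k Γ(Y, T) := smooth_strSec g hT
      refine ⟨Γ(Y, T), inferInstance, inferInstance, ⟨evalAt hyT, fun c => ?_⟩, inferInstance, hTO,
        fun a => ?_, b T hT, ?_⟩
      · exact congrArg (fun f => f c) (evalAt_comp_strSec g hyT hy)
      · obtain ⟨w, hw, rfl⟩ := (Φ.isFrobSubring hT).surj a
        exact ⟨w, rfl, T, hT, hyT, w, hw, rfl⟩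
      -- The sections over `V` and over the open `T` centring `O` both compare with one over a
      -- smaller `W`, so their values at `y` differ by a `p`-th power.
      · obtain ⟨W, hW, eW, hyW⟩ := exists_isAffineOpen_le (U := V ⊓ T) ⟨hy, hyT⟩
        obtain ⟨c, hc⟩ := hb V W hV hW (eW.trans inf_le_left)
        obtain ⟨d, hd⟩ := hb T W hT hW (eW.trans inf_le_right)
        obtain ⟨r, hr⟩ := exists_pow_sub_pow_eq p (CharP.cast_eq_zero (Y.residueField y) p)
          (evalAt hyW c) (evalAt hyW d)
        refine ⟨r, ?_⟩
        change _ = evalAt hyT _ + _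
        rw [← evalAt_comp_res hyW (eW.trans inf_le_left), ← evalAt_comp_res hyW (eW.trans inf_le_right),
          RingHom.comp_apply, RingHom.comp_apply, hc, hd, map_add, map_add, map_pow, map_pow, ← hr]
        ring
  obtain ⟨s, rfl⟩ := Y.residue_surjective y s
  refine ⟨e s, ?_⟩
  have h1 : Y.presheaf.germ V y hy (b V hV) = s ^ p := by
    have h2 : Y.presheaf.germ V y hy (b V hV) - s ^ p ∈ IsLocalRing.maximalIdeal _ := by
      rw [← IsLocalRing.residue_eq_zero_iff, map_sub, sub_eq_zero, map_pow]
      exact hs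
    rw [IsLocalRing.isField_iff_maximalIdeal_eq.mp hfield] at h2
    exact sub_eq_zero.mp h2
  rw [← map_pow, ← h1]
  exact (e.commutes _).symm

end

end

/-! ### Lifting the projections, and the product decomposition. -/

section

section

open TensorProduct

variable {p : ℕ} [hp : Fact p.Prime] {k : Type u} [Field k] [CharP k p] [PerfectField k]
  {X Y : Scheme.{u}} (f : X ⟶ Spec (.of k)) (g : Y ⟶ Spec (.of k))

/-- A section over an affine open of the first factor is a `p`-th power if it is one on the
product. -/
theorem exists_eq_pow_of_pull_fst [Nonempty Y] {U : X.Opens} (hU : IsAffineOpen U) (b : Γ(X, U))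
    (h : ∀ V : Y.Opens, IsAffineOpen V →
      ∃ c, pull (pullback.fst f g) (inf_le_left : prodOpen f g U V ≤ _) b = c ^ p) :
    ∃ c, b = c ^ p := by
  obtain ⟨y⟩ := ‹Nonempty Y›
  obtain ⟨V, hV, -, hyV⟩ := exists_isAffineOpen_le (U := ⊤) (x := y) trivial
  have : Nonempty V := ⟨⟨y, hyV⟩⟩
  have hnt : Nontrivial Γ(Y, V) := inferInstance
  let _ : Algebra k Γ(Y, V) := (strSec g V).toAlgebra
  let _ : Algebra k Γ(X, U) := (strSec f U).toAlgebra
  obtain ⟨ρ, hρ⟩ : ∃ ρ : Γ(Y, V) →ₗ[k] k, ρ 1 = 1 := by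
    obtain ⟨ρ, hρ⟩ := (Algebra.linearMap k Γ(Y, V)).exists_leftInverse_of_injective
      (LinearMap.ker_eq_bot.mpr (FaithfulSMul.algebraMap_injective k Γ(Y, V)))
    refine ⟨ρ, ?_⟩
    have := congrArg (fun l => l 1) hρ
    simpa using this
  have hij : (pull (pullback.fst f g) (inf_le_left : prodOpen f g U V ≤ _)).comp (algebraMap k Γ(X, U)) =
      (pull (pullback.snd f g) (inf_le_right : prodOpen f g U V ≤ _)).comp
        (algebraMap k Γ(Y, V)) := by
    change RingHom.comp _ (strSec f U) = RingHom.comp _ (strSec g V)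
    rw [pull_comp_strSec, pull_comp_strSec, pullback.condition]
  have hθ := tensorHom_bijective hij (isPushout_prodOpen f g hU hV)
  obtain ⟨c, hc⟩ := h V hV
  obtain ⟨c, rfl⟩ := hθ.2 c
  have h1 : Algebra.TensorProduct.includeLeftRingHom b * 1 = c ^ p := by
    apply hθ.1
    rw [map_pow, ← hc, mul_one]
    change tensorHom _ _ hij (b ⊗ₜ 1) = _
    rw [tensorHom_tmul, map_one, mul_one]
  let r := tensorRetraction (p := p) ρ hρ (natCast_sections_eq_zero p f U)
  obtain ⟨a, ha⟩ := r.map_pow' c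
  refine ⟨a, ?_⟩
  rw [← ha, ← h1, r.map_mul', r.map_one', mul_one]

/-- Sections over the products of an affine open `U` with the affine opens of `Y`, compatible up
to `p`-th powers, come up to `p`-th powers from `U`. -/
theorem exists_eq_pull_fst_add_pow [Smooth g] [IsProper g] [GeometricallyConnected g]
    (Φ : FrobFamily p Y) {U : X.Opens} (hU : IsAffineOpen U)
    (d : ∀ V : Y.Opens, IsAffineOpen V → Γ(pullback f g, prodOpen f g U V))
    (hd : ∀ V V' (hV : IsAffineOpen V) (hV' : IsAffineOpen V') (e : V' ≤ V),
      ∃ c, res (prodOpen_mono f g le_rfl e) (d V hV) = d V' hV' + c ^ p) :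
    ∃ n : Γ(X, U), ∀ V hV,
      ∃ c, d V hV = pull (pullback.fst f g) (inf_le_left : prodOpen f g U V ≤ _) n + c ^ p := by
  let _ : Algebra k Γ(X, U) := (strSec f U).toAlgebra
  let J := {V : Y.Opens // IsAffineOpen V}
  let a : ∀ V : J, Algebra k Γ(Y, V.1) := fun V => (strSec g V.1).toAlgebra
  have hij : ∀ V : J, (pull (pullback.fst f g) (inf_le_left : prodOpen f g U V.1 ≤ _)).comp
        (algebraMap k Γ(X, U)) =
      (pull (pullback.snd f g) (inf_le_right : prodOpen f g U V.1 ≤ _)).comp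
        (algebraMap k Γ(Y, V.1)) := fun V => by
    change RingHom.comp _ (strSec f U) = RingHom.comp _ (strSec g V.1)
    rw [pull_comp_strSec, pull_comp_strSec, pullback.condition]
  let θ := fun V : J => tensorHom _ _ (hij V)
  have hθ : ∀ V, Function.Bijective (θ V) := fun V =>
    tensorHom_bijective (hij V) (isPushout_prodOpen f g hU V.2)
  let ρ : ∀ V V' : J, V'.1 ≤ V.1 → (Γ(Y, V.1) →ₐ[k] Γ(Y, V'.1)) := fun V V' e =>
    ⟨res e, fun c => congrArg (fun f => f c) (res_comp_strSec g e)⟩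
  have hρθ : ∀ (V V' : J) (e : V'.1 ≤ V.1) (x : Γ(X, U) ⊗[k] Γ(Y, V.1)),
      θ V' (Algebra.TensorProduct.map (AlgHom.id k _) (ρ V V' e) x) =
        res (prodOpen_mono f g le_rfl e) (θ V x) := by
    intro V V' e x
    have : (θ V').comp (Algebra.TensorProduct.map (AlgHom.id k _) (ρ V V' e)).toRingHom =
        (res (prodOpen_mono f g le_rfl e)).comp (θ V) := by
      refine ringHom_tensor_ext fun x y => ?_
      change tensorHom _ _ (hij V') (x ⊗ₜ (res e y)) = res _ (tensorHom _ _ (hij V) (x ⊗ₜ y))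
      rw [tensorHom_tmul, tensorHom_tmul, map_mul, ← RingHom.comp_apply, ← RingHom.comp_apply,
        ← RingHom.comp_apply, res_pull, res_pull, pull_res]
    exact congrArg (fun f => f x) this
  choose d' hd' using fun V : J => (hθ V).2 (d V.1 V.2)
  obtain ⟨n, hn⟩ := exists_eq_tmul_one_add_pow p Γ(X, U) (fun V V' : J => V'.1 ≤ V.1)
    (fun V => Γ(Y, V.1)) ρ
    (fun b hb => by
      obtain ⟨n, hn⟩ := exists_eq_strSec g (fun V hV => b ⟨V, hV⟩)
        (fun V V' hV hV' e => hb ⟨V, hV⟩ ⟨V', hV'⟩ e)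
      exact ⟨n, fun V => hn V.1 V.2⟩)
    (fun b hb V => exists_eq_pow_of_frobFamily g Φ (fun V hV => b ⟨V, hV⟩)
        (fun V V' hV hV' e => hb ⟨V, hV⟩ ⟨V', hV'⟩ e) V.1 V.2)
    d' (fun V V' e => by
      obtain ⟨c, hc⟩ := hd V.1 V'.1 V.2 V'.2 e
      obtain ⟨c, rfl⟩ := (hθ V').2 c
      refine ⟨c, (hθ V').1 ?_⟩
      rw [hρθ, hd', map_add, hd', map_pow, hc])
  refine ⟨n, fun V hV => ?_⟩
  obtain ⟨c, hc⟩ := hn ⟨V, hV⟩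
  refine ⟨θ ⟨V, hV⟩ c, ?_⟩
  rw [← hd' ⟨V, hV⟩, hc, map_add, map_pow]
  change tensorHom _ _ (hij ⟨V, hV⟩) (n ⊗ₜ 1) + _ = _
  rw [tensorHom_tmul, map_one, mul_one]

namespace FrobeniusLifting

variable {f g} (L : FrobeniusLifting p (prodStr f g))

/-- The Witt vectors over an open of the first factor whose pullbacks come from the lifting of
the product. -/
noncomputable def wittSubringLeft (U : X.Opens) : Subring (W2 p Γ(X, U)) :=
  (L.wittSubring (pullback.fst f g ⁻¹ᵁ U)).comap (W2.map (pull (pullback.fst f g) le_rfl))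

theorem mem_wittSubringLeft [IsReduced (pullback f g)] {U : X.Opens} {w : W2 p Γ(X, U)} :
    w ∈ L.wittSubringLeft U ↔ ∀ V : Y.Opens, IsAffineOpen V →
      W2.map (pull (pullback.fst f g) (inf_le_left : prodOpen f g U V ≤ _)) w ∈
        L.wittSubring (prodOpen f g U V) := by
  constructor
  · intro h V _
    have h1 := L.map_mem_wittSubring (inf_le_left : prodOpen f g U V ≤ _) h
    rwa [W2.map_map, res_pull] at h1
  · intro h
    refine L.mem_wittSubring_of_locally fun z hz => ?_
    obtain ⟨V, hV, -, hzV⟩ := exists_isAffineOpen_le (U := ⊤) (x := pullback.snd f g z) trivial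
    refine ⟨prodOpen f g U V, inf_le_left, ⟨hz, hzV⟩, ?_⟩
    rw [W2.map_map, res_pull]
    exact h V hV

/-- Choose lifts of `a` over each `U × V`. Their second components agree up to `p`-th powers, so
they come from some `n` over `U` up to `p`-th powers; the pullback of `(a, n)` then differs from
each lift by some `V (c ^ p)`, which belongs to the subring. -/
theorem isFrobSubring_wittSubringLeft [IsReduced (pullback f g)] [Smooth g] [IsProper g]
    [GeometricallyConnected g] [Nonempty Y] (Φ : FrobFamily p Y) {U : X.Opens}
    (hU : IsAffineOpen U) : IsFrobSubring p (L.wittSubringLeft U) where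
  surj a := by
    have hR := fun (V : Y.Opens) (hV : IsAffineOpen V) =>
      L.isFrobSubring_wittSubring (isAffineOpen_prodOpen f g hU hV)
    choose w hw hwa using fun V hV =>
      (hR V hV).surj (pull (pullback.fst f g) (inf_le_left : prodOpen f g U V ≤ _) a)
    obtain ⟨n, hn⟩ := exists_eq_pull_fst_add_pow f g Φ hU (fun V hV => (w V hV).coeff 1)
      (fun V V' hV hV' e => by
        rw [← W2.map_coeff]
        refine (hR V' hV').exists_coeff_one_sub
          (L.map_mem_wittSubring (prodOpen_mono f g le_rfl e) (hw V hV)) (hw V' hV') ?_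
        rw [W2.c0_map, hwa, hwa, ← RingHom.comp_apply, res_pull])
    refine ⟨W2.mk a n, L.mem_wittSubringLeft.mpr fun V hV => ?_, by simp⟩
    obtain ⟨c, hc⟩ := hn V hV
    have h1 : W2.map (pull (pullback.fst f g) (inf_le_left : prodOpen f g U V ≤ _)) (W2.mk a n) =
        w V hV - W2.V (c ^ p) := by
      rw [eq_sub_iff_add_eq, W2.add_V, ← W2.mk_eta (w V hV), hwa, hc, W2.map_coeff, W2.c0_map]
      simp
    rw [h1]
    exact sub_mem (hw V hV) (((hR V hV).V_mem_iff _).mpr ⟨c, rfl⟩)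
  V_mem_iff b := by
    rw [mem_wittSubringLeft]
    simp only [W2.map_V]
    constructor
    · intro h
      exact exists_eq_pow_of_pull_fst f g hU b fun V hV =>
        ((L.isFrobSubring_wittSubring (isAffineOpen_prodOpen f g hU hV)).V_mem_iff _).mp (h V hV)
    · rintro ⟨c, rfl⟩ V hV
      exact ((L.isFrobSubring_wittSubring (isAffineOpen_prodOpen f g hU hV)).V_mem_iff _).mpr
        ⟨_, map_pow _ _ _⟩

/-- A lifting of the product maps to a lifting of the first factor. -/
theorem exists_hom_left [Smooth f] [Smooth g] [IsProper g] [GeometricallyConnected g] [Nonempty Y]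
    (Φ : FrobFamily p Y) :
    ∃ (LX : FrobeniusLifting p f) (q : L.scheme ⟶ LX.scheme), q ≫ LX.str = L.str ∧
      L.incl ≫ q = pullback.fst f g ≫ LX.incl ∧ L.frob ≫ q = q ≫ LX.frob := by
  have := isReduced_of_smooth_hom f
  have : IsReduced (pullback f g) := isReduced_of_smooth_hom (prodStr f g)
  let Ψ : FrobFamily p X :=
    { R := L.wittSubringLeft
      isFrobSubring := L.isFrobSubring_wittSubringLeft Φ
      map_mem := fun {U V} _ _ h w hw => by
        have h1 := L.map_mem_wittSubring
          (Scheme.Hom.preimage_mono (pullback.fst f g) h) hw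
        rw [W2.map_map, res_pull, ← pull_res _ le_rfl h, ← W2.map_map] at h1
        exact h1 }
  obtain ⟨LX, hLX⟩ := Ψ.exists_lifting_hom f
  refine ⟨LX, hLX _ inferInstance _ L (pullback.fst f g) rfl fun U W hU hW e w hw => ?_⟩
  have h1 : W2.map _ (W2.map _ w) ∈ L.frobSubring hW := hw W hW e
  rwa [W2.map_map, res_pull] at h1

/-- Transport of a Frobenius lifting along an isomorphism. -/
noncomputable def ofIso {Z Z' : Scheme.{u}} {fZ : Z ⟶ Spec (.of k)} (L : FrobeniusLifting p fZ)
    {fZ' : Z' ⟶ Spec (.of k)} (e : Z' ≅ Z) (he : e.hom ≫ fZ = fZ') : FrobeniusLifting p fZ' where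
  scheme := L.scheme
  str := L.str
  flat := L.flat
  incl := e.hom ≫ L.incl
  isPullback := L.isPullback.of_iso e.symm (Iso.refl _) (Iso.refl _) (Iso.refl _) (by simp)
    (by simp [← he]) (by simp) (by simp)
  frob := L.frob
  incl_frob := by
    rw [Category.assoc, L.incl_frob, ← Category.assoc, ← Category.assoc,
      absFrobenius_naturality fZ' fZ e.hom]

/-- The lifting of the product with the factors exchanged. -/
noncomputable def swap : FrobeniusLifting p (prodStr g f) :=
  L.ofIso (pullbackSymmetry g f) (by simp [pullback.condition])

/-- Descent by retraction first gives Frobenius families on both factors. Each is used only for the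
vanishing needed to lift the projection to the other factor. -/
theorem exists_isProduct [Smooth f] [Smooth g] [IsProper f] [IsProper g] [GeometricallyConnected f]
    [GeometricallyConnected g] [Nonempty X] [Nonempty Y] :
    ∃ (LX : FrobeniusLifting p f) (LY : FrobeniusLifting p g), L.IsProduct LX LY := by
  obtain ⟨ΦX⟩ := exists_frobFamily_left f g L
  obtain ⟨ΦY⟩ := exists_frobFamily_left g f L.swap
  obtain ⟨LX, q₁, h₁, hi₁, hF₁⟩ := L.exists_hom_left ΦY
  obtain ⟨LY, q₂, h₂, hi₂, hF₂⟩ := L.swap.exists_hom_left ΦX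
  change L.scheme ⟶ LY.scheme at q₂
  change q₂ ≫ LY.str = L.str at h₂
  change ((pullbackSymmetry g f).hom ≫ L.incl) ≫ q₂ = _ at hi₂
  change L.frob ≫ q₂ = q₂ ≫ LY.frob at hF₂
  have hi₂' : L.incl ≫ q₂ = pullback.snd f g ≫ LY.incl := by
    rw [Category.assoc, ← Iso.eq_inv_comp, ← Category.assoc] at hi₂
    rw [hi₂]
    simp
  let q : L.scheme ⟶ pullback LX.str LY.str := pullback.lift q₁ q₂ (h₁.trans h₂.symm)
  have hq₁ : q ≫ pullback.fst LX.str LY.str = q₁ := pullback.lift_fst _ _ _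
  have hq₂ : q ≫ pullback.snd LX.str LY.str = q₂ := pullback.lift_snd _ _ _
  have hq : IsIso q := by
    refine isIso_of_incl L (LX.prod LY) q ?_
    change L.incl ≫ q = pullback.map f g LX.str LY.str LX.incl LY.incl (specReduction p k)
      LX.isPullback.w.symm LY.isPullback.w.symm
    apply pullback.hom_ext
    · exact (Category.assoc _ _ _).trans ((congrArg (L.incl ≫ ·) hq₁).trans
        (hi₁.trans (pullback.lift_fst _ _ _).symm))
    · exact (Category.assoc _ _ _).trans ((congrArg (L.incl ≫ ·) hq₂).trans
        (hi₂'.trans (pullback.lift_snd _ _ _).symm))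
  refine ⟨LX, LY, q₁, q₂, h₁, h₂, ?_, hi₁, hi₂', hF₁, hF₂⟩
  exact IsPullback.of_iso_pullback ⟨h₁.trans h₂.symm⟩ (asIso q) hq₁ hq₂

end FrobeniusLifting

theorem IsFLiftable.left [Smooth f] [Nonempty Y] (h : IsFLiftable p (prodStr f g)) :
    IsFLiftable p f := by
  obtain ⟨L⟩ := h
  have := isReduced_of_smooth_hom f
  obtain ⟨Φ⟩ := exists_frobFamily_left f g L
  obtain ⟨LX, -⟩ := Φ.exists_lifting_hom f
  exact ⟨LX⟩

end

end

end FLift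

theorem mainTheorem8 (p : ℕ) [Fact p.Prime] {k : Type u} [Field k] [CharP k p] [PerfectField k]
    {X Y : Scheme.{u}} (f : X ⟶ Spec (.of k)) (g : Y ⟶ Spec (.of k))
    [Smooth f] [IsProper f] [Smooth g] [IsProper g] [Nonempty X] [Nonempty Y] :
    (FLift.IsFLiftable p (FLift.prodStr f g) ↔
      FLift.IsFLiftable p f ∧ FLift.IsFLiftable p g) ∧
    (GeometricallyConnected f → GeometricallyConnected g →
      ∀ L : FLift.FrobeniusLifting p (FLift.prodStr f g),
        ∃ (LX : FLift.FrobeniusLifting p f) (LY : FLift.FrobeniusLifting p g),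
          L.IsProduct LX LY) := by
  refine ⟨⟨fun h => ⟨FLift.IsFLiftable.left f g h, FLift.IsFLiftable.left g f ?_⟩, ?_⟩,
    fun _ _ L => L.exists_isProduct⟩
  · obtain ⟨L⟩ := h
    exact ⟨L.swap⟩
  · rintro ⟨⟨LX⟩, ⟨LY⟩⟩
    exact ⟨LX.prod LY⟩
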